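/- **Setting.** Let $b\ge 2$ be an integer and let $\mathbb T_b$ be the $b$-nary rooted tree, with root $\varnothing$; $m(\sigma)$ denotes the mother of a site $\sigma\neq\varnothing$. Let $\mathcal M$ be the set of Borel probability measures on $[0,1]$. For $\rho\in\mathcal M$ let $(X_\sigma)_{\sigma\in\mathbb T_b}$ be i.i.d. with law $\rho$ under $\mathbb P_\rho$, with expectation $\mathbb E_\rho$. Given $v\ge 0$, put $X^{(v)}_\varnothing(0)=X_\varnothing+v$ and $X^{(v)}_\sigma(0)=X_\sigma$ for $\sigma\ne\varnothing$, and for $t=0,1,2,\dots$ $$X^{(v)}_\sigma(t+1)=\begin{cases}X^{(v)}_\sigma(t)+\tfrac1b X^{(v)}_{m(\sigma)}(t) & \text{if }\sigma\neq\varnothing \text{ and } X^{(v)}_{m(\sigma)}(t)\ge 1,\\ 0 & \text{otherwise, if } X^{(v)}_\sigma(t)\ge1,\\ X^{(v)}_\sigma(t) & \text{otherwise.}\end{cases}$$ The avalanche $\mathscr A^{(v)}$ is the set of sites $\sigma$ for which there are times $s<t$ with $X^{(v)}_\sigma(t)=0$ and $X^{(v)}_\sigma(s)\neq0$; $|\mathscr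 A^{(v)}|\in\{0,1,2,\dots\}\cup\{\infty\}$ is its cardinality. For $\theta\ge1$ and $X_1,X_2,\dots$ i.i.d. with law $\rho$, let $Q^{(\theta)}_0=\theta$, $Q^{(\theta)}_{n}=X_{n}+\frac1b Q^{(\theta)}_{n-1}$ for $n\ge1$, and $Z_n(\theta)=\mathbb P(Q^{(\theta)}_k\ge1,\ k=0,\dots,n)$. The limit $\mathfrak z(\rho)=\lim_{n\to\infty}Z_n(\theta)^{1/n}$ exists and does not depend on $\theta\ge1$ (so one may take $\theta=1$). Put $z_c=\frac1b$ and $x_\star=x_\star(\rho)=\sup\{y\in[0,1]:\rho([y,1])>0\}$. Let $\mathcal M^\flat\subset\mathcal M$ be the set of those $\rho$ that have a density with respect to Lebesgue measure on $[0,1]$ bounded in $L^\infty$, and that satisfy $\rho([1-\frac1b,1])>0$. **Theorem 4.1.** Let $\rho\in\mathcal M^\flat$ satisfy $\mathfrak z(\rho)=z_c$. Then there are functions $\tau,\mathcal T\colon(1-x_\star,\infty)\to(0,\infty)$ and $\varTheta\colon[0,\infty)\to[0,\infty)$ such that the following holds. (1) If $\rho'\in\mathcal M^\flat$ and $\rho_\alpha=\alpha\rho'+(1-\alpha)\rho$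 satisfies $\mathfrak z(\rho_\alpha)<z_c$ for all $\alpha\in(0,1]$, then for all $v>1-x_\star$ (the left-hand side being finite for all sufficiently small $\alpha>0$) $$\mathbb E_{\rho_\alpha}\bigl(|\mathscr A^{(v)}|\bigr)=\frac{\tau(v)}{z_c-\mathfrak z(\rho_\alpha)}\,[1+o(1)],\qquad \alpha\downarrow0.$$ (2) For all $v\ge0$, $$\mathbb P_\rho\bigl(|\mathscr A^{(v)}|\ge n\bigr)=\frac{\varTheta(v)}{n^{1/2}}\,[1+o(1)],\qquad n\to\infty,$$ where $\varTheta(v)>0$ for $v>1-x_\star$. (3) If $\rho'\in\mathcal M^\flat$ and $\rho_\alpha=\alpha\rho'+(1-\alpha)\rho$ satisfies $\mathfrak z(\rho_\alpha)>z_c$ for all $\alpha\in(0,1]$, then for all $v>1-x_\star$, $$\mathbb P_{\rho_\alpha}\bigl(|\mathscr A^{(v)}|=\infty\bigr)=\bigl(\mathfrak z(\rho_\alpha)-z_c\bigr)\,\mathcal T(v)\,[1+o(1)],\qquad \alpha\downarrow0.$$ -/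

import Mathlib

open MeasureTheory ProbabilityTheory Filter Topology Asymptotics
open scoped unitInterval ENNReal NNReal

namespace TreeAvalanche

noncomputable section

/-! ### The avalanche process on the `b`-nary rooted tree -/

/-- A site of the `b`-nary rooted tree: a finite word `(σ₁, …, σₖ)` over an alphabet of `b` letters.
The root is the empty word, the layer is the length of the word, and the mother of a site
`s ≠ []` is the word `s.dropLast` with its last letter removed. -/
abbrev Site (b : ℕ) : Type := List (Fin b)

/-- An initial configuration of energies in `[0, 1]`. -/
abbrev Config (b : ℕ) : Type := Site b → I

/-- One step of the deterministic update rule. -/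
def step (b : ℕ) (X : Site b → ℝ) (s : Site b) : ℝ :=
  if s ≠ [] ∧ 1 ≤ X s.dropLast then X s + X s.dropLast / b
  else if 1 ≤ X s then 0
  else X s

/-- The process `X^{(v)}(t)` started from the configuration `ω` with the amount `v` added
at the root. -/
def process (b : ℕ) (ω : Config b) (v : ℝ) : ℕ → Site b → ℝ
  | 0 => fun s => if s = [] then (ω s : ℝ) + v else (ω s : ℝ)
  | t + 1 => step b (process b ω v t)

/-- The set of sites that have avalanched by time `t`. -/
def avalancheBy (b : ℕ) (ω : Config b) (v : ℝ) (t : ℕ) : Set (Site b) :=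
  {s | process b ω v t s = 0 ∧ ∃ r < t, process b ω v r s ≠ 0}

/-- The set of sites that ever avalanche. -/
def avalanche (b : ℕ) (ω : Config b) (v : ℝ) : Set (Site b) :=
  ⋃ t, avalancheBy b ω v t

/-- The law under which the energies of the sites are i.i.d. with distribution `ρ`. -/
def law (b : ℕ) (ρ : ProbabilityMeasure I) : Measure (Config b) :=
  Measure.infinitePi fun _ : Site b => (ρ : Measure I)

/-- The expected number of avalanched sites, as an element of `[0, ∞]`. -/
def expectedSize (b : ℕ) (ρ : ProbabilityMeasure I) (v : ℝ) : ℝ≥0∞ :=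
  ∫⁻ ω, ((avalanche b ω v).encard : ℝ≥0∞) ∂(law b ρ)

/-- The probability that at least `n` sites avalanche. -/
def probSizeGE (b : ℕ) (ρ : ProbabilityMeasure I) (v : ℝ) (n : ℕ) : ℝ :=
  (law b ρ).real {ω | (n : ℕ∞) ≤ (avalanche b ω v).encard}

/-- The probability that infinitely many sites avalanche. -/
def probInfinite (b : ℕ) (ρ : ProbabilityMeasure I) (v : ℝ) : ℝ :=
  (law b ρ).real {ω | (avalanche b ω v).Infinite}

/-! ### The class of measures -/

/-- The maximum of the support of `ρ`, that is `sup {y ∈ [0, 1] : ρ([y, 1]) > 0}`. -/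
def xStar (ρ : ProbabilityMeasure I) : ℝ :=
  sSup {y : ℝ | 0 ≤ y ∧ y ≤ 1 ∧ 0 < (ρ : Measure I) {x : I | y ≤ x}}

/-- Probability measures on `[0, 1]` which have an essentially bounded density with respect to
Lebesgue measure and which give positive mass to `[1 - 1/b, 1]`. -/
def IsFlat (b : ℕ) (ρ : ProbabilityMeasure I) : Prop :=
  (∃ φ : I → ℝ≥0∞, Measurable φ ∧ (∃ C : ℝ≥0, ∀ᵐ x, φ x ≤ C) ∧
    (ρ : Measure I) = (volume : Measure I).withDensity φ) ∧
  0 < (ρ : Measure I) {x : I | 1 - 1 / (b : ℝ) ≤ x}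

/-- The convex combination `α ρ' + (1 - α) ρ`. -/
def mix (ρ ρ' : ProbabilityMeasure I) (α : I) : ProbabilityMeasure I :=
  ⟨ENNReal.ofReal α • (ρ' : Measure I) + ENNReal.ofReal (1 - α) • (ρ : Measure I), ⟨by
    simp only [Measure.coe_add, Measure.coe_smul, Pi.add_apply, Pi.smul_apply, measure_univ,
      smul_eq_mul, mul_one]
    rw [← ENNReal.ofReal_add α.2.1 (sub_nonneg.2 α.2.2)]
    simp⟩⟩

/-! ### The functional `𝔷` -/

/-- `Q b θ x n = xₙ₋₁ + xₙ₋₂ / b + ⋯ + x₀ / b ^ (n - 1) + θ / b ^ n`. -/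
def Q (b : ℕ) (θ : ℝ) (x : ℕ → I) : ℕ → ℝ
  | 0 => θ
  | n + 1 => (x n : ℝ) + Q b θ x n / b

/-- The probability that `Q b θ x k ≥ 1` for `k = 0, …, n` when `x₀, x₁, …` are i.i.d. with
distribution `ρ`. -/
def Z (b : ℕ) (ρ : ProbabilityMeasure I) (n : ℕ) (θ : ℝ) : ℝ :=
  (Measure.infinitePi fun _ : ℕ => (ρ : Measure I)).real {x | ∀ k ≤ n, 1 ≤ Q b θ x k}

/-- The functional `𝔷(ρ) = lim Zₙ(θ)^{1/n}`, whose value is the same for all `θ ≥ 1`, taken here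
at `θ = 1`. That this limit always exists is `tendsto_frakZ`. -/
def frakZ (b : ℕ) (ρ : ProbabilityMeasure I) : ℝ :=
  limUnder atTop fun n : ℕ => Z b ρ n 1 ^ (1 / (n : ℝ))

/-! The rest of this section proves that the limit defining `frakZ` exists. -/

lemma Q_add_ge (b : ℕ) (x : ℕ → I) (m : ℕ) (hm : 1 ≤ Q b 1 x m) (k : ℕ) :
    Q b 1 (fun i => x (m + i)) k ≤ Q b 1 x (m + k) := by
  induction k with
  | zero => simpa [Q] using hm
  | succ k ih =>
    rw [← Nat.add_assoc]
    simp only [Q]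
    gcongr

lemma Q_congr (b : ℕ) (θ : ℝ) (x y : ℕ → I) (m : ℕ) (h : ∀ i < m, x i = y i) (k : ℕ)
    (hk : k ≤ m) : Q b θ x k = Q b θ y k := by
  induction k with
  | zero => rfl
  | succ k ih => simp only [Q]; rw [ih (by omega), h k (by omega)]

lemma measurable_Q (b : ℕ) (θ : ℝ) (k : ℕ) : Measurable fun x : ℕ → I => Q b θ x k := by
  induction k with
  | zero => exact measurable_const
  | succ k ih =>
    simp only [Q]
    exact ((measurable_subtype_coe.comp (measurable_pi_apply k))).add (ih.div_const _)

lemma measurableSet_surv (b : ℕ) (θ : ℝ) (n : ℕ) :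
    MeasurableSet {x : ℕ → I | ∀ k ≤ n, 1 ≤ Q b θ x k} := by
  have : {x : ℕ → I | ∀ k ≤ n, 1 ≤ Q b θ x k} = ⋂ k, ⋂ (_ : k ≤ n), {x | 1 ≤ Q b θ x k} := by
    ext; simp
  rw [this]
  exact MeasurableSet.iInter fun k => MeasurableSet.iInter fun _ =>
    measurableSet_le measurable_const (measurable_Q b θ k)

/-- Extension of a finite family by zero. -/
def ext0 (S : Finset ℕ) (y : S → I) (i : ℕ) : I := if h : i ∈ S then y ⟨i, h⟩ else 0

lemma measurable_ext0 (S : Finset ℕ) : Measurable (ext0 S) := by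
  refine measurable_pi_iff.2 fun i => ?_
  unfold ext0
  split_ifs with h
  · exact measurable_pi_apply _
  · exact measurable_const

lemma Z_mul_le (b : ℕ) (ρ : ProbabilityMeasure I) (m n : ℕ) :
    Z b ρ m 1 * Z b ρ n 1 ≤ Z b ρ (m + n) 1 := by
  set μ : Measure (ℕ → I) := Measure.infinitePi fun _ : ℕ => (ρ : Measure I) with hμ
  set E₁ : Set (ℕ → I) := {x | ∀ k ≤ m, 1 ≤ Q b 1 x k}
  set F : Set (ℕ → I) := {x | ∀ k ≤ n, 1 ≤ Q b 1 x k}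
  have hF : MeasurableSet F := measurableSet_surv b 1 n
  have hE₁ : MeasurableSet E₁ := measurableSet_surv b 1 m
  set sh : (ℕ → I) → (ℕ → I) := fun x i => x (m + i)
  have hsh : Measurable sh := by fun_prop
  have hmap : μ.map sh = μ :=
    Measure.map_infinitePi_infinitePi_of_inj (P := fun _ : ℕ => (ρ : Measure I))
      (f := fun i => m + i) (add_right_injective m)
  have hE₂ : μ (sh ⁻¹' F) = μ F := by
    rw [← Measure.map_apply hsh hF, hmap]
  have hind : iIndepFun (fun (i : ℕ) (x : ℕ → I) => x i) μ :=
    iIndepFun_infinitePi (P := fun _ : ℕ => (ρ : Measure I)) (X := fun _ x => x)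
      (fun _ => measurable_id)
  set S : Finset ℕ := Finset.range m
  set T : Finset ℕ := Finset.Ico m (m + n)
  have hST : Disjoint S T := by
    rw [Finset.disjoint_left]
    intro i hi hi'
    simp only [S, T, Finset.mem_range, Finset.mem_Ico] at hi hi'
    omega
  have hIF := hind.indepFun_finset S T hST (fun i => measurable_pi_apply i)
  have h₁ : E₁ = (fun (x : ℕ → I) (i : S) => x i) ⁻¹' (ext0 S ⁻¹' E₁) := by
    ext x
    have : ∀ k ≤ m, Q b 1 (ext0 S fun i => x i) k = Q b 1 x k := fun k hk =>
      Q_congr b 1 _ _ m (fun i hi => by simp [ext0, S, hi]) k hk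
    simp only [E₁, Set.mem_preimage, Set.mem_ofPred_eq]
    exact forall₂_congr fun k hk => by rw [this k hk]
  have h₂ : sh ⁻¹' F = (fun (x : ℕ → I) (i : T) => x i) ⁻¹' (ext0 T ⁻¹' (sh ⁻¹' F)) := by
    ext x
    have : ∀ k ≤ n, Q b 1 (sh (ext0 T fun i => x i)) k = Q b 1 (sh x) k := fun k hk =>
      Q_congr b 1 _ _ n (fun i hi => by simp [sh, ext0, T, hi]) k hk
    simp only [F, Set.mem_preimage, Set.mem_ofPred_eq]
    exact forall₂_congr fun k hk => by rw [this k hk]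
  have hmul : μ (E₁ ∩ sh ⁻¹' F) = μ E₁ * μ F := by
    rw [← hE₂]
    conv_lhs => rw [h₁, h₂]
    conv_rhs => rw [h₁, h₂]
    exact hIF.measure_inter_preimage_eq_mul _ _ (measurable_ext0 S hE₁)
      (measurable_ext0 T (hsh hF))
  have hsub : E₁ ∩ sh ⁻¹' F ⊆ {x | ∀ k ≤ m + n, 1 ≤ Q b 1 x k} := by
    rintro x ⟨hx₁, hx₂⟩ k hk
    rcases le_total k m with h | h
    · exact hx₁ k h
    · obtain ⟨j, rfl⟩ := Nat.exists_eq_add_of_le h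
      exact (hx₂ j (by omega)).trans (Q_add_ge b x m (hx₁ m le_rfl) j)
  change μ.real E₁ * μ.real F ≤ μ.real {x | ∀ k ≤ m + n, 1 ≤ Q b 1 x k}
  have : μ.real (E₁ ∩ sh ⁻¹' F) = μ.real E₁ * μ.real F := by
    simp only [Measure.real, hmul, ENNReal.toReal_mul]
  rw [← this]
  exact measureReal_mono hsub

theorem tendsto_frakZ (b : ℕ) (ρ : ProbabilityMeasure I) :
    Tendsto (fun n : ℕ => Z b ρ n 1 ^ (1 / (n : ℝ))) atTop (𝓝 (frakZ b ρ)) := by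
  refine tendsto_nhds_limUnder ?_
  have h0 : ∀ n, 0 ≤ Z b ρ n 1 := fun n => measureReal_nonneg
  have h1 : ∀ n, Z b ρ n 1 ≤ 1 := fun n => measureReal_le_one
  rcases (h0 1).eq_or_lt with hz | hz
  · refine ⟨0, tendsto_const_nhds.congr' ?_⟩
    filter_upwards [eventually_ge_atTop 1] with n hn
    have : Z b ρ n 1 ≤ Z b ρ 1 1 :=
      measureReal_mono fun x hx k hk => hx k (hk.trans hn)
    rw [← hz] at this
    rw [le_antisymm this (h0 n), Real.zero_rpow (by positivity)]
  · have hZ0 : Z b ρ 0 1 = 1 := by simp [Z, Q]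
    have hpos : ∀ n, 0 < Z b ρ n 1 := by
      intro n
      induction n with
      | zero => rw [hZ0]; exact one_pos
      | succ n ih => exact (mul_pos ih hz).trans_le (Z_mul_le b ρ n 1)
    have hsub : Subadditive fun n => -Real.log (Z b ρ n 1) := by
      intro m n
      have := Real.log_le_log (mul_pos (hpos m) (hpos n)) (Z_mul_le b ρ m n)
      rw [Real.log_mul (hpos m).ne' (hpos n).ne'] at this
      linarith
    have hbdd : BddBelow (Set.range fun n : ℕ => -Real.log (Z b ρ n 1) / n) :=
      ⟨0, by
        rintro _ ⟨n, rfl⟩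
        exact div_nonneg (neg_nonneg.2 (Real.log_nonpos (h0 n) (h1 n))) n.cast_nonneg⟩
    refine ⟨Real.exp (-hsub.lim), ?_⟩
    refine ((Real.continuous_exp.tendsto _).comp (hsub.tendsto_lim hbdd).neg).congr fun n => ?_
    rw [Function.comp_apply, Real.rpow_def_of_pos (hpos n)]
    congr 1
    ring

end

end TreeAvalanche

open TreeAvalanche

namespace TreeAvalanche

/-! ### Leading eigenvalue of a positive operator on continuous functions -/

section Perron

variable {S : Type*} [TopologicalSpace S] [CompactSpace S]

/-! Almost surely every initial energy is below one, and the avalanche then crosses the tree one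
layer per time step. A site avalanches exactly when the energies along the branch from the root,
each the site's own energy plus `1/b` times its mother's, all reach one (`avalanche_eq`). The
subtrees of the root are independent (`map_graft`), so this is a branching process whose type is the
energy `θ ∈ [1, K]`. Its mean operator is `b A`, with `(A f)(θ) = E[f(X + θ/b); X + θ/b ≥ 1]`
(`childOp`).

Spectral input. `A` has a leading eigenvalue `r` with an eigenvector `h` bounded below, a positive
left eigenvector `l`, and normalized powers close to `f ↦ l(f) h` (`PerronData`). This follows by
contracting the oscillation of `Aⁿ f / Aⁿ 1`, once the values of `Aⁿ 1` are comparable uniformly in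
`n` (`childOp_pow_comparable`) and some power of `A` satisfies Dobrushin's condition
(`childOp_dobrushin`). Absolute continuity makes `A` act on continuous functions and gives the
modulus of continuity behind Dobrushin's condition. Since `Zₙ` is `Aⁿ 1` at `θ = 1`, the functional
`frakZ` equals `r` (`frakZ_eq`), and criticality reads `b r = 1`. For mixtures `A_α → A` in operator
norm, hence `r_α → r` and `l_α → l` (`tendsto_perron_r`, `tendsto_perron_l`).

Below criticality the expected size is governed by the resolvent `U = 1 + b A_α U`. Pairing with
`l_α` gives `l_α(U) = 1 / (1 - b r_α)`, and `U` aligns with `h` (`tendsto_resolvent`).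

For the other two regimes each avalanching site is marked with probability `ε = 1 - s`. The
probability `u` that a subtree is infinite or marked solves `u = 1 - s (1 - A u)^b`. Near
criticality `u` is small and asymptotic to `κ h` with `κ = l_α(u)`, and the pairing reduces the
equation to the scalar relation `ε/κ² + ((1 - ε) b r_α - 1)/κ → c > 0` (`tendsto_nonlinear`). With
`ε = 0` this gives `κ ~ (b r_α - 1)/c`, the survival probability; with `b r = 1` it gives `κ ~
√(ε/c)`. The latter is a statement on the generating function of the tail of the size, which a
Tauberian theorem for monotone sequences (`tendsto_sqrt_mul_of_antitone`) turns into `n^(-1/2)`. -/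

lemma map_mono_of_pos {F : Type*} [AddCommGroup F] [PartialOrder F] [IsOrderedAddMonoid F]
    [TopologicalSpace F] [Module ℝ F] (B : C(S, ℝ) →L[ℝ] F)
    (hB : ∀ f, 0 ≤ f → 0 ≤ B f) {f g : C(S, ℝ)} (h : f ≤ g) : B f ≤ B g := by
  have := hB (g - f) (sub_nonneg.2 h)
  rwa [map_sub, sub_nonneg] at this

lemma pow_pos_of_pos {B : C(S, ℝ) →L[ℝ] C(S, ℝ)} (hB : ∀ f, 0 ≤ f → 0 ≤ B f) (n : ℕ) :
    ∀ f, 0 ≤ f → 0 ≤ (B ^ n) f := by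
  induction n with
  | zero => intro f hf; simpa using hf
  | succ n ih => intro f hf; rw [pow_succ']; exact hB _ (ih f hf)

lemma pow_one_ge {B : C(S, ℝ) →L[ℝ] C(S, ℝ)} (hB : ∀ f, 0 ≤ f → 0 ≤ B f) {p : ℝ} (hp0 : 0 ≤ p)
    (hp : ∀ θ, p ≤ B 1 θ) (n : ℕ) (θ : S) : p ^ n ≤ (B ^ n) 1 θ := by
  induction n generalizing θ with
  | zero => simp
  | succ n ih =>
    have h1 : (p ^ n) • (1 : C(S, ℝ)) ≤ (B ^ n) 1 := fun x => by simpa using ih x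
    have h2 : B _ θ ≤ B _ θ := map_mono_of_pos B hB h1 θ
    rw [pow_succ' B]
    simp only [map_smul, ContinuousMap.smul_apply, smul_eq_mul, mul_apply_eq_comp,
      Function.comp_apply] at h2 ⊢
    refine le_trans ?_ h2
    rw [pow_succ]
    exact mul_le_mul_of_nonneg_left (hp θ) (by positivity)

/-- One step of a positive operator satisfying Dobrushin's condition contracts the oscillation of
ratios. -/
lemma ratio_osc_contract {B : C(S, ℝ) →L[ℝ] C(S, ℝ)} (hB : ∀ f, 0 ≤ f → 0 ≤ B f) {C δ β : ℝ}
    (hC : 0 < C) (hβ : 0 < β) (hB1 : ∀ θ, B 1 θ ≤ β) (hδ0 : 0 < δ)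
    (hδ : ∀ f : C(S, ℝ), 0 ≤ f → f ≤ 1 → ∀ θ θ', δ ≤ B (1 - f) θ + B f θ')
    {w u : C(S, ℝ)} (hw : ∀ θ, 0 < w θ) (hwC : ∀ θ θ', w θ ≤ C * w θ') (hBw : ∀ θ, 0 < B w θ)
    {lo hi : ℝ} (hlo : ∀ θ, lo * w θ ≤ u θ) (hhi : ∀ θ, u θ ≤ hi * w θ) (θ θ' : S) :
    B u θ / B w θ - B u θ' / B w θ' ≤ (1 - δ / (C ^ 2 * β)) * (hi - lo) := by
  have hd : 0 ≤ hi - lo := by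
    have := (hlo θ).trans (hhi θ)
    nlinarith [hw θ]
  rcases hd.eq_or_lt with hd | hd
  · have : u = lo • w := by
      ext x
      have h1 := hlo x
      have h2 := hhi x
      rw [show hi = lo by linarith] at h2
      simpa using le_antisymm h2 h1
    rw [this, ← hd]
    simp only [map_smul, ContinuousMap.smul_apply, smul_eq_mul]
    rw [mul_div_assoc, mul_div_assoc, div_self (hBw θ).ne', div_self (hBw θ').ne']
    simp
  set d := hi - lo
  -- `q` is the relative position of `u / w` in `[lo, hi]`. The ratio at `θ` is expressed through `1
  -- - q` and the one at `θ'` through `q`, so that their difference is `d` times one minus a sum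
  -- that Dobrushin's condition bounds below.
  let q : C(S, ℝ) := ⟨fun x => (u x - lo * w x) / (d * w x), by
    refine Continuous.div (by fun_prop) (by fun_prop) fun x => (mul_pos hd (hw x)).ne'⟩
  have hq : ∀ x, q x = (u x - lo * w x) / (d * w x) := fun x => rfl
  have hq0 : 0 ≤ q := ContinuousMap.le_def.2 fun x => by
    rw [hq]; exact div_nonneg (by simpa using hlo x) (mul_pos hd (hw x)).le
  have hq1 : q ≤ 1 := ContinuousMap.le_def.2 fun x => by
    rw [hq, ContinuousMap.one_apply, div_le_one (mul_pos hd (hw x))]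
    have := hhi x
    simp only [d]; linarith
  have hu : u = lo • w + d • (w * q) := by
    ext x
    have := (hw x).ne'
    simp only [ContinuousMap.add_apply, ContinuousMap.smul_apply, ContinuousMap.mul_apply,
      smul_eq_mul, hq]
    field_simp
    ring
  set c := w θ
  have hc : 0 < c := hw θ
  have low : ∀ f : C(S, ℝ), 0 ≤ f → ∀ x, c / C * B f x ≤ B (w * f) x := by
    intro f hf x
    have : (c / C) • f ≤ w * f := fun y => by
      have h3 : c / C ≤ w y := by rw [div_le_iff₀' hC]; exact hwC θ y
      simpa using mul_le_mul_of_nonneg_right h3 (hf y)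
    simpa using map_mono_of_pos B hB this x
  have up : ∀ x, B w x ≤ C * c * β := by
    intro x
    have : w ≤ (C * c) • (1 : C(S, ℝ)) := fun y => by simpa using hwC y θ
    have h : B _ x ≤ B _ x := map_mono_of_pos B hB this x
    simp only [map_smul, ContinuousMap.smul_apply, smul_eq_mul] at h
    exact h.trans (mul_le_mul_of_nonneg_left (hB1 x) (by positivity))
  -- Comparability pinches `w` between `c / C` and `C c`; using the lower bound in the numerator and
  -- the upper one in the denominator leaves the factor `1 / (C² β)`.
  have key : ∀ f : C(S, ℝ), 0 ≤ f → ∀ x, B f x / (C ^ 2 * β) ≤ B (w * f) x / B w x := by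
    intro f hf x
    have h0 : 0 ≤ B f x := hB f hf x
    rw [div_le_div_iff₀ (by positivity) (hBw x)]
    calc B f x * B w x ≤ B f x * (C * c * β) := mul_le_mul_of_nonneg_left (up x) h0
      _ = (c / C * B f x) * (C ^ 2 * β) := by field_simp
      _ ≤ _ := mul_le_mul_of_nonneg_right (low f hf x) (by positivity)
  have e1 : B u θ / B w θ = lo + d * (1 - B (w * (1 - q)) θ / B w θ) := by
    have : w * q = w - w * (1 - q) := by ring
    rw [hu, this]
    have := (hBw θ).ne'
    simp only [map_add, map_smul, map_sub, ContinuousMap.add_apply, ContinuousMap.smul_apply,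
      ContinuousMap.sub_apply, smul_eq_mul]
    field_simp
  have e2 : B u θ' / B w θ' = lo + d * (B (w * q) θ' / B w θ') := by
    rw [hu]
    have := (hBw θ').ne'
    simp only [map_add, map_smul, ContinuousMap.add_apply, ContinuousMap.smul_apply, smul_eq_mul]
    field_simp
  have k1 := key (1 - q) (sub_nonneg.2 hq1) θ
  have k2 := key q hq0 θ'
  have k3 := hδ q hq0 hq1 θ θ'
  have k4 : δ / (C ^ 2 * β) ≤ B (w * (1 - q)) θ / B w θ + B (w * q) θ' / B w θ' :=
    le_trans (by rw [← add_div]; gcongr) (add_le_add k1 k2)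
  rw [e1, e2]
  nlinarith

/-- The data of an isolated simple leading eigenvalue `r` of a positive operator: the right
eigenvector `h`, the left eigenvector `l`, and the convergence of the normalized powers. -/
structure PerronData (A : C(S, ℝ) →L[ℝ] C(S, ℝ)) where
  r : ℝ
  h : C(S, ℝ)
  l : C(S, ℝ) →L[ℝ] ℝ
  c : ℝ
  r_pos : 0 < r
  c_pos : 0 < c
  h_ge : ∀ θ, c ≤ h θ
  l_pos : ∀ f, 0 ≤ f → 0 ≤ l f
  l_one : l 1 = 1
  l_h : l h = 1
  A_h : A h = r • h
  l_A : ∀ f, l (A f) = r * l f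
  conv : ∀ ε > 0, ∃ N : ℕ, ∀ f, ‖(r ^ N)⁻¹ • (A ^ N) f - l f • h‖ ≤ ε * ‖f‖

variable [Nonempty S]

lemma norm_le_of_abs_le {f : C(S, ℝ)} {M : ℝ} (h : ∀ θ, |f θ| ≤ M) : ‖f‖ ≤ M :=
  (ContinuousMap.norm_le_of_nonempty f).2 h

lemma abs_apply_le_norm (f : C(S, ℝ)) (θ : S) : |f θ| ≤ ‖f‖ := f.norm_coe_le_norm θ

lemma abs_le_norm_mul_one (B : C(S, ℝ) →L[ℝ] ℝ) (hB : ∀ f, 0 ≤ f → 0 ≤ B f)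
    (f : C(S, ℝ)) : |B f| ≤ ‖f‖ * B 1 := by
  have h1 : f ≤ ‖f‖ • (1 : C(S, ℝ)) := fun x => by
    simpa using (le_abs_self _).trans (abs_apply_le_norm f x)
  have h2 : (-‖f‖) • (1 : C(S, ℝ)) ≤ f := fun x => by
    simpa using (abs_le.1 (abs_apply_le_norm f x)).1
  have h3 := map_mono_of_pos B hB h1
  have h4 := map_mono_of_pos B hB h2
  simp only [map_smul, smul_eq_mul] at h3 h4
  exact abs_le.2 ⟨by linarith, h3⟩

lemma abs_map_le {B : C(S, ℝ) →L[ℝ] C(S, ℝ)} (hB : ∀ f, 0 ≤ f → 0 ≤ B f)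
    (f : C(S, ℝ)) (θ : S) : |B f θ| ≤ ‖f‖ * B 1 θ := by
  have h1 : f ≤ ‖f‖ • (1 : C(S, ℝ)) := fun x => by
    simpa using (le_abs_self _).trans (abs_apply_le_norm f x)
  have h2 : (-‖f‖) • (1 : C(S, ℝ)) ≤ f := fun x => by
    simpa using (abs_le.1 (abs_apply_le_norm f x)).1
  have h3 : B _ θ ≤ B _ θ := map_mono_of_pos B hB h1 θ
  have h4 : B _ θ ≤ B _ θ := map_mono_of_pos B hB h2 θ
  simp only [map_smul, ContinuousMap.smul_apply, smul_eq_mul] at h3 h4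
  exact abs_le.2 ⟨by linarith, h3⟩

/-- The leading eigenvalue data of a positive operator satisfying Dobrushin's condition in one
step, with comparable powers. -/
theorem exists_perronData_of_dobrushin {B : C(S, ℝ) →L[ℝ] C(S, ℝ)} (hB : ∀ f, 0 ≤ f → 0 ≤ B f)
    {p : ℝ} (hp0 : 0 < p) (hp : ∀ θ, p ≤ B 1 θ) {C : ℝ}
    (hC : ∀ n θ θ', (B ^ n) 1 θ ≤ C * (B ^ n) 1 θ') {δ : ℝ} (hδ0 : 0 < δ)
    (hδ : ∀ f : C(S, ℝ), 0 ≤ f → f ≤ 1 → ∀ θ θ', δ ≤ B (1 - f) θ + B f θ') :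
    Nonempty (PerronData B) := by
  obtain ⟨θ₀⟩ := ‹Nonempty S›
  have hne : Nonempty S := ⟨θ₀⟩
  have hC1 : 1 ≤ C := by simpa using hC 0 θ₀ θ₀
  have hC0 : 0 < C := by linarith
  have hpow : ∀ n θ, 0 < (B ^ n) 1 θ := fun n θ =>
    (pow_pos hp0 n).trans_le (pow_one_ge hB hp0.le hp n θ)
  set β := ‖B 1‖
  have hB1 : ∀ θ, B 1 θ ≤ β := fun θ => (le_abs_self _).trans (abs_apply_le_norm _ θ)
  have hβ : 0 < β := hp0.trans_le ((hp θ₀).trans (hB1 θ₀))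
  set γ := 1 - δ / (C ^ 2 * β)
  have hγ1 : γ < 1 := by
    have : 0 < δ / (C ^ 2 * β) := by positivity
    simp only [γ]; linarith
  have hγ0 : 0 ≤ γ := by
    have h1 : δ ≤ β := by simpa using (hδ 0 le_rfl zero_le_one θ₀ θ₀).trans (by simpa using hB1 θ₀)
    have : δ / (C ^ 2 * β) ≤ 1 := by
      rw [div_le_one (by positivity)]
      nlinarith [one_le_pow₀ hC1 (n := 2)]
    simp only [γ]; linarith
  -- The ranges of these ratios are nested in `n` and shrink by the factor `γ`, so the ratios
  -- converge geometrically to a constant function of `θ`; that constant, as a function of `f`, is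
  -- the left eigenvector.
  set R : ℕ → C(S, ℝ) → S → ℝ := fun n f θ => (B ^ n) f θ / (B ^ n) 1 θ with hR
  have hRc : ∀ n f, Continuous (R n f) := fun n f =>
    Continuous.div (by fun_prop) (by fun_prop) fun x => (hpow n x).ne'
  have succ_apply : ∀ n f, (B ^ (n + 1)) f = B ((B ^ n) f) := fun n f => by rw [pow_succ']; rfl
  have step : ∀ n f, ∃ θm θM, (∀ θ, R n f θm ≤ R n f θ) ∧ (∀ θ, R n f θ ≤ R n f θM) ∧
      (∀ θ, R n f θm ≤ R (n + 1) f θ) ∧ (∀ θ, R (n + 1) f θ ≤ R n f θM) ∧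
      ∀ θ θ', R (n + 1) f θ - R (n + 1) f θ' ≤ γ * (R n f θM - R n f θm) := by
    intro n f
    obtain ⟨θm, -, hm⟩ := isCompact_univ.exists_isMinOn Set.univ_nonempty (hRc n f).continuousOn
    obtain ⟨θM, -, hM⟩ := isCompact_univ.exists_isMaxOn Set.univ_nonempty (hRc n f).continuousOn
    have hm' : ∀ θ, R n f θm ≤ R n f θ := fun θ => hm (Set.mem_univ θ)
    have hM' : ∀ θ, R n f θ ≤ R n f θM := fun θ => hM (Set.mem_univ θ)
    have lo : ∀ θ, R n f θm * (B ^ n) 1 θ ≤ (B ^ n) f θ := fun θ =>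
      (le_div_iff₀ (hpow n θ)).1 (hm' θ)
    have hi : ∀ θ, (B ^ n) f θ ≤ R n f θM * (B ^ n) 1 θ := fun θ =>
      (div_le_iff₀ (hpow n θ)).1 (hM' θ)
    refine ⟨θm, θM, hm', hM', fun θ => ?_, fun θ => ?_, fun θ θ' => ?_⟩
    · simp only [R]
      rw [le_div_iff₀ (hpow _ θ), succ_apply, succ_apply]
      have : R n f θm • (B ^ n) 1 ≤ (B ^ n) f := lo
      have h : B _ θ ≤ B _ θ := map_mono_of_pos B hB this θ
      rwa [map_smul] at h
    · simp only [R]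
      rw [div_le_iff₀ (hpow _ θ), succ_apply, succ_apply]
      have : (B ^ n) f ≤ R n f θM • (B ^ n) 1 := hi
      have h : B _ θ ≤ B _ θ := map_mono_of_pos B hB this θ
      rwa [map_smul] at h
    · have hBw : ∀ θ, 0 < B ((B ^ n) 1) θ := fun θ => by rw [← succ_apply]; exact hpow _ θ
      have := ratio_osc_contract hB hC0 hβ hB1 hδ0 hδ (hpow n) (hC n) hBw lo hi θ θ'
      simpa only [R, succ_apply] using this
  have osc : ∀ n f θ θ', R n f θ - R n f θ' ≤ 2 * ‖f‖ * γ ^ n := by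
    intro n f
    induction n with
    | zero =>
      intro θ θ'
      have h1 := abs_le.1 (abs_apply_le_norm f θ)
      have h2 := abs_le.1 (abs_apply_le_norm f θ')
      simp only [R, pow_zero, one_apply_eq_self, ContinuousMap.one_apply, div_one, mul_one]
      linarith
    | succ n ih =>
      intro θ θ'
      obtain ⟨θm, θM, -, -, -, -, h⟩ := step n f
      refine (h θ θ').trans ?_
      rw [pow_succ]
      have := mul_le_mul_of_nonneg_left (ih θM θm) hγ0
      linarith
  have near : ∀ n f θ, dist (R n f θ) (R (n + 1) f θ) ≤ 2 * ‖f‖ * γ ^ n := by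
    intro n f θ
    obtain ⟨θm, θM, h1, h2, h3, h4, -⟩ := step n f
    rw [Real.dist_eq, abs_le]
    have := osc n f θM θm
    exact ⟨by linarith [h1 θ, h2 θ, h3 θ, h4 θ], by linarith [h1 θ, h2 θ, h3 θ, h4 θ]⟩
  have lim : ∀ f, ∃ x, Tendsto (fun n => R n f θ₀) atTop (𝓝 x) := fun f =>
    cauchySeq_tendsto_of_complete (cauchySeq_of_le_geometric γ _ hγ1 fun n => near n f θ₀)
  choose L hL using lim
  set K₁ := 2 / (1 - γ) + 2
  have hγ' : 0 < 1 - γ := by linarith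
  have hK₁ : 0 < K₁ := by positivity
  have rate : ∀ n f θ, |R n f θ - L f| ≤ K₁ * ‖f‖ * γ ^ n := by
    intro n f θ
    have h1 := dist_le_of_le_geometric_of_tendsto γ _ hγ1 (fun n => near n f θ₀) (hL f) n
    rw [Real.dist_eq, abs_le] at h1
    have h2 := osc n f θ θ₀
    have h3 := osc n f θ₀ θ
    have h4 : K₁ * ‖f‖ * γ ^ n = 2 * ‖f‖ * γ ^ n / (1 - γ) + 2 * ‖f‖ * γ ^ n := by
      simp only [K₁]; ring
    rw [h4, abs_le]
    constructor <;> linarith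
  have limθ : ∀ f θ, Tendsto (fun n => R n f θ) atTop (𝓝 (L f)) := by
    intro f θ
    rw [tendsto_iff_norm_sub_tendsto_zero]
    refine squeeze_zero (fun n => norm_nonneg _) (fun n => rate n f θ) ?_
    simpa using (tendsto_pow_atTop_nhds_zero_of_lt_one hγ0 hγ1).const_mul (K₁ * ‖f‖)
  have bnd : ∀ n f θ, |R n f θ| ≤ ‖f‖ := by
    intro n f θ
    simp only [R]
    rw [abs_div, abs_of_pos (hpow n θ), div_le_iff₀ (hpow n θ)]
    exact abs_map_le (pow_pos_of_pos hB n) f θ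
  let l : C(S, ℝ) →L[ℝ] ℝ := LinearMap.mkContinuous
    { toFun := L
      map_add' := fun f g => tendsto_nhds_unique (hL (f + g))
        (((hL f).add (hL g)).congr fun n => by simp only [R, map_add, ContinuousMap.add_apply]; ring)
      map_smul' := fun a f => tendsto_nhds_unique (hL (a • f))
        (((hL f).const_mul a).congr fun n => by
          simp only [R, map_smul, ContinuousMap.smul_apply, smul_eq_mul]; ring) } 1
    fun f => by
      rw [one_mul]
      exact le_of_tendsto (hL f).norm (Eventually.of_forall fun n => bnd n f θ₀)
  have hl : ∀ f, l f = L f := fun f => rfl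
  have lpos : ∀ f, 0 ≤ f → 0 ≤ L f := fun f hf => ge_of_tendsto' (hL f) fun n =>
    div_nonneg (pow_pos_of_pos hB n f hf θ₀) (hpow n θ₀).le
  have lone : L 1 = 1 := tendsto_nhds_unique (hL 1) (tendsto_const_nhds.congr fun n => by
    simp only [R]; rw [div_self (hpow n θ₀).ne'])
  set r := L (B 1)
  have hr : 0 < r := by
    have h1 : p • (1 : C(S, ℝ)) ≤ B 1 := fun x => by simpa using hp x
    have h2 := map_mono_of_pos l lpos h1
    rw [map_smul, hl, hl, lone] at h2
    simp only [smul_eq_mul, mul_one] at h2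
    exact hp0.trans_le h2
  -- Limit of the identity `R n (B f) = R n (B 1) * R (n + 1) f`.
  have lB : ∀ f, L (B f) = r * L f := by
    intro f
    refine tendsto_nhds_unique (hL (B f)) ((((hL (B 1)).mul ((hL f).comp (tendsto_add_atTop_nat 1)))).congr
      fun n => ?_)
    have e : ∀ g, (B ^ n) (B g) = (B ^ (n + 1)) g := fun g => by rw [pow_succ]; rfl
    simp only [R, Function.comp_apply, e]
    have h1 := (hpow n θ₀).ne'
    have h2 := (hpow (n + 1) θ₀).ne'
    field_simp
  have lBn : ∀ n, L ((B ^ n) 1) = r ^ n := by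
    intro n
    induction n with
    | zero => simpa using lone
    | succ n ih => rw [succ_apply, lB, ih, pow_succ, mul_comm]
  have upn : ∀ n θ, (B ^ n) 1 θ ≤ C * r ^ n := by
    intro n θ
    have h1 : ((B ^ n) 1 θ / C) • (1 : C(S, ℝ)) ≤ (B ^ n) 1 := fun x => by
      have : (B ^ n) 1 θ / C ≤ (B ^ n) 1 x := by rw [div_le_iff₀' hC0]; exact hC n θ x
      simpa using this
    have h2 := map_mono_of_pos l lpos h1
    rw [map_smul, hl, hl, lone, lBn, smul_eq_mul, mul_one, div_le_iff₀' hC0] at h2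
    exact h2
  have lown : ∀ n θ, r ^ n / C ≤ (B ^ n) 1 θ := by
    intro n θ
    have h1 : (B ^ n) 1 ≤ (C * (B ^ n) 1 θ) • (1 : C(S, ℝ)) := fun x => by
      simpa using hC n x θ
    have h2 := map_mono_of_pos l lpos h1
    rw [map_smul, hl, hl, lone, lBn, smul_eq_mul, mul_one] at h2
    rwa [div_le_iff₀' hC0]
  -- The right eigenvector is the limit of `H`. The increment `H (n + 1) - H n` is `H n` times `(R n
  -- (B 1) - r) / r`, which is geometrically small.
  set H : ℕ → C(S, ℝ) := fun n => (r ^ n)⁻¹ • (B ^ n) 1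
  have hH : ∀ n θ, H n θ = (B ^ n) 1 θ / r ^ n := fun n θ => by
    simp only [H, ContinuousMap.smul_apply, smul_eq_mul]; ring
  have hHC : ∀ n θ, |H n θ| ≤ C := fun n θ => by
    rw [hH, abs_of_pos (div_pos (hpow n θ) (pow_pos hr n)), div_le_iff₀ (pow_pos hr n)]
    exact upn n θ
  set K₂ := C * (K₁ * ‖B 1‖ / r)
  have hHd : ∀ n, dist (H n) (H (n + 1)) ≤ K₂ * γ ^ n := by
    intro n
    rw [dist_comm, dist_eq_norm]
    refine norm_le_of_abs_le fun θ => ?_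
    have h1 : H (n + 1) θ - H n θ = H n θ * ((R n (B 1) θ - L (B 1)) / r) := by
      have e : (B ^ n) (B 1) = (B ^ (n + 1)) 1 := by rw [pow_succ]; rfl
      simp only [hH, R, e]
      have h1 := (hpow n θ).ne'
      have h3 := hr.ne'
      change _ = _ * ((_ - r) / r)
      rw [pow_succ r]
      field_simp
    rw [ContinuousMap.sub_apply, h1, abs_mul, abs_div, abs_of_pos hr]
    calc |H n θ| * (|R n (B 1) θ - L (B 1)| / r) ≤ C * ((K₁ * ‖B 1‖ * γ ^ n) / r) := by
          gcongr
          · exact hHC n θ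
          · exact rate n (B 1) θ
      _ = _ := by simp only [K₂]; ring
  obtain ⟨h, hh⟩ := cauchySeq_tendsto_of_complete (cauchySeq_of_le_geometric γ _ hγ1 hHd)
  have hHh : ∀ n, ‖H n - h‖ ≤ K₂ * γ ^ n / (1 - γ) := fun n => by
    rw [← dist_eq_norm]; exact dist_le_of_le_geometric_of_tendsto γ _ hγ1 hHd hh n
  have hhθ : ∀ θ, Tendsto (fun n => H n θ) atTop (𝓝 (h θ)) := fun θ =>
    ((continuous_eval_const θ).tendsto h).comp hh
  have Bh : B h = r • h := by
    refine tendsto_nhds_unique ((B.continuous.tendsto h).comp hh)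
      (((hh.comp (tendsto_add_atTop_nat 1)).const_smul r).congr fun n => ?_)
    simp only [H, Function.comp_apply, map_smul, ← succ_apply, smul_smul]
    congr 1
    have := hr.ne'
    rw [pow_succ]
    field_simp
  have lh : L h = 1 := by
    refine tendsto_nhds_unique ((l.continuous.tendsto h).comp hh) (tendsto_const_nhds.congr
      fun n => ?_)
    simp only [H, Function.comp_apply, map_smul, smul_eq_mul]
    rw [hl, lBn, inv_mul_cancel₀ (pow_pos hr n).ne']
  set K₃ := C * K₁ + K₂ / (1 - γ)
  have hK₂ : 0 ≤ K₂ := by positivity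
  have conv : ∀ n f, ‖(r ^ n)⁻¹ • (B ^ n) f - l f • h‖ ≤ K₃ * γ ^ n * ‖f‖ := by
    intro n f
    refine norm_le_of_abs_le fun θ => ?_
    have h1 : ((r ^ n)⁻¹ • (B ^ n) f - l f • h) θ
        = H n θ * (R n f θ - L f) + L f * ((H n - h) θ) := by
      simp only [ContinuousMap.sub_apply, ContinuousMap.smul_apply, smul_eq_mul, hH, R, hl]
      have h1 := (hpow n θ).ne'
      have h3 := hr.ne'
      field_simp
      ring
    rw [h1]
    have hLf : |L f| ≤ ‖f‖ := le_of_tendsto (hL f).norm (Eventually.of_forall fun n => bnd n f θ₀)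
    calc _ ≤ |H n θ| * |R n f θ - L f| + |L f| * |(H n - h) θ| := by
          rw [← abs_mul, ← abs_mul]; exact abs_add_le _ _
      _ ≤ C * (K₁ * ‖f‖ * γ ^ n) + ‖f‖ * (K₂ * γ ^ n / (1 - γ)) := by
          gcongr
          · exact hHC n θ
          · exact rate n f θ
          · exact (abs_apply_le_norm _ θ).trans (hHh n)
      _ = _ := by simp only [K₃]; ring
  refine ⟨{ r := r, h := h, l := l, c := 1 / C, r_pos := hr, c_pos := by positivity,
            h_ge := fun θ => ?_, l_pos := lpos, l_one := lone, l_h := lh, A_h := Bh, l_A := lB,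
            conv := fun ε hε => ?_ }⟩
  · refine ge_of_tendsto' (hhθ θ) fun n => ?_
    rw [hH, le_div_iff₀ (pow_pos hr n)]
    have := lown n θ
    rwa [one_div, inv_mul_eq_div]
  · have ht : Tendsto (fun n => K₃ * γ ^ n) atTop (𝓝 0) := by
      simpa using (tendsto_pow_atTop_nhds_zero_of_lt_one hγ0 hγ1).const_mul K₃
    obtain ⟨N, hN⟩ := (ht.eventually (gt_mem_nhds hε)).exists
    exact ⟨N, fun f => (conv N f).trans (by gcongr)⟩

/-- The leading eigenvalue data of a positive operator some power of which satisfies Dobrushin's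
condition. -/
theorem exists_perronData {A : C(S, ℝ) →L[ℝ] C(S, ℝ)} (hA : ∀ f, 0 ≤ f → 0 ≤ A f)
    {p : ℝ} (hp0 : 0 < p) (hp : ∀ θ, p ≤ A 1 θ) {C : ℝ}
    (hC : ∀ n θ θ', (A ^ n) 1 θ ≤ C * (A ^ n) 1 θ') {δ : ℝ} (hδ0 : 0 < δ) {m : ℕ}
    (hδ : ∀ f : C(S, ℝ), 0 ≤ f → f ≤ 1 → ∀ θ θ', δ ≤ (A ^ m) (1 - f) θ + (A ^ m) f θ') :
    Nonempty (PerronData A) := by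
  obtain ⟨θ₀⟩ := ‹Nonempty S›
  have hne : Nonempty S := ⟨θ₀⟩
  obtain ⟨D⟩ := exists_perronData_of_dobrushin (pow_pos_of_pos hA m) (pow_pos hp0 m)
    (pow_one_ge hA hp0.le hp m) (C := C) (fun n θ θ' => by rw [← pow_mul]; exact hC _ θ θ') hδ0 hδ
  set B := A ^ m
  have comm : ∀ n f, (B ^ n) (A f) = A ((B ^ n) f) := by
    intro n f
    have : Commute (B ^ n) A := ((Commute.refl A).pow_left m).pow_left n
    exact DFunLike.congr_fun this.eq f
  have hfix : ∀ n, (D.r ^ n)⁻¹ • (B ^ n) D.h = D.h := by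
    intro n
    induction n with
    | zero => simp
    | succ n ih =>
      rw [pow_succ B]
      change (D.r ^ (n + 1))⁻¹ • (B ^ n) (B D.h) = _
      rw [D.A_h, map_smul, smul_smul, pow_succ, mul_inv, mul_assoc, inv_mul_cancel₀ D.r_pos.ne',
        mul_one, ih]
  set s := D.l (A D.h)
  -- `A` commutes with its power `B`, so `A h` is again fixed by the normalized powers of `B`; these
  -- send it close to a multiple of `h`. The dual argument gives the left eigenvector of `A`.
  have Ah : A D.h = s • D.h := by
    have : ∀ ε > 0, ‖A D.h - s • D.h‖ ≤ 0 + ε := by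
      intro ε hε
      obtain ⟨N, hN⟩ := D.conv (ε / (‖A D.h‖ + 1)) (by positivity)
      have := hN (A D.h)
      rw [comm, ← map_smul, hfix] at this
      refine this.trans ?_
      rw [zero_add, div_mul_eq_mul_div, div_le_iff₀ (by positivity)]
      nlinarith [norm_nonneg (A D.h)]
    have := le_of_forall_pos_le_add this
    exact sub_eq_zero.1 (norm_le_zero_iff.1 this)
  have lB : ∀ n f, D.l ((B ^ n) f) = D.r ^ n * D.l f := by
    intro n
    induction n with
    | zero => simp
    | succ n ih =>
      intro f
      rw [pow_succ]
      change D.l ((B ^ n) (B f)) = _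
      rw [ih, D.l_A]; ring
  have lA : ∀ f, D.l (A f) = s * D.l f := by
    intro f
    have : ∀ ε > 0, |D.l (A f) - s * D.l f| ≤ 0 + ε := by
      intro ε hε
      obtain ⟨N, hN⟩ := D.conv (ε / (‖D.l‖ * ‖A‖ * ‖f‖ + 1)) (by positivity)
      have h1 : D.l (A f) - s * D.l f = D.l (A ((D.r ^ N)⁻¹ • (B ^ N) f - D.l f • D.h)) := by
        rw [map_sub, map_sub, map_smul, ← comm, map_smul, lB, map_smul, Ah, map_smul, map_smul,
          D.l_h]
        have := (pow_pos D.r_pos N).ne'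
        simp only [smul_eq_mul]
        field_simp
      rw [h1]
      calc _ ≤ ‖D.l‖ * ‖A ((D.r ^ N)⁻¹ • (B ^ N) f - D.l f • D.h)‖ := D.l.le_opNorm _
        _ ≤ ‖D.l‖ * (‖A‖ * ‖(D.r ^ N)⁻¹ • (B ^ N) f - D.l f • D.h‖) := by
            gcongr; exact A.le_opNorm _
        _ ≤ ‖D.l‖ * (‖A‖ * (ε / (‖D.l‖ * ‖A‖ * ‖f‖ + 1) * ‖f‖)) := by gcongr; exact hN f
        _ = ε * ((‖D.l‖ * ‖A‖ * ‖f‖) / (‖D.l‖ * ‖A‖ * ‖f‖ + 1)) := by ring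
        _ ≤ ε * 1 := by
            gcongr
            rw [div_le_one (by positivity)]; linarith
        _ = _ := by ring
    have := le_of_forall_pos_le_add this
    exact sub_eq_zero.1 (abs_nonpos_iff.1 this)
  have hs : 0 < s := by
    have h1 : (D.c * p) • (1 : C(S, ℝ)) ≤ A D.h := by
      have h2 : D.c • (1 : C(S, ℝ)) ≤ D.h := fun x => by simpa using D.h_ge x
      refine le_trans (fun x => ?_) (map_mono_of_pos A hA h2)
      have := mul_le_mul_of_nonneg_left (hp x) D.c_pos.le
      simpa using this
    have h2 := map_mono_of_pos D.l D.l_pos h1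
    rw [map_smul, D.l_one, smul_eq_mul, mul_one] at h2
    exact (mul_pos D.c_pos hp0).trans_le h2
  have hrs : D.r = s ^ m := by
    have h1 : ∀ n, (A ^ n) D.h = s ^ n • D.h := by
      intro n
      induction n with
      | zero => simp
      | succ n ih =>
        rw [pow_succ]
        change (A ^ n) (A D.h) = _
        rw [Ah, map_smul, ih, smul_smul, pow_succ, mul_comm]
    have h2 := D.A_h
    rw [h1 m] at h2
    have h3 := congrArg D.l h2
    simpa [D.l_h] using h3.symm
  refine ⟨{ r := s, h := D.h, l := D.l, c := D.c, r_pos := hs, c_pos := D.c_pos, h_ge := D.h_ge,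
            l_pos := D.l_pos, l_one := D.l_one, l_h := D.l_h, A_h := Ah, l_A := lA,
            conv := fun ε hε => ?_ }⟩
  -- Only one exponent is required for each `ε`, so multiples of `m` suffice.
  obtain ⟨N, hN⟩ := D.conv ε hε
  refine ⟨m * N, fun f => ?_⟩
  rw [pow_mul, pow_mul, ← hrs]
  exact hN f

end Perron


/-! ### Perturbation of the leading eigenvalue; the linear resolvent -/

section Perturbation

variable {S : Type*} [TopologicalSpace S] [CompactSpace S] [Nonempty S]

lemma PerronData.abs_l_le {A : C(S, ℝ) →L[ℝ] C(S, ℝ)} (D : PerronData A) (f : C(S, ℝ)) :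
    |D.l f| ≤ ‖f‖ := by
  simpa [D.l_one] using abs_le_norm_mul_one D.l D.l_pos f

lemma PerronData.l_pow {A : C(S, ℝ) →L[ℝ] C(S, ℝ)} (D : PerronData A) (N : ℕ) (f : C(S, ℝ)) :
    D.l ((A ^ N) f) = D.r ^ N * D.l f := by
  induction N generalizing f with
  | zero => simp
  | succ n ih =>
    rw [pow_succ]
    change D.l ((A ^ n) (A f)) = _
    rw [ih, D.l_A]; ring

lemma PerronData.l_mono {A : C(S, ℝ) →L[ℝ] C(S, ℝ)} (D : PerronData A) {f g : C(S, ℝ)}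
    (h : f ≤ g) : D.l f ≤ D.l g := map_mono_of_pos D.l D.l_pos h

/-- Jensen's inequality for the normalized positive functional `l`: expand `l((f - l f)²) ≥ 0`. -/
lemma PerronData.sq_l_le {A : C(S, ℝ) →L[ℝ] C(S, ℝ)} (D : PerronData A) (f : C(S, ℝ)) :
    D.l f ^ 2 ≤ D.l (f ^ 2) := by
  set a := D.l f
  have h1 : 0 ≤ (f - a • (1 : C(S, ℝ))) ^ 2 := fun x => by
    simpa using sq_nonneg (f x - a)
  have h2 := D.l_pos _ h1
  have h3 : (f - a • (1 : C(S, ℝ))) ^ 2 = f ^ 2 - (2 * a) • f + (a ^ 2) • (1 : C(S, ℝ)) := by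
    ext x; simp; ring
  rw [h3, map_add, map_sub, map_smul, map_smul, D.l_one] at h2
  simp only [smul_eq_mul] at h2
  change 0 ≤ D.l (f ^ 2) - 2 * a * a + a ^ 2 * 1 at h2
  nlinarith

lemma tendsto_opNorm_sub {E G : Type*} [NormedAddCommGroup E] [NormedSpace ℝ E]
    [NormedAddCommGroup G] [NormedSpace ℝ G] {ι : Type*} {F : Filter ι} {A : E →L[ℝ] G}
    {Ak : ι → E →L[ℝ] G} : Tendsto Ak F (𝓝 A) ↔ Tendsto (fun k => ‖Ak k - A‖) F (𝓝 0) :=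
  tendsto_iff_norm_sub_tendsto_zero

lemma tendsto_opNorm_smul_pow_sub {E : Type*} [NormedAddCommGroup E] [NormedSpace ℝ E]
    {ι : Type*} {F : Filter ι} {A : E →L[ℝ] E} {Ak : ι → E →L[ℝ] E} (hA : Tendsto Ak F (𝓝 A))
    {a : ι → ℝ} {r : ℝ} (ha : Tendsto a F (𝓝 r)) (N : ℕ) :
    Tendsto (fun k => ‖a k • Ak k ^ N - r • A ^ N‖) F (𝓝 0) :=
  tendsto_opNorm_sub.1 (ha.smul (hA.pow N))

variable {ι : Type*} {F : Filter ι} {A : C(S, ℝ) →L[ℝ] C(S, ℝ)}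
  {Ak : ι → C(S, ℝ) →L[ℝ] C(S, ℝ)}

/-- Pairing the perturbed left eigenvector with the unperturbed right one gives `(r_k - r) l_k(h) =
l_k((A_k - A) h)`, and `l_k(h) ≥ c` because `l_k` is positive and normalized. -/
lemma tendsto_perron_r (D : PerronData A) (Dk : ∀ k, PerronData (Ak k))
    (hA : Tendsto Ak F (𝓝 A)) : Tendsto (fun k => (Dk k).r) F (𝓝 D.r) := by
  rw [tendsto_iff_norm_sub_tendsto_zero]
  have h0 : Tendsto (fun k => ‖Ak k - A‖ * ‖D.h‖ / D.c) F (𝓝 0) := by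
    have := ((tendsto_opNorm_sub (E := C(S, ℝ)) (G := C(S, ℝ))).1 hA).mul_const ‖D.h‖
    simpa using this.div_const D.c
  refine squeeze_zero (fun _ => norm_nonneg _) (fun k => ?_) h0
  have h1 : (Dk k).l ((Ak k - A) D.h) = ((Dk k).r - D.r) * (Dk k).l D.h := by
    change (Dk k).l (Ak k D.h - A D.h) = _
    rw [map_sub, (Dk k).l_A, D.A_h, map_smul, smul_eq_mul]; ring
  have h2 : D.c ≤ (Dk k).l D.h := by
    have : D.c • (1 : C(S, ℝ)) ≤ D.h := fun x => by simpa using D.h_ge x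
    simpa [(Dk k).l_one] using (Dk k).l_mono this
  rw [le_div_iff₀ D.c_pos]
  calc ‖(Dk k).r - D.r‖ * D.c ≤ ‖(Dk k).r - D.r‖ * (Dk k).l D.h := by gcongr
    _ = |(Dk k).l ((Ak k - A) D.h)| := by
        rw [h1, abs_mul, abs_of_pos (D.c_pos.trans_le h2), Real.norm_eq_abs]
    _ ≤ ‖(Ak k - A) D.h‖ := (Dk k).abs_l_le _
    _ ≤ _ := (Ak k - A).le_opNorm _

/-- By the eigenvalue equation `l_k(f) = l_k(r_k^{-N} A_k^N f)`. For a fixed large `N` this operator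
is norm close to `r^{-N} A^N`, hence to `f ↦ l(f) h`, so `l_k(f)` is close to `l(f) l_k(h)`
uniformly on the unit ball. -/
lemma tendsto_perron_l (D : PerronData A) (Dk : ∀ k, PerronData (Ak k))
    (hA : Tendsto Ak F (𝓝 A)) : Tendsto (fun k => (Dk k).l) F (𝓝 D.l) := by
  have hr := tendsto_perron_r D Dk hA
  refine (tendsto_opNorm_sub (E := C(S, ℝ)) (G := ℝ)).2 (Metric.tendsto_nhds.2 fun ε hε => ?_)
  obtain ⟨N, hN⟩ := D.conv (ε / 8) (by positivity)
  have hP := tendsto_opNorm_smul_pow_sub (E := C(S, ℝ)) hA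
    ((hr.pow N).inv₀ (pow_pos D.r_pos N).ne') N
  have hev := (Metric.tendsto_nhds.1 hP) (ε / 8) (by positivity)
  filter_upwards [hev] with k hk
  simp only [Real.dist_eq, sub_zero, abs_norm] at hk ⊢
  have b1 : ∀ f, |(Dk k).l f - D.l f * (Dk k).l D.h| ≤ ε / 4 * ‖f‖ := by
    intro f
    have e1 : (Dk k).l f = (Dk k).l (((Dk k).r ^ N)⁻¹ • (Ak k ^ N) f) := by
      rw [map_smul, (Dk k).l_pow, smul_eq_mul, inv_mul_cancel_left₀ (pow_pos (Dk k).r_pos N).ne']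
    have e2 : (Dk k).l f - D.l f * (Dk k).l D.h
        = (Dk k).l (((Dk k).r ^ N)⁻¹ • (Ak k ^ N) f - D.l f • D.h) := by
      rw [map_sub, ← e1, map_smul, smul_eq_mul]
    rw [e2]
    refine ((Dk k).abs_l_le _).trans ?_
    have e3 : ((Dk k).r ^ N)⁻¹ • (Ak k ^ N) f - D.l f • D.h
        = (((Dk k).r ^ N)⁻¹ • (Ak k ^ N) - (D.r ^ N)⁻¹ • A ^ N) f
          + ((D.r ^ N)⁻¹ • (A ^ N) f - D.l f • D.h) := by
      change _ = (((Dk k).r ^ N)⁻¹ • (Ak k ^ N) f - (D.r ^ N)⁻¹ • (A ^ N) f) + _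
      abel
    rw [e3]
    refine (norm_add_le _ _).trans ?_
    have := (ContinuousLinearMap.le_opNorm
      (((Dk k).r ^ N)⁻¹ • (Ak k ^ N) - (D.r ^ N)⁻¹ • A ^ N) f)
    nlinarith [hN f, norm_nonneg f]
  -- The choice `f = 1` shows `l_k(h)` close to one, which removes the unknown factor.
  have b2 := b1 1
  rw [(Dk k).l_one, D.l_one, one_mul, norm_one, mul_one] at b2
  refine lt_of_le_of_lt (ContinuousLinearMap.opNorm_le_bound _ (by positivity : 0 ≤ ε / 2)
    fun f => ?_) (by linarith)
  have e : ((Dk k).l - D.l) f = ((Dk k).l f - D.l f * (Dk k).l D.h)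
      - D.l f * (1 - (Dk k).l D.h) := by
    change (Dk k).l f - D.l f = _
    ring
  rw [e, Real.norm_eq_abs]
  refine (abs_sub _ _).trans ?_
  rw [abs_mul]
  have := mul_le_mul (D.abs_l_le f) b2 (abs_nonneg _) (norm_nonneg _)
  linarith [b1 f]

lemma isLittleO_map_sub (hA : Tendsto Ak F (𝓝 A)) (u : ι → C(S, ℝ)) :
    (fun k => Ak k (u k) - A (u k)) =o[F] u := by
  have h := (tendsto_opNorm_sub (E := C(S, ℝ)) (G := C(S, ℝ))).1 hA
  rw [isLittleO_iff]
  intro c hc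
  filter_upwards [h.eventually (gt_mem_nhds hc)] with k hk
  calc ‖Ak k (u k) - A (u k)‖ = ‖(Ak k - A) (u k)‖ := rfl
    _ ≤ ‖Ak k - A‖ * ‖u k‖ := (Ak k - A).le_opNorm _
    _ ≤ _ := by gcongr

/-- Approximate fixed points of `r⁻¹ A` are asymptotically multiples of the eigenvector. -/
lemma tendsto_profile (D : PerronData A) (Dk : ∀ k, PerronData (Ak k))
    (hA : Tendsto Ak F (𝓝 A)) {b : ℝ} (hb : b * D.r = 1) {u : ι → C(S, ℝ)}
    (hu0 : ∀ᶠ k in F, u k ≠ 0) (hu : (fun k => u k - b • Ak k (u k)) =o[F] u) :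
    (∀ᶠ k in F, (Dk k).l (u k) ≠ 0) ∧
      Tendsto (fun k => ((Dk k).l (u k))⁻¹ • u k) F (𝓝 D.h) := by
  have h1 : (fun k => u k - b • A (u k)) =o[F] u := by
    refine (hu.add ((isLittleO_map_sub hA u).const_smul_left b)).congr_left fun k => ?_
    simp only [Pi.smul_apply, smul_sub]; abel
  -- An approximate fixed point of `r⁻¹ A` is one of `r^{-N} A^N` for each fixed `N`; these powers
  -- nearly project onto the line of `h`.
  have hN : ∀ N : ℕ, (fun k => u k - (D.r ^ N)⁻¹ • (A ^ N) (u k)) =o[F] u := by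
    intro N
    induction N with
    | zero => simp
    | succ N ih =>
      have h2 := (((A ^ N).isBigO_comp _ F).trans_isLittleO h1).const_smul_left (D.r ^ N)⁻¹
      refine (ih.add h2).congr_left fun k => ?_
      have : (A ^ (N + 1)) (u k) = (A ^ N) (A (u k)) := by rw [pow_succ]; rfl
      have h3 : D.r⁻¹ = b := (eq_inv_of_mul_eq_one_left hb).symm
      simp only [Pi.smul_apply, map_sub, map_smul, smul_sub, smul_smul]
      rw [this, pow_succ D.r, mul_inv, h3]
      abel
  have h3 : (fun k => u k - D.l (u k) • D.h) =o[F] u := by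
    rw [isLittleO_iff]
    intro c hc
    obtain ⟨N, hN'⟩ := D.conv (c / 2) (by positivity)
    filter_upwards [(isLittleO_iff.1 (hN N)) (half_pos hc)] with k hk
    have : u k - D.l (u k) • D.h = (u k - (D.r ^ N)⁻¹ • (A ^ N) (u k))
        + ((D.r ^ N)⁻¹ • (A ^ N) (u k) - D.l (u k) • D.h) := by abel
    rw [this]
    refine (norm_add_le _ _).trans ?_
    linarith [hN' (u k)]
  have h4 : (fun k => ((Dk k).l (u k) - D.l (u k)) • D.h) =o[F] u := by
    have hl := (tendsto_opNorm_sub (E := C(S, ℝ)) (G := ℝ)).1 (tendsto_perron_l D Dk hA)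
    have : (fun k => (Dk k).l (u k) - D.l (u k)) =o[F] u := by
      rw [isLittleO_iff]
      intro c hc
      filter_upwards [hl.eventually (gt_mem_nhds hc)] with k hk
      calc ‖(Dk k).l (u k) - D.l (u k)‖ = ‖((Dk k).l - D.l) (u k)‖ := rfl
        _ ≤ ‖(Dk k).l - D.l‖ * ‖u k‖ := ((Dk k).l - D.l).le_opNorm _
        _ ≤ _ := by gcongr
    have h5 : (fun k => ((Dk k).l (u k) - D.l (u k)) • D.h)
        =O[F] (fun k => (Dk k).l (u k) - D.l (u k)) :=
      IsBigO.of_bound ‖D.h‖ (Eventually.of_forall fun k => by rw [norm_smul, mul_comm])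
    exact h5.trans_isLittleO this
  have h5 : (fun k => u k - (Dk k).l (u k) • D.h) =o[F] u :=
    (h3.sub h4).congr_left fun k => by rw [sub_smul]; abel
  -- Since `u - l_k(u) h = o(u)`, the size of `u` is controlled by `l_k(u)` alone. In particular
  -- `l_k(u)` cannot vanish when `u ≠ 0`.
  have h6 : u =O[F] fun k => (Dk k).l (u k) := by
    have h7 := h5.right_isBigO_sub
    have h8 : (fun k => u k - (u k - (Dk k).l (u k) • D.h)) =O[F] fun k => (Dk k).l (u k) :=
      IsBigO.of_bound ‖D.h‖ (Eventually.of_forall fun k => by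
        rw [sub_sub_cancel, norm_smul, mul_comm])
    exact h7.trans h8
  have h7 := h5.trans_isBigO h6
  have hne : ∀ᶠ k in F, (Dk k).l (u k) ≠ 0 := by
    obtain ⟨c, hc⟩ := h6.bound
    filter_upwards [hc, hu0] with k hk hk0 h0
    rw [h0, norm_zero, mul_zero] at hk
    exact hk0 (norm_le_zero_iff.1 hk)
  refine ⟨hne, ?_⟩
  rw [tendsto_iff_norm_sub_tendsto_zero]
  have h8 := h7.norm_norm.tendsto_div_nhds_zero
  refine h8.congr' ?_
  filter_upwards [hne] with k hk
  have : ((Dk k).l (u k))⁻¹ • u k - D.h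
      = ((Dk k).l (u k))⁻¹ • (u k - (Dk k).l (u k) • D.h) := by
    rw [smul_sub, smul_smul, inv_mul_cancel₀ hk, one_smul]
  rw [this, norm_smul, norm_inv]
  ring

/-- Behaviour of the resolvent applied to `1` near the leading eigenvalue. -/
lemma tendsto_resolvent [F.NeBot] (D : PerronData A) (Dk : ∀ k, PerronData (Ak k))
    (hA : Tendsto Ak F (𝓝 A)) {b : ℝ} (hb : b * D.r = 1) {u : ι → C(S, ℝ)}
    (hu : ∀ᶠ k in F, u k = 1 + b • Ak k (u k)) (hsub : ∀ᶠ k in F, b * (Dk k).r < 1) :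
    Tendsto (fun k => (1 - b * (Dk k).r) • u k) F (𝓝 D.h) := by
  have hr := tendsto_perron_r D Dk hA
  -- Pairing the resolvent equation with `l_k` identifies the size of `u`. It tends to infinity, so
  -- the source term `1` is `o(u)` and `u` is an approximate fixed point.
  have hl : ∀ᶠ k in F, (Dk k).l (u k) * (1 - b * (Dk k).r) = 1 := by
    filter_upwards [hu] with k hk
    have h1 := congrArg (Dk k).l hk
    rw [map_add, map_smul, (Dk k).l_one, (Dk k).l_A, smul_eq_mul] at h1
    linarith
  have hlinv : ∀ᶠ k in F, ((Dk k).l (u k))⁻¹ = 1 - b * (Dk k).r := by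
    filter_upwards [hl] with k hk
    exact inv_eq_of_mul_eq_one_right hk
  have h0 : Tendsto (fun k => 1 - b * (Dk k).r) F (𝓝 0) := by
    have := (hr.const_mul b).const_sub 1
    rwa [hb, sub_self] at this
  have hu0 : ∀ᶠ k in F, u k ≠ 0 := by
    filter_upwards [hl] with k hk h0
    rw [h0, map_zero, zero_mul] at hk
    exact zero_ne_one hk
  have hsmall : (fun k => u k - b • Ak k (u k)) =o[F] u := by
    rw [isLittleO_iff]
    intro c hc
    filter_upwards [hu, hl, hsub, h0.eventually (gt_mem_nhds hc)] with k hk hlk hs hck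
    have e : u k - b • Ak k (u k) = 1 := by
      nth_rewrite 1 [hk]; exact add_sub_cancel_right _ _
    rw [e, norm_one]
    have h1 : (Dk k).l (u k) ≤ ‖u k‖ := (le_abs_self _).trans ((Dk k).abs_l_le _)
    calc (1 : ℝ) = (Dk k).l (u k) * (1 - b * (Dk k).r) := hlk.symm
      _ ≤ ‖u k‖ * (1 - b * (Dk k).r) := by
          gcongr
      _ ≤ ‖u k‖ * c := by gcongr
      _ = _ := mul_comm _ _
  obtain ⟨-, h⟩ := tendsto_profile D Dk hA hb hu0 hsmall
  refine h.congr' ?_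
  filter_upwards [hlinv] with k hk
  rw [hk]

/-- The polynomial `q` with `(1 - x) ^ n = 1 - n x + x ^ 2 q(x)`. -/
def remPoly {R : Type*} [CommRing R] : ℕ → R → R
  | 0, _ => 0
  | n + 1, x => n + (1 - x) * remPoly n x

lemma one_sub_pow_eq {R : Type*} [CommRing R] (n : ℕ) (x : R) :
    (1 - x) ^ n = 1 - n * x + x ^ 2 * remPoly n x := by
  induction n with
  | zero => simp [remPoly]
  | succ n ih => rw [pow_succ, ih, remPoly]; push_cast; ring

lemma remPoly_nonneg (n : ℕ) {x : ℝ} (hx : x ≤ 1) : 0 ≤ remPoly n x := by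
  induction n with
  | zero => simp [remPoly]
  | succ n ih => rw [remPoly]; have := mul_nonneg (sub_nonneg.2 hx) ih; positivity

/-- The recursion gives `n - 1` plus a nonnegative term. This is where at least two children are
needed: otherwise the quadratic term would vanish. -/
lemma one_le_remPoly {n : ℕ} (hn : 1 < n) {x : ℝ} (hx : x ≤ 1) : 1 ≤ remPoly n x := by
  obtain ⟨m, rfl⟩ : ∃ m, n = m + 1 := ⟨n - 1, by omega⟩
  rw [remPoly]
  have h1 := mul_nonneg (sub_nonneg.2 hx) (remPoly_nonneg m hx)
  have : (1 : ℝ) ≤ m := by exact_mod_cast (by omega : 1 ≤ m)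
  linarith

lemma continuous_remPoly {R : Type*} [CommRing R] [TopologicalSpace R] [IsTopologicalRing R]
    (n : ℕ) : Continuous (remPoly n : R → R) := by
  induction n with
  | zero => simp only [remPoly]; exact continuous_const
  | succ n ih => simp only [remPoly]; fun_prop

lemma remPoly_apply {S : Type*} [TopologicalSpace S] (n : ℕ) (f : C(S, ℝ)) (x : S) :
    remPoly n f x = remPoly n (f x) := by
  induction n with
  | zero => simp [remPoly]
  | succ n ih => simp [remPoly, ih]

end Perturbation


/-! ### Small solutions of the nonlinear survival equation -/

section Perturbation

variable {S : Type*} [TopologicalSpace S] [CompactSpace S] [Nonempty S]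
variable {ι : Type*} {F : Filter ι} {A : C(S, ℝ) →L[ℝ] C(S, ℝ)}
  {Ak : ι → C(S, ℝ) →L[ℝ] C(S, ℝ)}

lemma tendsto_map_apply (hA : Tendsto Ak F (𝓝 A)) {w : ι → C(S, ℝ)} {x : C(S, ℝ)}
    (hw : Tendsto w F (𝓝 x)) : Tendsto (fun k => Ak k (w k)) F (𝓝 (A x)) := by
  have h1 : Tendsto (fun k => Ak k (w k) - A (w k)) F (𝓝 0) :=
    ((isLittleO_map_sub hA w).trans_isBigO (hw.isBigO_one ℝ)).tendsto_zero_of_tendsto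
      tendsto_const_nhds
  simpa using h1.add ((A.continuous.tendsto x).comp hw)

lemma tendsto_functional_apply {l : C(S, ℝ) →L[ℝ] ℝ} {lk : ι → C(S, ℝ) →L[ℝ] ℝ}
    (hl : Tendsto lk F (𝓝 l)) {w : ι → C(S, ℝ)} {x : C(S, ℝ)}
    (hw : Tendsto w F (𝓝 x)) : Tendsto (fun k => lk k (w k)) F (𝓝 (l x)) := by
  have h0 := (tendsto_opNorm_sub (E := C(S, ℝ)) (G := ℝ)).1 hl
  have h1 : Tendsto (fun k => lk k (w k) - l (w k)) F (𝓝 0) :=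
    squeeze_zero_norm (fun k => (lk k - l).le_opNorm (w k)) (by simpa using h0.mul hw.norm)
  simpa using h1.add ((l.continuous.tendsto x).comp hw)

/-- Small nonnegative solutions of `u = ε + (1 - ε) (1 - (1 - A u) ^ n)` near criticality. -/
lemma tendsto_nonlinear (D : PerronData A) (Dk : ∀ k, PerronData (Ak k))
    (hA : Tendsto Ak F (𝓝 A)) (hpos : ∀ f, 0 ≤ f → 0 ≤ A f)
    (hposk : ∀ k f, 0 ≤ f → 0 ≤ Ak k f) {n : ℕ} (hn : 1 < n)
    (hb : n * D.r = 1) {u : ι → C(S, ℝ)} {ε : ι → ℝ} (hε0 : ∀ᶠ k in F, 0 ≤ ε k)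
    (hε : Tendsto ε F (𝓝 0))
    (hu : ∀ᶠ k in F, 0 ≤ u k ∧ u k ≤ 1 ∧ Ak k (u k) ≤ 1 ∧ u k ≠ 0 ∧
      u k = ε k • (1 : C(S, ℝ)) + (1 - ε k) • ((n : ℝ) • Ak k (u k)
        - (Ak k (u k)) ^ 2 * remPoly n (Ak k (u k)))) :
    (∀ᶠ k in F, 0 < (Dk k).l (u k)) ∧ Tendsto (fun k => (Dk k).l (u k)) F (𝓝 0) ∧
      Tendsto (fun k => ((Dk k).l (u k))⁻¹ • u k) F (𝓝 D.h) ∧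
      Tendsto (fun k => ε k / (Dk k).l (u k) ^ 2 + ((1 - ε k) * (n * (Dk k).r) - 1) / (Dk k).l (u k))
        F (𝓝 (remPoly n 0 * D.r ^ 2 * D.l (D.h ^ 2))) := by
  have hr := tendsto_perron_r D Dk hA
  have hl := tendsto_perron_l D Dk hA
  have hln := (tendsto_opNorm_sub (E := C(S, ℝ)) (G := ℝ)).1 hl
  have hAn := (tendsto_opNorm_sub (E := C(S, ℝ)) (G := C(S, ℝ))).1 hA
  set κ : ι → ℝ := fun k => (Dk k).l (u k) with hκ
  set v : ι → C(S, ℝ) := fun k => Ak k (u k) with hv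
  set q : ι → C(S, ℝ) := fun k => remPoly n (v k) with hq
  have hq1 : ∀ᶠ k in F, 1 ≤ q k := by
    filter_upwards [hu] with k ⟨_, _, h3, _⟩
    refine ContinuousMap.le_def.2 fun x => ?_
    rw [hq, remPoly_apply]
    exact one_le_remPoly hn (h3 x)
  have hκ01 : ∀ᶠ k in F, 0 ≤ κ k ∧ κ k ≤ 1 := by
    filter_upwards [hu] with k ⟨h1, h2, _⟩
    refine ⟨(Dk k).l_pos _ h1, ?_⟩
    rw [← (Dk k).l_one]; exact (Dk k).l_mono h2
  have hnr : Tendsto (fun k => n * (Dk k).r) F (𝓝 1) := by rw [← hb]; exact hr.const_mul _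
  have hε1 : ∀ᶠ k in F, ε k < 1 := hε.eventually (gt_mem_nhds one_pos)
  have pair : ∀ᶠ k in F, κ k = ε k + (1 - ε k) * (n * (Dk k).r * κ k
      - (Dk k).l (v k ^ 2 * q k)) := by
    filter_upwards [hu] with k ⟨_, _, _, _, h⟩
    have h1 := congrArg (Dk k).l h
    rw [map_add, map_smul, map_smul, map_sub, map_smul, (Dk k).l_A, (Dk k).l_one] at h1
    simp only [smul_eq_mul] at h1
    rw [mul_one, ← mul_assoc] at h1
    exact h1
  -- the pairing with the left eigenvector tends to zero
  have hκ0 : Tendsto κ F (𝓝 0) := by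
    have hlim : Tendsto (fun k => (ε k + |n * (Dk k).r - 1|) / ((1 - ε k) * (Dk k).r ^ 2)) F
        (𝓝 0) := by
      have h1 : Tendsto (fun k => ε k + |n * (Dk k).r - 1|) F (𝓝 0) := by
        simpa using hε.add (hnr.sub_const 1).abs
      have h2 : Tendsto (fun k => (1 - ε k) * (Dk k).r ^ 2) F (𝓝 ((1 - 0) * D.r ^ 2)) :=
        (hε.const_sub 1).mul (hr.pow 2)
      have h3 := h1.div h2 (by have := D.r_pos; positivity)
      rw [zero_div] at h3
      exact h3
    -- As the remainder factor is at least one, Jensen bounds the quadratic term below by `(r_k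
    -- κ)²`. The paired equation then forces `(1 - ε) r_k² κ² ≤ ε + |n r_k - 1|`.
    have hsq : Tendsto (fun k => κ k ^ 2) F (𝓝 0) := by
      refine squeeze_zero' (Eventually.of_forall fun k => sq_nonneg _) ?_ hlim
      filter_upwards [hu, hq1, hκ01, pair, hε0, hε1] with k ⟨h1, h2, h3, h4, h5⟩ hqk ⟨k0, k1⟩ hp e0 e1
      have a1 : (Dk k).l (v k ^ 2) ≤ (Dk k).l (v k ^ 2 * q k) := by
        refine (Dk k).l_mono (ContinuousMap.le_def.2 fun x => ?_)
        have : (1 : ℝ) ≤ q k x := hqk x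
        have h0 := sq_nonneg (v k x)
        simp only [ContinuousMap.mul_apply, ContinuousMap.pow_apply]
        nlinarith
      have a2 : ((Dk k).r * κ k) ^ 2 ≤ (Dk k).l (v k ^ 2) := by
        rw [← (Dk k).l_A]; exact (Dk k).sq_l_le _
      rw [le_div_iff₀ (mul_pos (by linarith) (pow_pos (Dk k).r_pos 2))]
      have a3 := mul_le_mul_of_nonneg_left (a2.trans a1) (sub_nonneg.2 e1.le)
      have a4 : ((1 - ε k) * (n * (Dk k).r) - 1) * κ k ≤ |n * (Dk k).r - 1| := by
        have b1 : (1 - ε k) * (n * (Dk k).r) - 1 ≤ |n * (Dk k).r - 1| := by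
          have := le_abs_self (n * (Dk k).r - 1)
          have b2 : 0 ≤ n * (Dk k).r := by have := (Dk k).r_pos; positivity
          nlinarith
        calc _ ≤ |n * (Dk k).r - 1| * κ k := mul_le_mul_of_nonneg_right b1 k0
          _ ≤ |n * (Dk k).r - 1| * 1 := by gcongr
          _ = _ := mul_one _
      nlinarith
    have hsqrt : Tendsto (fun k => √(κ k ^ 2)) F (𝓝 √0) := (Real.continuous_sqrt.tendsto 0).comp hsq
    rw [Real.sqrt_zero] at hsqrt
    refine hsqrt.congr' ?_
    filter_upwards [hκ01] with k hk
    exact Real.sqrt_sq hk.1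
  have hnorm1 : ∀ᶠ k in F, ‖u k‖ ≤ 1 := by
    filter_upwards [hu] with k ⟨h1, h2, _⟩
    refine norm_le_of_abs_le fun x => ?_
    have h1' : (0 : ℝ) ≤ u k x := h1 x
    have h2' : u k x ≤ 1 := h2 x
    rw [abs_of_nonneg h1']; exact h2'
  have hlu : Tendsto (fun k => D.l (u k)) F (𝓝 0) := by
    have h1 : Tendsto (fun k => (Dk k).l (u k) - D.l (u k)) F (𝓝 0) := by
      refine squeeze_zero_norm' ?_ hln
      filter_upwards [hnorm1] with k hk
      exact ((Dk k).l - D.l).le_of_opNorm_le_of_le le_rfl hk |>.trans (mul_one _).le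
    simpa [hκ] using hκ0.sub h1
  -- Dropping the nonnegative quadratic term linearizes the equation into an inequality that can be
  -- iterated. Since `r^{-N} A^N u` is close to `l(u) h` and `l(u) → 0`, this upgrades the
  -- convergence of the pairing to uniform convergence of `u`.
  have hiter : ∀ N : ℕ, ∃ e : ι → ℝ, Tendsto e F (𝓝 0) ∧
      (∀ᶠ k in F, 0 ≤ e k) ∧ ∀ᶠ k in F, u k ≤ e k • (1 : C(S, ℝ)) + (D.r ^ N)⁻¹ • (A ^ N) (u k) := by
    have hrinv : D.r⁻¹ = n := (eq_inv_of_mul_eq_one_left hb).symm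
    intro N
    induction N with
    | zero =>
      exact ⟨fun _ => 0, tendsto_const_nhds, Eventually.of_forall fun k => le_rfl,
        Eventually.of_forall fun k => by simp⟩
    | succ N ih =>
      obtain ⟨e, he, hepos, hle⟩ := ih
      refine ⟨fun k => ε k + n * ‖Ak k - A‖ + e k * (n * ‖A 1‖), ?_, ?_, ?_⟩
      · simpa using (hε.add (hAn.const_mul (n : ℝ))).add (he.mul_const (n * ‖A 1‖))
      · filter_upwards [hε0, hepos] with k e0 e1
        positivity
      filter_upwards [hu, hle, hnorm1, hq1, hε0, hε1, hepos] with
        k ⟨h1, h2, h3, h4, h5⟩ hk hn1 hqk e0 e1 ek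
      refine ContinuousMap.le_def.2 fun x => ?_
      have c1 : u k x ≤ ε k + n * v k x := by
        have := DFunLike.congr_fun h5 x
        simp only [ContinuousMap.add_apply, ContinuousMap.smul_apply, ContinuousMap.sub_apply,
          ContinuousMap.mul_apply, ContinuousMap.pow_apply, ContinuousMap.one_apply,
          smul_eq_mul, mul_one] at this
        have q0 : (1 : ℝ) ≤ remPoly n (Ak k (u k)) x := hqk x
        have q1 := mul_nonneg (sq_nonneg (Ak k (u k) x)) (zero_le_one.trans q0)
        have q2 : 0 ≤ Ak k (u k) x := hposk k _ h1 x
        have q3 : (0 : ℝ) ≤ n * Ak k (u k) x := by positivity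
        simp only [hv]
        nlinarith
      have c2 : v k x ≤ A (u k) x + ‖Ak k - A‖ := by
        have h6 : |(Ak k - A) (u k) x| ≤ ‖Ak k - A‖ :=
          (abs_apply_le_norm _ x).trans (((Ak k - A).le_of_opNorm_le_of_le le_rfl hn1).trans
            (mul_one _).le)
        have h7 : (Ak k - A) (u k) x = v k x - A (u k) x := rfl
        linarith [le_abs_self ((Ak k - A) (u k) x)]
      have c3 : A (u k) x ≤ e k * A 1 x + (D.r ^ N)⁻¹ * (A ^ (N + 1)) (u k) x := by
        have h6 : A _ x ≤ A _ x := map_mono_of_pos A hpos hk x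
        have h7 : (A ^ (N + 1)) (u k) = A ((A ^ N) (u k)) := by rw [pow_succ']; rfl
        rw [map_add, map_smul, map_smul] at h6
        rw [h7]
        exact h6
      have c4 : A 1 x ≤ ‖A 1‖ := (le_abs_self _).trans (abs_apply_le_norm _ x)
      have c5 : (D.r ^ (N + 1))⁻¹ = n * (D.r ^ N)⁻¹ := by rw [pow_succ, mul_inv, hrinv, mul_comm]
      simp only [ContinuousMap.add_apply, ContinuousMap.smul_apply, ContinuousMap.one_apply,
        smul_eq_mul, mul_one]
      rw [c5]
      have c6 := mul_le_mul_of_nonneg_left c4 ek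
      have c7 := mul_le_mul_of_nonneg_left (c2.trans (add_le_add_left (c3.trans
        (add_le_add_left c6 _)) _)) (Nat.cast_nonneg n : (0 : ℝ) ≤ n)
      linarith
  have hu0 : Tendsto u F (𝓝 0) := by
    rw [tendsto_zero_iff_norm_tendsto_zero, Metric.tendsto_nhds]
    intro c hc
    obtain ⟨N, hN⟩ := D.conv (c / 4) (by positivity)
    obtain ⟨e, he, -, hle⟩ := hiter N
    have h2 := ((he.add (hlu.abs.mul_const ‖D.h‖)).eventually
      (gt_mem_nhds (by simpa using half_pos hc : (0 : ℝ) + |0| * ‖D.h‖ < c / 2)))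
    filter_upwards [hle, h2, hu, hnorm1] with k h3 h4 ⟨h5, _⟩ h6
    rw [Real.dist_eq, sub_zero, abs_norm]
    refine lt_of_le_of_lt (norm_le_of_abs_le (M := c / 2 + c / 4) fun x => ?_) (by linarith)
    have h5x : (0 : ℝ) ≤ u k x := h5 x
    rw [abs_of_nonneg h5x]
    have h7 : u k x ≤ e k + (D.r ^ N)⁻¹ * (A ^ N) (u k) x := by simpa using h3 x
    have h8 := (abs_apply_le_norm _ x).trans (hN (u k))
    simp only [ContinuousMap.sub_apply, ContinuousMap.smul_apply, smul_eq_mul] at h8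
    have h9 : D.l (u k) * D.h x ≤ |D.l (u k)| * ‖D.h‖ := by
      refine (le_abs_self _).trans ?_
      rw [abs_mul]
      gcongr
      exact abs_apply_le_norm _ x
    have h10 := (le_abs_self _).trans h8
    nlinarith
  have hv0 : Tendsto v F (𝓝 0) := by simpa using tendsto_map_apply hA hu0
  have hvO : v =O[F] fun k => ‖u k‖ := by
    have h1 := (isLittleO_map_sub hA u).isBigO.add (A.isBigO_comp u F)
    simpa using h1.norm_right
  have hq0 : Tendsto q F (𝓝 (remPoly n 0)) := ((continuous_remPoly n).tendsto 0).comp hv0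
  have hvq : (fun k => v k ^ 2 * q k) =o[F] fun k => ‖u k‖ := by
    have h1 : (fun k => v k * q k) =o[F] fun _ => (1 : ℝ) :=
      (isLittleO_one_iff ℝ).2 (by simpa using hv0.mul hq0)
    refine (h1.mul_isBigO hvO).congr (fun k => by ring) fun k => one_mul _
  have hκO : κ =O[F] fun k => ‖u k‖ :=
    IsBigO.of_bound 1 (Eventually.of_forall fun k => by simpa using (Dk k).abs_l_le (u k))
  -- The paired equation reads `ε (1 - n r_k κ) = (1 - n r_k) κ + (1 - ε) l_k(v² q)`, with both
  -- terms on the right negligible against `u`. So the killing is a small perturbation of the fixed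
  -- point equation, and `tendsto_profile` applies.
  have hεo : ε =o[F] fun k => ‖u k‖ := by
    have h1 : (fun k => (1 - n * (Dk k).r) * κ k + (1 - ε k) * (Dk k).l (v k ^ 2 * q k))
        =o[F] fun k => ‖u k‖ := by
      have h2 : (fun k => 1 - n * (Dk k).r) =o[F] fun _ => (1 : ℝ) :=
        (isLittleO_one_iff ℝ).2 (by simpa using hnr.const_sub 1)
      have h3 : (fun k => (Dk k).l (v k ^ 2 * q k)) =o[F] fun k => ‖u k‖ :=
        IsBigO.trans_isLittleO (IsBigO.of_bound 1 (Eventually.of_forall fun k => by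
          simpa using (Dk k).abs_l_le _)) hvq
      have h4 : (fun k => 1 - ε k) =O[F] fun _ => (1 : ℝ) := (hε.const_sub 1).isBigO_one ℝ
      exact ((h2.mul_isBigO hκO).congr_right fun k => one_mul _).add
        ((h4.mul_isLittleO h3).congr_right fun k => one_mul _)
    refine IsBigO.trans_isLittleO (IsBigO.of_bound 2 ?_) h1
    have h5 : Tendsto (fun k => 1 - n * (Dk k).r * κ k) F (𝓝 1) := by
      simpa using (hnr.mul hκ0).const_sub 1
    filter_upwards [h5.eventually (lt_mem_nhds (by norm_num : (1 / 2 : ℝ) < 1)), pair, hε0]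
      with k hk hp e0
    have e : (1 - n * (Dk k).r) * κ k + (1 - ε k) * (Dk k).l (v k ^ 2 * q k)
        = ε k * (1 - n * (Dk k).r * κ k) := by linarith
    rw [e, norm_mul, Real.norm_eq_abs, Real.norm_eq_abs, abs_of_nonneg e0, abs_of_pos (by linarith)]
    nlinarith
  have hsmall : (fun k => u k - (n : ℝ) • Ak k (u k)) =o[F] u := by
    have h1 : (fun k => ε k • (1 : C(S, ℝ))) =o[F] fun k => ‖u k‖ :=
      IsBigO.trans_isLittleO (IsBigO.of_bound 1 (Eventually.of_forall fun k => by
        rw [norm_smul, norm_one]; linarith)) hεo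
    have h2 : (fun k => (ε k * n) • v k) =o[F] fun k => ‖u k‖ := by
      have : (fun k => ε k * n) =o[F] fun _ => (1 : ℝ) :=
        (isLittleO_one_iff ℝ).2 (by simpa using hε.mul_const (n : ℝ))
      exact (this.smul_isBigO hvO).congr_right fun k => one_mul _
    have h3 : (fun k => (1 - ε k) • (v k ^ 2 * q k)) =o[F] fun k => ‖u k‖ := by
      have h4 : (fun k => 1 - ε k) =O[F] fun _ => (1 : ℝ) := (hε.const_sub 1).isBigO_one ℝ
      exact (h4.smul_isLittleO hvq).congr_right fun k => one_mul _
    refine (((h1.sub h2).sub h3).congr' ?_ EventuallyEq.rfl).of_norm_right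
    filter_upwards [hu] with k ⟨_, _, _, _, h⟩
    calc _ = (ε k • (1 : C(S, ℝ)) + (1 - ε k) • ((n : ℝ) • v k - v k ^ 2 * q k)) - (n : ℝ) • v k := by
          module
      _ = _ := by rw [← h]
  obtain ⟨hne, hprof⟩ := tendsto_profile D Dk hA hb
    (hu.mono fun k h => h.2.2.2.1) hsmall
  refine ⟨?_, hκ0, hprof, ?_⟩
  · filter_upwards [hne, hκ01] with k h1 h2
    exact lt_of_le_of_ne h2.1 (Ne.symm h1)
  -- The scalar limit is the paired equation divided by `κ²`, with `u / κ` replaced by its limit `h`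
  -- in the quadratic term.
  have hw := tendsto_map_apply hA hprof
  have h1 : Tendsto (fun k => (Dk k).l ((Ak k ((κ k)⁻¹ • u k)) ^ 2 * q k)) F
      (𝓝 (D.l ((A D.h) ^ 2 * remPoly n 0))) :=
    tendsto_functional_apply hl ((hw.pow 2).mul hq0)
  have h2 : D.l ((A D.h) ^ 2 * remPoly n 0) = remPoly n 0 * D.r ^ 2 * D.l (D.h ^ 2) := by
    have : (A D.h) ^ 2 * remPoly n 0 = (remPoly n (0 : ℝ) * D.r ^ 2) • D.h ^ 2 := by
      ext x
      rw [D.A_h]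
      simp only [ContinuousMap.mul_apply, ContinuousMap.pow_apply, ContinuousMap.smul_apply,
        smul_eq_mul, remPoly_apply, ContinuousMap.zero_apply]
      ring
    rw [this, map_smul, smul_eq_mul]
  rw [← h2]
  have h3 := (hε.const_sub 1).mul h1
  rw [sub_zero, one_mul] at h3
  refine h3.congr' ?_
  filter_upwards [hne, pair] with k hk hp
  have e : (Ak k ((κ k)⁻¹ • u k)) ^ 2 * q k = ((κ k)⁻¹ ^ 2) • (v k ^ 2 * q k) := by
    rw [map_smul, smul_pow, smul_mul_assoc]
  rw [e, map_smul, smul_eq_mul]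
  change κ k ≠ 0 at hk
  have e3 : (1 - ε k) * (Dk k).l (v k ^ 2 * q k)
      = ε k + ((1 - ε k) * (n * (Dk k).r) - 1) * κ k := by linarith
  change _ = ε k / κ k ^ 2 + ((1 - ε k) * (n * (Dk k).r) - 1) / κ k
  rw [mul_left_comm, e3]
  field_simp

end Perturbation


/-! ### Karamata's Tauberian theorem with exponent one half -/

section Tauberian

lemma exp_neg_inv_pow_mem (m n : ℕ) : Real.exp (-(1 / (m : ℝ))) ^ n ∈ Set.Icc (0 : ℝ) 1 :=
  ⟨by positivity, pow_le_one₀ (by positivity) (Real.exp_le_one_iff.2 (by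
    have : (0 : ℝ) ≤ 1 / m := by positivity
    linarith))⟩

lemma summable_weight {w : ℕ → ℝ} (hw0 : ∀ n, 0 ≤ w n) (hw1 : ∀ n, w n ≤ 1) {y : ℝ} (hy0 : 0 ≤ y)
    (hy1 : y < 1) {f : ℝ → ℝ} {M : ℝ} (hf : ∀ x ∈ Set.Icc (0 : ℝ) 1, |f x| ≤ M) :
    Summable fun n => w n * y ^ n * f (y ^ n) := by
  refine Summable.of_norm_bounded ((summable_geometric_of_lt_one hy0 hy1).mul_left M) fun n => ?_
  have h1 := hf (y ^ n) ⟨by positivity, pow_le_one₀ hy0 hy1.le⟩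
  rw [norm_mul, norm_mul, Real.norm_eq_abs, Real.norm_eq_abs, Real.norm_eq_abs,
    abs_of_nonneg (hw0 n), abs_of_nonneg (pow_nonneg hy0 n)]
  have h2 : w n * y ^ n ≤ y ^ n := mul_le_of_le_one_left (by positivity) (hw1 n)
  calc w n * y ^ n * |f (y ^ n)| ≤ y ^ n * M :=
        mul_le_mul h2 h1 (abs_nonneg _) (by positivity)
    _ = _ := mul_comm _ _

lemma exp_neg_inv_lt_one {m : ℕ} (hm : 0 < m) : Real.exp (-(1 / (m : ℝ))) < 1 := by
  rw [Real.exp_lt_one_iff]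
  have : (0 : ℝ) < 1 / m := by positivity
  linarith

lemma tendsto_mul_one_sub_exp (r : ℝ) :
    Tendsto (fun m : ℕ => (m : ℝ) * (1 - Real.exp (-(r / m)))) atTop (𝓝 r) := by
  have h1 : HasDerivAt (fun x : ℝ => 1 - Real.exp (-(r * x))) r 0 := by
    have := (((hasDerivAt_id (0 : ℝ)).const_mul r).neg.exp).const_sub 1
    simpa using this
  have h2 := h1.tendsto_slope
  have h3 : Tendsto (fun m : ℕ => (1 : ℝ) / m) atTop (𝓝[≠] 0) := by
    refine tendsto_nhdsWithin_iff.2 ⟨tendsto_one_div_atTop_nhds_zero_nat, ?_⟩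
    filter_upwards [eventually_gt_atTop 0] with m hm
    have : (0 : ℝ) < 1 / m := by positivity
    exact this.ne'
  refine (h2.comp h3).congr' ?_
  filter_upwards [eventually_gt_atTop 0] with m hm
  simp only [Function.comp_apply, slope_def_field]
  have : (m : ℝ) ≠ 0 := by positivity
  simp only [mul_zero, neg_zero, Real.exp_zero, sub_self, sub_zero]
  rw [div_div_eq_mul_div, div_one, mul_comm, mul_one_div]

lemma integrableOn_gamma_weight {p : ℝ} (hp : 0 < p) {f : ℝ → ℝ} (hf : Continuous f) {M : ℝ}
    (hM : ∀ x ∈ Set.Icc (0 : ℝ) 1, |f x| ≤ M) :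
    IntegrableOn (fun t => Real.exp (-t) * t ^ (p - 1) * f (Real.exp (-t))) (Set.Ioi 0) := by
  have h1 := Real.GammaIntegral_convergent hp
  refine Integrable.mul_bdd (c := M) h1 (hf.comp (by fun_prop)).aestronglyMeasurable.restrict ?_
  refine (ae_restrict_iff' measurableSet_Ioi).2 (Eventually.of_forall fun t ht => ?_)
  exact hM _ ⟨(Real.exp_pos _).le, Real.exp_le_one_iff.2 (by simpa using ht.le)⟩

/-- Karamata's theorem: convergence of the rescaled weights against continuous test functions. -/
lemma tendsto_rescaled_weights {w : ℕ → ℝ} (hw0 : ∀ n, 0 ≤ w n) (hw1 : ∀ n, w n ≤ 1) {p c : ℝ}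
    (hp : 0 < p)
    (h : Tendsto (fun s : ℝ => (1 - s) ^ p * ∑' n, w n * s ^ n) (𝓝[<] 1) (𝓝 c))
    {f : ℝ → ℝ} (hf : Continuous f) :
    Tendsto (fun m : ℕ => (m : ℝ) ^ (-p) *
        ∑' n, w n * Real.exp (-(1 / m)) ^ n * f (Real.exp (-(1 / m)) ^ n)) atTop
      (𝓝 (c / Real.Gamma p *
        ∫ t in Set.Ioi (0 : ℝ), Real.exp (-t) * t ^ (p - 1) * f (Real.exp (-t)))) := by
  set L : ℕ → (ℝ → ℝ) → ℝ := fun m f => (m : ℝ) ^ (-p) *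
        ∑' n, w n * Real.exp (-(1 / m)) ^ n * f (Real.exp (-(1 / m)) ^ n) with hL
  set J : (ℝ → ℝ) → ℝ := fun f =>
        ∫ t in Set.Ioi (0 : ℝ), Real.exp (-t) * t ^ (p - 1) * f (Real.exp (-t)) with hJ
  have hΓ := Real.Gamma_pos_of_pos hp
  have bdd : ∀ g : ℝ → ℝ, Continuous g → ∃ M, ∀ x ∈ Set.Icc (0 : ℝ) 1, |g x| ≤ M := fun g hg => by
    obtain ⟨M, hM⟩ := isCompact_Icc.exists_bound_of_continuousOn (s := Set.Icc (0 : ℝ) 1)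
      hg.continuousOn
    exact ⟨M, hM⟩
  -- On the test function `y ^ j` the weighted sum is the power series at `s = exp(-(j + 1)/m)`,
  -- where the hypothesis applies directly. Weierstrass approximation then passes from polynomials
  -- to continuous functions.
  have mono : ∀ j : ℕ, Tendsto (fun m => L m fun y => y ^ j) atTop
      (𝓝 (c / Real.Gamma p * J fun y => y ^ j)) := by
    intro j
    have hr : (0 : ℝ) < j + 1 := by positivity
    have e1 : (J fun y => y ^ j) = (1 / (j + 1 : ℝ)) ^ p * Real.Gamma p := by
      rw [← Real.integral_rpow_mul_exp_neg_mul_Ioi hp hr]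
      simp only [J]
      refine setIntegral_congr_fun measurableSet_Ioi fun t _ => ?_
      rw [← Real.exp_nat_mul, mul_comm (Real.exp (-t)), mul_assoc, ← Real.exp_add]
      ring_nf
    have e2 : c / Real.Gamma p * (J fun y => y ^ j) = c * (1 / (j + 1 : ℝ)) ^ p := by
      rw [e1]; field_simp
    rw [e2]
    have hs : Tendsto (fun m : ℕ => Real.exp (-((j + 1 : ℝ) / m))) atTop (𝓝[<] 1) := by
      refine tendsto_nhdsWithin_iff.2 ⟨?_, ?_⟩
      · have : Tendsto (fun m : ℕ => -((j + 1 : ℝ) / m)) atTop (𝓝 0) := by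
          simpa using (tendsto_const_div_atTop_nhds_zero_nat (j + 1 : ℝ)).neg
        have h2 := (Real.continuous_exp.tendsto 0).comp this
        rw [Real.exp_zero] at h2
        exact h2
      · filter_upwards [eventually_gt_atTop 0] with m hm
        rw [Set.mem_Iio, Real.exp_lt_one_iff]
        have : (0 : ℝ) < (j + 1) / m := by positivity
        linarith
    have h1 := h.comp hs
    have h2 := ((tendsto_mul_one_sub_exp (j + 1 : ℝ)).rpow_const (p := -p) (Or.inl hr.ne'))
    have h3 := h1.mul h2
    have e3 : (1 / (j + 1 : ℝ)) ^ p = (j + 1 : ℝ) ^ (-p) := by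
      rw [one_div, Real.inv_rpow hr.le, Real.rpow_neg hr.le]
    rw [e3]
    refine h3.congr' ?_
    filter_upwards [eventually_gt_atTop 0] with m hm
    have hm' : (0 : ℝ) < m := by positivity
    have hpos : 0 < 1 - Real.exp (-((j + 1 : ℝ) / m)) := by
      rw [sub_pos, Real.exp_lt_one_iff]
      have : (0 : ℝ) < (j + 1) / m := by positivity
      linarith
    simp only [Function.comp_apply, L]
    rw [Real.mul_rpow hm'.le hpos.le]
    have e4 : ∀ n, w n * Real.exp (-(1 / m)) ^ n * (Real.exp (-(1 / (m : ℝ))) ^ n) ^ j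
        = w n * Real.exp (-((j + 1 : ℝ) / m)) ^ n := by
      intro n
      rw [mul_assoc, ← pow_succ', ← pow_mul, ← Real.exp_nat_mul, ← Real.exp_nat_mul]
      congr 2
      push_cast
      ring
    simp only [e4]
    have e5 : (1 - Real.exp (-((j + 1 : ℝ) / m))) ^ p * (1 - Real.exp (-((j + 1 : ℝ) / m))) ^ (-p) = 1 := by
      rw [← Real.rpow_add hpos, add_neg_cancel, Real.rpow_zero]
    linear_combination ((m : ℝ) ^ (-p) * ∑' n, w n * Real.exp (-((j + 1 : ℝ) / m)) ^ n) * e5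
  have Ladd : ∀ m g₁ g₂, 0 < m → Continuous g₁ → Continuous g₂ → L m (fun y => g₁ y + g₂ y) = L m g₁ + L m g₂ := by
    intro m g₁ g₂ hm h₁ h₂
    obtain ⟨M₁, hM₁⟩ := bdd g₁ h₁
    obtain ⟨M₂, hM₂⟩ := bdd g₂ h₂
    have s1 := summable_weight hw0 hw1 (Real.exp_pos _).le (exp_neg_inv_lt_one hm) hM₁
    have s2 := summable_weight hw0 hw1 (Real.exp_pos _).le (exp_neg_inv_lt_one hm) hM₂
    simp only [L]
    rw [← mul_add, ← s1.tsum_add s2]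
    simp only [mul_add]
  have Jadd : ∀ g₁ g₂, Continuous g₁ → Continuous g₂ → J (fun y => g₁ y + g₂ y) = J g₁ + J g₂ := by
    intro g₁ g₂ h₁ h₂
    obtain ⟨M₁, hM₁⟩ := bdd g₁ h₁
    obtain ⟨M₂, hM₂⟩ := bdd g₂ h₂
    simp only [J]
    rw [← integral_add (integrableOn_gamma_weight hp h₁ hM₁) (integrableOn_gamma_weight hp h₂ hM₂)]
    simp only [mul_add]
  have Lsmul : ∀ m (a : ℝ) g, L m (fun y => a * g y) = a * L m g := by
    intro m a g
    simp only [L]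
    rw [mul_left_comm a]
    congr 1
    rw [← tsum_mul_left]
    exact tsum_congr fun n => by ring
  have Jsmul : ∀ (a : ℝ) g, J (fun y => a * g y) = a * J g := by
    intro a g
    simp only [J]
    rw [← integral_const_mul]
    congr 1
    ext n; ring
  have poly : ∀ P : Polynomial ℝ, Tendsto (fun m => L m fun y => P.eval y) atTop
      (𝓝 (c / Real.Gamma p * J fun y => P.eval y)) := by
    intro P
    induction P using Polynomial.induction_on' with
    | add P Q hP hQ =>
      simp only [Polynomial.eval_add]
      rw [Jadd _ _ P.continuous Q.continuous, mul_add]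
      refine (hP.add hQ).congr' ?_
      filter_upwards [eventually_gt_atTop 0] with m hm
      rw [Ladd m _ _ hm P.continuous Q.continuous]
    | monomial n a =>
      simp only [Polynomial.eval_monomial]
      rw [Jsmul a fun y => y ^ n, mul_left_comm]
      exact ((mono n).const_mul a).congr fun m => (Lsmul m a fun y => y ^ n).symm
  have Lbd : ∀ m g₁ g₂ ε, 0 < m → Continuous g₁ → Continuous g₂ →
      (∀ x ∈ Set.Icc (0 : ℝ) 1, |g₁ x - g₂ x| ≤ ε) → |L m g₁ - L m g₂| ≤ ε * L m fun _ => 1 := by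
    intro m g₁ g₂ ε hm h₁ h₂ hε
    obtain ⟨M₁, hM₁⟩ := bdd g₁ h₁
    obtain ⟨M₂, hM₂⟩ := bdd g₂ h₂
    have s1 := summable_weight hw0 hw1 (Real.exp_pos _).le (exp_neg_inv_lt_one hm) hM₁
    have s2 := summable_weight hw0 hw1 (Real.exp_pos _).le (exp_neg_inv_lt_one hm) hM₂
    have s3 := summable_weight hw0 hw1 (Real.exp_pos _).le (exp_neg_inv_lt_one hm)
      (f := fun _ => (1 : ℝ)) (M := 1) (fun x _ => by simp)
    rw [← Lsmul m ε fun _ => 1]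
    simp only [L]
    rw [← mul_sub, ← s1.tsum_sub s2, abs_mul, abs_of_nonneg (by positivity)]
    refine mul_le_mul_of_nonneg_left ?_ (by positivity)
    rw [← Real.norm_eq_abs]
    refine tsum_of_norm_bounded (s3.mul_left ε).hasSum (fun n => ?_) |>.trans (le_of_eq ?_)
    · have h0 := hε _ (exp_neg_inv_pow_mem m n)
      have h1 : 0 ≤ w n * Real.exp (-(1 / (m : ℝ))) ^ n := mul_nonneg (hw0 n) (by positivity)
      rw [← mul_sub, norm_mul, Real.norm_eq_abs, Real.norm_eq_abs, abs_of_nonneg h1]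
      nlinarith
    · congr 1
      ext n; ring
  have Jbd : ∀ g₁ g₂ ε, Continuous g₁ → Continuous g₂ →
      (∀ x ∈ Set.Icc (0 : ℝ) 1, |g₁ x - g₂ x| ≤ ε) → |J g₁ - J g₂| ≤ ε * J fun _ => 1 := by
    intro g₁ g₂ ε h₁ h₂ hε
    obtain ⟨M₁, hM₁⟩ := bdd g₁ h₁
    obtain ⟨M₂, hM₂⟩ := bdd g₂ h₂
    rw [← Jsmul ε fun _ => 1]
    simp only [J]
    rw [← integral_sub (integrableOn_gamma_weight hp h₁ hM₁) (integrableOn_gamma_weight hp h₂ hM₂),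
      ← Real.norm_eq_abs]
    refine norm_integral_le_of_norm_le (integrableOn_gamma_weight hp (f := fun _ => ε * 1) (M := |ε|)
      (by fun_prop) (fun x _ => by simp)) ?_
    refine (ae_restrict_iff' measurableSet_Ioi).2 (Eventually.of_forall fun t ht => ?_)
    have ht' : (0 : ℝ) < t := ht
    have h0 := hε (Real.exp (-t)) ⟨(Real.exp_pos _).le, Real.exp_le_one_iff.2 (by linarith)⟩
    have h1 : 0 ≤ Real.exp (-t) * t ^ (p - 1) := by positivity
    rw [← mul_sub, norm_mul, Real.norm_eq_abs, Real.norm_eq_abs, abs_of_nonneg h1]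
    nlinarith
  have one := mono 0
  simp only [pow_zero] at one
  rw [Metric.tendsto_atTop']
  intro ε hε
  -- `B` eventually dominates the total mass `L m 1`, and it dominates the limiting mass, so a
  -- uniform error `ε / (4 B)` costs at most `ε / 4` on each side.
  set B := |c / Real.Gamma p * J fun _ => 1| + 1 with hB
  have hBpos : 0 < B := by positivity
  obtain ⟨P, hP⟩ := exists_polynomial_near_of_continuousOn 0 1 f hf.continuousOn (ε / (4 * B))
    (by positivity)
  have hP' : ∀ x ∈ Set.Icc (0 : ℝ) 1, |f x - P.eval x| ≤ ε / (4 * B) := fun x hx => by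
    rw [abs_sub_comm]; exact (hP x hx).le
  have ev1 := one.eventually (gt_mem_nhds (show c / Real.Gamma p * (J fun _ => 1) < B from
    (le_abs_self _).trans_lt (by simp [B])))
  have ev2 := Metric.tendsto_nhds.1 (poly P) (ε / 4) (by positivity)
  obtain ⟨N, hN⟩ := eventually_atTop.1 (ev1.and (ev2.and (eventually_gt_atTop 0)))
  refine ⟨N, fun m hm => ?_⟩
  obtain ⟨h1, h2, hm0⟩ := hN m hm.le
  have b1 := Lbd m f (fun y => P.eval y) _ hm0 hf P.continuous hP'
  have b2 := Jbd f (fun y => P.eval y) _ hf P.continuous hP'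
  have b3 : |c / Real.Gamma p * J f - c / Real.Gamma p * J fun y => P.eval y| ≤ ε / 4 := by
    rw [← mul_sub, abs_mul]
    have J0 : 0 ≤ J fun _ => 1 := setIntegral_nonneg measurableSet_Ioi fun t ht => by
      have ht' : (0 : ℝ) < t := ht
      positivity
    calc _ ≤ |c / Real.Gamma p| * (ε / (4 * B) * J fun _ => 1) := by gcongr
      _ = ε / (4 * B) * |c / Real.Gamma p * J fun _ => 1| := by
          rw [abs_mul, abs_of_nonneg J0]; ring
      _ ≤ ε / (4 * B) * B := by gcongr; simp [B]
      _ = ε / 4 := by field_simp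
  have b4 : ε / (4 * B) * (L m fun _ => 1) ≤ ε / 4 := by
    calc _ ≤ ε / (4 * B) * B := by gcongr
      _ = ε / 4 := by field_simp
  rw [Real.dist_eq] at h2 ⊢
  rw [abs_le] at b1 b2 b3
  rw [abs_lt] at h2 ⊢
  change -ε < L m f - c / Real.Gamma p * J f ∧ L m f - c / Real.Gamma p * J f < ε
  constructor <;> linarith [b1.1, b1.2, b3.1, b3.2, h2.1, h2.2]

/-- A Tauberian theorem with exponent `1/2` for antitone sequences. -/
theorem tendsto_sqrt_mul_of_antitone {a : ℕ → ℝ} (ha0 : ∀ n, 0 ≤ a n) (ha1 : ∀ n, a n ≤ 1)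
    (ha : Antitone a) {c : ℝ} (hc : 0 ≤ c)
    (h : Tendsto (fun s : ℝ => (1 - s) ^ (1 / 2 : ℝ) * ∑' n, a n * s ^ n) (𝓝[<] 1) (𝓝 c)) :
    Tendsto (fun n : ℕ => (n : ℝ) ^ (1 / 2 : ℝ) * a n) atTop (𝓝 (c / √Real.pi)) := by
  -- The same theorem with constant weights and `p = 1` gives the normalization against which the
  -- sequence is compared.
  have hone : Tendsto (fun s : ℝ => (1 - s) ^ (1 : ℝ) * ∑' n, (fun _ : ℕ => (1 : ℝ)) n * s ^ n)
      (𝓝[<] 1) (𝓝 1) := by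
    refine tendsto_const_nhds.congr' ?_
    filter_upwards [Ioo_mem_nhdsLT (zero_lt_one (α := ℝ))] with s hs
    simp only [one_mul]
    rw [tsum_geometric_of_lt_one hs.1.le hs.2, Real.rpow_one, mul_inv_cancel₀]
    linarith [hs.2]
  -- A continuous bump: `f α β (exp(-t))` is nonzero only for `α < t < β`, so with `t = n / m` it
  -- selects indices `n` between `α m` and `β m`.
  let f : ℝ → ℝ → ℝ → ℝ := fun α β y => max 0 ((y - Real.exp (-β)) * (Real.exp (-α) - y))
  have hfc : ∀ α β, Continuous (f α β) := fun α β => by fun_prop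
  have hf0 : ∀ α β y, 0 ≤ f α β y := fun α β y => le_max_left _ _
  have hsupp : ∀ α β t, α < β → f α β (Real.exp (-t)) ≠ 0 → α < t ∧ t < β := by
    intro α β t hαβ h0
    have h1 : 0 < (Real.exp (-t) - Real.exp (-β)) * (Real.exp (-α) - Real.exp (-t)) := by
      by_contra hcon
      exact h0 (max_eq_left (not_lt.1 hcon))
    have h2 : Real.exp (-β) < Real.exp (-α) := Real.exp_lt_exp.2 (by linarith)
    rcases pos_and_pos_or_neg_and_neg_of_mul_pos h1 with ⟨h3, h4⟩ | ⟨h3, h4⟩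
    · have h3' := Real.exp_lt_exp.1 (sub_pos.1 h3)
      have h4' := Real.exp_lt_exp.1 (sub_pos.1 h4)
      constructor <;> linarith
    · linarith
  set J : ℝ → ℝ → ℝ → ℝ := fun p α β =>
    ∫ t in Set.Ioi (0 : ℝ), Real.exp (-t) * t ^ (p - 1) * f α β (Real.exp (-t)) with hJ
  have bdd : ∀ α β, ∃ M, ∀ x ∈ Set.Icc (0 : ℝ) 1, |f α β x| ≤ M := fun α β => by
    obtain ⟨M, hM⟩ := isCompact_Icc.exists_bound_of_continuousOn (s := Set.Icc (0 : ℝ) 1)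
      (hfc α β).continuousOn
    exact ⟨M, hM⟩
  have hint : ∀ p α β : ℝ, 0 < p → IntegrableOn
      (fun t => Real.exp (-t) * t ^ (p - 1) * f α β (Real.exp (-t))) (Set.Ioi 0) :=
    fun p α β hp => by
      obtain ⟨M, hM⟩ := bdd α β
      exact integrableOn_gamma_weight hp (hfc α β) hM
  have hJpos : ∀ α β, 0 < α → α < β → 0 < J 1 α β := by
    intro α β hα hαβ
    simp only [J]
    rw [setIntegral_pos_iff_support_of_nonneg_ae ?_ (hint 1 α β one_pos)]
    · have hsub : Set.Ioo α β ⊆ (Function.support fun t : ℝ =>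
          Real.exp (-t) * t ^ ((1 : ℝ) - 1) * f α β (Real.exp (-t))) ∩ Set.Ioi 0 := by
        intro t ht
        have h1 : 0 < (Real.exp (-t) - Real.exp (-β)) * (Real.exp (-α) - Real.exp (-t)) :=
          mul_pos (sub_pos.2 (Real.exp_lt_exp.2 (by linarith [ht.2])))
            (sub_pos.2 (Real.exp_lt_exp.2 (by linarith [ht.1])))
        have h2 : 0 < f α β (Real.exp (-t)) := lt_max_of_lt_right h1
        have h3 : 0 < t := hα.trans ht.1
        refine ⟨?_, h3⟩
        rw [Function.mem_support]
        positivity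
      refine lt_of_lt_of_le ?_ (measure_mono hsub)
      rw [Real.volume_Ioo]
      exact ENNReal.ofReal_pos.2 (by linarith)
    · refine (ae_restrict_iff' measurableSet_Ioi).2 (Eventually.of_forall fun t ht => ?_)
      have h3 : (0 : ℝ) < t := ht
      have := hf0 α β (Real.exp (-t))
      simp only [Pi.zero_apply]
      positivity
  have hJle : ∀ α β, 0 < α → α < β → J (1 / 2) α β ≤ α ^ (-(1 / 2) : ℝ) * J 1 α β ∧
      β ^ (-(1 / 2) : ℝ) * J 1 α β ≤ J (1 / 2) α β := by
    intro α β hα hαβ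
    have key : ∀ t ∈ Set.Ioi (0 : ℝ), f α β (Real.exp (-t)) ≠ 0 →
        t ^ ((1 / 2 : ℝ) - 1) ≤ α ^ (-(1 / 2) : ℝ) ∧ β ^ (-(1 / 2) : ℝ) ≤ t ^ ((1 / 2 : ℝ) - 1) := by
      intro t ht h0
      obtain ⟨h1, h2⟩ := hsupp α β t hαβ h0
      have h3 : (0 : ℝ) < t := ht
      rw [show (1 / 2 : ℝ) - 1 = -(1 / 2) by norm_num]
      exact ⟨Real.rpow_le_rpow_of_nonpos hα h1.le (by norm_num),
        Real.rpow_le_rpow_of_nonpos h3 h2.le (by norm_num)⟩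
    simp only [J]
    rw [← integral_const_mul, ← integral_const_mul]
    constructor
    · refine setIntegral_mono_on (hint _ α β (by norm_num)) ((hint 1 α β one_pos).const_mul _)
        measurableSet_Ioi fun t ht => ?_
      by_cases h0 : f α β (Real.exp (-t)) = 0
      · simp [h0]
      · obtain ⟨h1, -⟩ := key t ht h0
        rw [sub_self, Real.rpow_zero, mul_one]
        have := mul_nonneg (Real.exp_pos (-t)).le (hf0 α β (Real.exp (-t)))
        nlinarith
    · refine setIntegral_mono_on ((hint 1 α β one_pos).const_mul _) (hint _ α β (by norm_num))
        measurableSet_Ioi fun t ht => ?_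
      by_cases h0 : f α β (Real.exp (-t)) = 0
      · simp [h0]
      · obtain ⟨-, h1⟩ := key t ht h0
        rw [sub_self, Real.rpow_zero, mul_one]
        have := mul_nonneg (Real.exp_pos (-t)).le (hf0 α β (Real.exp (-t)))
        nlinarith
  set K := c / √Real.pi with hK
  have hK0 : 0 ≤ K := by positivity
  set La : ℝ → ℝ → ℕ → ℝ := fun α β m => (m : ℝ) ^ (-(1 / 2) : ℝ) *
    ∑' n, a n * Real.exp (-(1 / m)) ^ n * f α β (Real.exp (-(1 / m)) ^ n) with hLa
  set L1 : ℝ → ℝ → ℕ → ℝ := fun α β m => (m : ℝ) ^ (-1 : ℝ) *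
    ∑' n, 1 * Real.exp (-(1 / m)) ^ n * f α β (Real.exp (-(1 / m)) ^ n) with hL1
  have limA : ∀ α β, Tendsto (La α β) atTop (𝓝 (K * J (1 / 2) α β)) := fun α β => by
    have := tendsto_rescaled_weights ha0 ha1 (by norm_num) h (hfc α β)
    rw [Real.Gamma_one_half_eq] at this
    exact this
  have lim1 : ∀ α β, Tendsto (L1 α β) atTop (𝓝 (J 1 α β)) := fun α β => by
    have := tendsto_rescaled_weights (fun _ => zero_le_one) (fun _ => le_rfl) one_pos hone (hfc α β)
    rw [Real.Gamma_one, div_one, one_mul] at this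
    exact this
  have e0 : ∀ m : ℕ, 0 < m → (m : ℝ) ^ (-(1 / 2) : ℝ) = (m : ℝ) ^ (1 / 2 : ℝ) * (m : ℝ) ^ (-1 : ℝ) := by
    intro m hm
    rw [← Real.rpow_add (by positivity)]
    norm_num
  have supp_nat : ∀ α β (m n : ℕ), 0 < m → α < β → f α β (Real.exp (-(1 / (m : ℝ))) ^ n) ≠ 0 →
      α * m < n ∧ n < β * m := by
    intro α β m n hm hαβ h0
    have hm' : (0 : ℝ) < m := by positivity
    have e : Real.exp (-(1 / (m : ℝ))) ^ n = Real.exp (-(n / m)) := by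
      rw [← Real.exp_nat_mul]; congr 1; ring
    rw [e] at h0
    obtain ⟨h1, h2⟩ := hsupp α β _ hαβ h0
    exact ⟨(lt_div_iff₀ hm').1 h1, (div_lt_iff₀ hm').1 h2⟩
  -- For a window ending at `m`, monotonicity gives `a n ≥ a m` throughout, so the window average
  -- bounds `a m` from above. A window starting at `m` gives the lower bound.
  have cmp_up : ∀ α (m : ℕ), 0 < m → α < 1 →
      (m : ℝ) ^ (1 / 2 : ℝ) * a m * L1 α 1 m ≤ La α 1 m := by
    intro α m hm hα
    obtain ⟨M, hM⟩ := bdd α 1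
    have s1 := summable_weight ha0 ha1 (Real.exp_pos _).le (exp_neg_inv_lt_one hm) hM
    have s2 := summable_weight (fun _ => zero_le_one) (fun _ => le_rfl) (Real.exp_pos _).le
      (exp_neg_inv_lt_one hm) hM
    simp only [La, L1]
    rw [e0 m hm]
    calc _ = (m : ℝ) ^ (1 / 2 : ℝ) * (m : ℝ) ^ (-1 : ℝ) * ∑' n, a m *
          (1 * Real.exp (-(1 / m)) ^ n * f α 1 (Real.exp (-(1 / m)) ^ n)) := by
          rw [tsum_mul_left]; ring
      _ ≤ _ := by
          refine mul_le_mul_of_nonneg_left ((s2.mul_left (a m)).tsum_le_tsum (fun n => ?_) s1)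
            (by positivity)
          by_cases h0 : f α 1 (Real.exp (-(1 / (m : ℝ))) ^ n) = 0
          · rw [h0]; simp
          · obtain ⟨-, h1⟩ := supp_nat α 1 m n hm hα h0
            rw [one_mul] at h1
            have h2 := ha (by exact_mod_cast h1.le : n ≤ m)
            rw [one_mul, mul_assoc]
            exact mul_le_mul_of_nonneg_right h2 (mul_nonneg (by positivity) (hf0 _ _ _))
  have cmp_dn : ∀ β (m : ℕ), 0 < m → 1 < β →
      La 1 β m ≤ (m : ℝ) ^ (1 / 2 : ℝ) * a m * L1 1 β m := by
    intro β m hm hβ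
    obtain ⟨M, hM⟩ := bdd 1 β
    have s1 := summable_weight ha0 ha1 (Real.exp_pos _).le (exp_neg_inv_lt_one hm) hM
    have s2 := summable_weight (fun _ => zero_le_one) (fun _ => le_rfl) (Real.exp_pos _).le
      (exp_neg_inv_lt_one hm) hM
    simp only [La, L1]
    rw [e0 m hm]
    calc _ ≤ (m : ℝ) ^ (1 / 2 : ℝ) * (m : ℝ) ^ (-1 : ℝ) * ∑' n, a m *
          (1 * Real.exp (-(1 / m)) ^ n * f 1 β (Real.exp (-(1 / m)) ^ n)) := by
          refine mul_le_mul_of_nonneg_left (s1.tsum_le_tsum (fun n => ?_) (s2.mul_left (a m)))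
            (by positivity)
          by_cases h0 : f 1 β (Real.exp (-(1 / (m : ℝ))) ^ n) = 0
          · rw [h0]; simp
          · obtain ⟨h1, -⟩ := supp_nat 1 β m n hm hβ h0
            rw [one_mul] at h1
            have h2 := ha (by exact_mod_cast h1.le : m ≤ n)
            rw [one_mul, mul_assoc]
            exact mul_le_mul_of_nonneg_right h2 (mul_nonneg (by positivity) (hf0 _ _ _))
      _ = _ := by rw [tsum_mul_left]; ring
  have hcont : Tendsto (fun x : ℝ => K * x ^ (-(1 / 2) : ℝ)) (𝓝 1) (𝓝 K) := by
    have : ContinuousAt (fun x : ℝ => K * x ^ (-(1 / 2) : ℝ)) 1 :=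
      continuousAt_const.mul (Real.continuousAt_rpow_const 1 _ (Or.inl one_ne_zero))
    simpa [ContinuousAt] using this
  rw [tendsto_order]
  constructor
  · intro x hx
    -- The ratio of the two window limits differs from `K` by at most the factor `β ^ (-1/2)`, which
    -- tends to one as the window narrows. The upper bound uses `α ↑ 1` in the same way.
    obtain ⟨β, hβ, h1⟩ := ((hcont.mono_left nhdsWithin_le_nhds).eventually
      (lt_mem_nhds hx)).and (self_mem_nhdsWithin (s := Set.Ioi (1 : ℝ))) |>.exists
    have hβ1 : 1 < β := h1
    have hJ1 := hJpos 1 β one_pos hβ1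
    have h2 := (limA 1 β).div (lim1 1 β) hJ1.ne'
    have h3 : x < K * J (1 / 2) 1 β / J 1 1 β := by
      rw [lt_div_iff₀ hJ1]
      calc x * J 1 1 β < K * β ^ (-(1 / 2) : ℝ) * J 1 1 β := by gcongr
        _ = K * (β ^ (-(1 / 2) : ℝ) * J 1 1 β) := by ring
        _ ≤ _ := by gcongr; exact (hJle 1 β one_pos hβ1).2
    filter_upwards [h2.eventually (lt_mem_nhds h3), eventually_gt_atTop 0,
      (lim1 1 β).eventually (lt_mem_nhds hJ1)] with m hm hm0 hL
    refine lt_of_lt_of_le hm ?_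
    change La 1 β m / L1 1 β m ≤ _
    rw [div_le_iff₀ hL]
    exact cmp_dn β m hm0 hβ1
  · intro x hx
    obtain ⟨α, hα, h1⟩ := ((hcont.mono_left nhdsWithin_le_nhds).eventually
      (gt_mem_nhds hx)).and (Ioo_mem_nhdsLT (zero_lt_one (α := ℝ))) |>.exists
    have hJ1 := hJpos α 1 h1.1 h1.2
    have h2 := (limA α 1).div (lim1 α 1) hJ1.ne'
    have h3 : K * J (1 / 2) α 1 / J 1 α 1 < x := by
      rw [div_lt_iff₀ hJ1]
      calc K * J (1 / 2) α 1 ≤ K * (α ^ (-(1 / 2) : ℝ) * J 1 α 1) := by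
            gcongr; exact (hJle α 1 h1.1 h1.2).1
        _ = K * α ^ (-(1 / 2) : ℝ) * J 1 α 1 := by ring
        _ < _ := by gcongr
    filter_upwards [h2.eventually (gt_mem_nhds h3), eventually_gt_atTop 0,
      (lim1 α 1).eventually (lt_mem_nhds hJ1)] with m hm hm0 hL
    refine lt_of_le_of_lt ?_ hm
    change _ ≤ La α 1 m / L1 α 1 m
    rw [le_div_iff₀ hL]
    exact cmp_up α m hm0 h1.2

end Tauberian


/-! ### The transition kernel and its regularity -/

noncomputable section Kernel

/-- Translation is continuous in `L¹`. -/
lemma exists_integral_translate_sub_le {ψ : ℝ → ℝ} (hψ : Integrable ψ) {ε : ℝ} (hε : 0 < ε) :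
    ∃ δ > 0, ∀ d : ℝ, |d| < δ → ∫ y, |ψ (d + y) - ψ y| ≤ ε := by
  have hm : MemLp ψ 1 := memLp_one_iff_integrable.2 hψ
  have : Fact ((1 : ℝ≥0∞) ≠ ∞) := ⟨ENNReal.one_ne_top⟩
  set f : Lp ℝ 1 (volume : Measure ℝ) := hm.toLp ψ
  have hc : Continuous fun d : ℝ => DomAddAct.mk d +ᵥ f :=
    (continuous_vadd (M := ℝᵈᵃᵃ) (X := Lp ℝ 1 (volume : Measure ℝ))).comp
      (DomAddAct.continuous_mk.prodMk continuous_const)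
  obtain ⟨δ, hδ, h⟩ := Metric.continuousAt_iff.1 (hc.continuousAt (x := (0 : ℝ))) ε hε
  refine ⟨δ, hδ, fun d hd => ?_⟩
  have h1 := (h (x := d) (by simpa using hd)).le
  have e0 : DomAddAct.mk (0 : ℝ) +ᵥ f = f := by
    rw [show DomAddAct.mk (0 : ℝ) = (0 : ℝᵈᵃᵃ) from rfl, zero_vadd]
  rw [e0, L1.dist_eq_integral_dist] at h1
  refine le_trans (le_of_eq (integral_congr_ae ?_)) h1
  have e1 : ((DomAddAct.mk d +ᵥ f : Lp ℝ 1 (volume : Measure ℝ)) : ℝ → ℝ)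
      =ᵐ[volume] fun y => ψ (d + y) := by
    have := (hm.comp_measurePreserving (measurePreserving_vadd d (volume : Measure ℝ))).coeFn_toLp
    exact this
  filter_upwards [e1, hm.coeFn_toLp] with y h2 h3
  rw [h2, h3, Real.dist_eq]

variable {ρ : ProbabilityMeasure I}

/-- A change of variables moves the translation from the test function, which may be discontinuous,
to the density, whose translates are continuous in `L¹`. -/
lemma integral_translate_eq (hac : (ρ : Measure I) ≪ volume) :
    ∃ ψ : ℝ → ℝ, Integrable ψ ∧ ∀ G : ℝ → ℝ, Measurable G → ∀ s,
      ∫ x : I, G (x + s) ∂(ρ : Measure I) = ∫ y, ψ (y - s) * G y := by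
  set μ : Measure ℝ := (ρ : Measure I).map Subtype.val
  have hμ : μ ≪ volume := by
    have h1 : μ ≪ (volume : Measure I).map Subtype.val := hac.map measurable_subtype_coe
    have h2 : (volume : Measure I).map Subtype.val = (volume : Measure ℝ).restrict (Set.Icc 0 1) := by
      rw [unitInterval.volume_def]
      exact map_comap_subtype_coe measurableSet_Icc _
    rw [h2] at h1
    exact h1.trans Measure.absolutelyContinuous_restrict
  have : IsFiniteMeasure μ := by infer_instance
  refine ⟨fun y => (μ.rnDeriv volume y).toReal, Measure.integrable_toReal_rnDeriv, fun G hG s => ?_⟩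
  have h1 : ∫ x : I, G (x + s) ∂(ρ : Measure I) = ∫ x, G (x + s) ∂μ :=
    (integral_map measurable_subtype_coe.aemeasurable
      (hG.comp (measurable_id.add_const s)).aestronglyMeasurable).symm
  rw [h1, ← integral_rnDeriv_smul hμ]
  rw [← integral_sub_right_eq_self (fun y => (μ.rnDeriv volume y).toReal • G (y + s)) s]
  simp

/-- The translates of an absolutely continuous law depend continuously on the translation, uniformly
over the test functions. -/
lemma exists_modulus (hac : (ρ : Measure I) ≪ volume) {ε : ℝ} (hε : 0 < ε) :
    ∃ δ > 0, ∀ G : ℝ → ℝ, Measurable G → (∀ y, |G y| ≤ 1) → ∀ s t : ℝ, |s - t| < δ →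
      |∫ x : I, G (x + s) ∂(ρ : Measure I) - ∫ x : I, G (x + t) ∂(ρ : Measure I)| ≤ ε := by
  obtain ⟨ψ, hψ, hG'⟩ := integral_translate_eq hac
  obtain ⟨δ, hδ, h⟩ := exists_integral_translate_sub_le hψ hε
  refine ⟨δ, hδ, fun G hG hG1 s t hst => ?_⟩
  have hi : ∀ s, Integrable fun y => ψ (y - s) * G y := fun s =>
    (hψ.comp_sub_right s).mul_bdd (c := 1) hG.aestronglyMeasurable
      (Eventually.of_forall hG1)
  rw [hG' G hG s, hG' G hG t, ← integral_sub (hi s) (hi t)]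
  have h2 := h (t - s) (by rwa [abs_sub_comm])
  rw [← integral_sub_right_eq_self (fun y => |ψ (t - s + y) - ψ y|) t] at h2
  refine le_trans ?_ h2
  rw [← Real.norm_eq_abs]
  refine (norm_integral_le_of_norm_le (g := fun y => |ψ (t - s + (y - t)) - ψ (y - t)|) ?_
    (Eventually.of_forall fun y => ?_))
  · have : ∀ y, t - s + (y - t) = y - s := fun y => by ring
    simp only [this]
    exact ((hψ.comp_sub_right s).sub (hψ.comp_sub_right t)).abs
  · rw [← sub_mul, norm_mul, show t - s + (y - t) = y - s by ring]
    exact mul_le_of_le_one_right (norm_nonneg _) (hG1 y)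

/-- The expectation of `F (X + v)` on the event `X + v ≥ 1`. -/
def kern (ρ : ProbabilityMeasure I) (F : ℝ → ℝ) (v : ℝ) : ℝ :=
  ∫ x : I, (if 1 ≤ (x : ℝ) + v then F (x + v) else 0) ∂(ρ : Measure I)

lemma measurable_alive {F : ℝ → ℝ} (hF : Measurable F) :
    Measurable fun y : ℝ => if 1 ≤ y then F y else 0 :=
  Measurable.ite measurableSet_Ici hF measurable_const

lemma abs_alive_le {F : ℝ → ℝ} {M : ℝ} (hM : ∀ y, 1 ≤ y → |F y| ≤ M) (hM0 : 0 ≤ M) (y : ℝ) :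
    |if 1 ≤ y then F y else 0| ≤ M := by
  split_ifs with h
  · exact hM y h
  · simpa using hM0

lemma integrable_kern (ρ : ProbabilityMeasure I) {F : ℝ → ℝ} (hF : Measurable F) {M : ℝ}
    (hM : ∀ y, 1 ≤ y → |F y| ≤ M) (v : ℝ) :
    Integrable (fun x : I => if 1 ≤ (x : ℝ) + v then F (x + v) else 0) (ρ : Measure I) := by
  have hM0 : 0 ≤ M := (abs_nonneg _).trans (hM 1 le_rfl)
  exact Integrable.of_bound (((measurable_alive hF).comp
    (measurable_subtype_coe.add_const v)).aestronglyMeasurable) M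
    (Eventually.of_forall fun x => abs_alive_le hM hM0 _)

lemma abs_kern_le (ρ : ProbabilityMeasure I) {F : ℝ → ℝ} {M : ℝ}
    (hM : ∀ y, 1 ≤ y → |F y| ≤ M) (v : ℝ) : |kern ρ F v| ≤ M := by
  have hM0 : 0 ≤ M := (abs_nonneg _).trans (hM 1 le_rfl)
  have := norm_integral_le_of_norm_le_const (μ := (ρ : Measure I))
    (f := fun x : I => if 1 ≤ (x : ℝ) + v then F (x + v) else 0) (C := M)
    (Eventually.of_forall fun x => abs_alive_le hM hM0 _)
  simpa [kern] using this

lemma kern_mono (ρ : ProbabilityMeasure I) {F G : ℝ → ℝ} (hF : Measurable F) (hG : Measurable G)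
    {M : ℝ} (hFM : ∀ y, 1 ≤ y → |F y| ≤ M) (hGM : ∀ y, 1 ≤ y → |G y| ≤ M)
    (h : ∀ y, 1 ≤ y → F y ≤ G y) (v : ℝ) : kern ρ F v ≤ kern ρ G v := by
  refine integral_mono (integrable_kern ρ hF hFM v) (integrable_kern ρ hG hGM v) fun x => ?_
  simp only
  split_ifs with h1
  · exact h _ h1
  · exact le_rfl

lemma exists_kern_modulus (hac : (ρ : Measure I) ≪ volume) {ε : ℝ} (hε : 0 < ε) :
    ∃ δ > 0, ∀ F : ℝ → ℝ, Measurable F → (∀ y, 1 ≤ y → |F y| ≤ 1) → ∀ s t : ℝ, |s - t| < δ →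
      |kern ρ F s - kern ρ F t| ≤ ε := by
  obtain ⟨δ, hδ, h⟩ := exists_modulus hac hε
  exact ⟨δ, hδ, fun F hF hF1 s t hst =>
    h _ (measurable_alive hF) (abs_alive_le hF1 zero_le_one) s t hst⟩

lemma continuous_kern (hac : (ρ : Measure I) ≪ volume) {F : ℝ → ℝ} (hF : Measurable F) {M : ℝ}
    (hM : ∀ y, 1 ≤ y → |F y| ≤ M) : Continuous (kern ρ F) := by
  have hM0 : 0 ≤ M := (abs_nonneg _).trans (hM 1 le_rfl)
  rw [Metric.continuous_iff]
  intro v ε hε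
  -- Normalizing by `M + 1` instead of `M` includes the case `M = 0`.
  obtain ⟨δ, hδ, h⟩ := exists_kern_modulus hac (ε := ε / (2 * (M + 1))) (by positivity)
  refine ⟨δ, hδ, fun w hw => ?_⟩
  have h1 := h (fun y => F y / (M + 1)) (hF.div_const _) (fun y hy => by
    rw [abs_div, abs_of_pos (by linarith : 0 < M + 1), div_le_one (by linarith)]
    linarith [hM y hy]) w v hw
  have e : ∀ w, kern ρ (fun y => F y / (M + 1)) w = kern ρ F w / (M + 1) := by
    intro w
    simp only [kern]
    rw [← integral_div]
    congr 1
    ext x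
    split_ifs <;> simp
  rw [e, e, ← sub_div, abs_div, abs_of_pos (by linarith : 0 < M + 1),
    div_le_iff₀ (by linarith)] at h1
  rw [Real.dist_eq]
  have : ε / (2 * (M + 1)) * (M + 1) = ε / 2 := by field_simp
  rw [this] at h1
  linarith

variable {K : ℝ} (hK : 1 ≤ K)

lemma measurable_IccExtend (f : C(Set.Icc 1 K, ℝ)) : Measurable (Set.IccExtend hK f) :=
  (f.continuous.Icc_extend' (h := hK)).measurable

lemma abs_IccExtend_le (f : C(Set.Icc 1 K, ℝ)) (y : ℝ) : |Set.IccExtend hK f y| ≤ ‖f‖ :=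
  f.norm_coe_le_norm _

/-- The functional `f ↦ E[f(X + v); X + v ≥ 1]` on the continuous functions on `[1, K]`. -/
def childFunctional (ρ : ProbabilityMeasure I) (v : ℝ) : C(Set.Icc 1 K, ℝ) →L[ℝ] ℝ :=
  LinearMap.mkContinuous
    { toFun := fun f => kern ρ (Set.IccExtend hK f) v
      map_add' := fun f g => by
        have h1 := integrable_kern ρ (measurable_IccExtend hK f)
          (fun y _ => abs_IccExtend_le hK f y) v
        have h2 := integrable_kern ρ (measurable_IccExtend hK g)
          (fun y _ => abs_IccExtend_le hK g y) v
        simp only [kern]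
        rw [← integral_add h1 h2]
        congr 1
        ext x
        split_ifs <;> simp [Set.IccExtend]
      map_smul' := fun a f => by
        simp only [kern, RingHom.id_apply, smul_eq_mul]
        rw [← integral_const_mul]
        congr 1
        ext x
        split_ifs <;> simp [Set.IccExtend] } 1
    fun f => by
      rw [one_mul]
      exact abs_kern_le ρ (fun y _ => abs_IccExtend_le hK f y) v

lemma childFunctional_apply (ρ : ProbabilityMeasure I) (v : ℝ) (f : C(Set.Icc 1 K, ℝ)) :
    childFunctional hK ρ v f = kern ρ (Set.IccExtend hK f) v := rfl

lemma abs_childFunctional_le (ρ : ProbabilityMeasure I) (v : ℝ) (f : C(Set.Icc 1 K, ℝ)) :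
    |childFunctional hK ρ v f| ≤ ‖f‖ :=
  abs_kern_le ρ (fun y _ => abs_IccExtend_le hK f y) v

lemma childFunctional_nonneg (ρ : ProbabilityMeasure I) (v : ℝ) {f : C(Set.Icc 1 K, ℝ)}
    (hf : 0 ≤ f) : 0 ≤ childFunctional hK ρ v f := by
  refine integral_nonneg fun x => ?_
  simp only [Pi.zero_apply]
  split_ifs
  · exact hf _
  · exact le_rfl

/-- The expected value operator `(A f)(θ) = E[f(X + θ/b); X + θ/b ≥ 1]`. -/
def childOp (b : ℕ) (hac : (ρ : Measure I) ≪ volume) :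
    C(Set.Icc 1 K, ℝ) →L[ℝ] C(Set.Icc 1 K, ℝ) :=
  LinearMap.mkContinuous
    { toFun := fun f => ⟨fun θ => childFunctional hK ρ (θ / b) f,
        (continuous_kern hac (measurable_IccExtend hK f)
          (fun y _ => abs_IccExtend_le hK f y)).comp (by fun_prop)⟩
      map_add' := fun f g => by ext θ; exact map_add (childFunctional hK ρ (θ / b)) f g
      map_smul' := fun a f => by ext θ; exact map_smul (childFunctional hK ρ (θ / b)) a f } 1
    fun f => by
      rw [one_mul]
      refine (ContinuousMap.norm_le _ (norm_nonneg _)).2 fun θ => ?_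
      exact abs_childFunctional_le hK ρ _ f

lemma childOp_apply (b : ℕ) (hac : (ρ : Measure I) ≪ volume) (f : C(Set.Icc 1 K, ℝ))
    (θ : Set.Icc 1 K) : childOp hK b hac f θ = childFunctional hK ρ (θ / b) f := rfl

lemma childOp_nonneg (b : ℕ) (hac : (ρ : Measure I) ≪ volume) (f : C(Set.Icc 1 K, ℝ)) (hf : 0 ≤ f) :
    0 ≤ childOp hK b hac f := fun _ => childFunctional_nonneg hK ρ _ hf

end Kernel


/-! ### Comparability of powers and Dobrushin's condition for the kernel -/

noncomputable section Kernel

variable {ρ : ProbabilityMeasure I}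

lemma xStar_set_nonempty (ρ : ProbabilityMeasure I) :
    {y : ℝ | 0 ≤ y ∧ y ≤ 1 ∧ 0 < (ρ : Measure I) {x : I | y ≤ x}}.Nonempty := by
  refine ⟨0, le_rfl, zero_le_one, ?_⟩
  have : {x : I | (0 : ℝ) ≤ x} = Set.univ := Set.eq_univ_of_forall fun x => x.2.1
  rw [this, measure_univ]
  exact one_pos

lemma xStar_bddAbove (ρ : ProbabilityMeasure I) :
    BddAbove {y : ℝ | 0 ≤ y ∧ y ≤ 1 ∧ 0 < (ρ : Measure I) {x : I | y ≤ x}} :=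
  ⟨1, fun _ h => h.2.1⟩

lemma xStar_le_one (ρ : ProbabilityMeasure I) : xStar ρ ≤ 1 :=
  csSup_le (xStar_set_nonempty ρ) fun _ h => h.2.1

lemma xStar_nonneg (ρ : ProbabilityMeasure I) : 0 ≤ xStar ρ := by
  obtain ⟨y, hy⟩ := xStar_set_nonempty ρ
  exact hy.1.trans (le_csSup (xStar_bddAbove ρ) hy)

lemma measure_pos_of_lt_xStar {a : ℝ} (ha : a < xStar ρ) :
    0 < (ρ : Measure I).real {x : I | a ≤ x} := by
  obtain ⟨y, hy, hay⟩ := exists_lt_of_lt_csSup (xStar_set_nonempty ρ) ha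
  have h1 : (ρ : Measure I) {x : I | y ≤ x} ≤ (ρ : Measure I) {x : I | a ≤ x} :=
    measure_mono fun x hx => hay.le.trans hx
  exact ENNReal.toReal_pos (hy.2.2.trans_le h1).ne' (measure_ne_top _ _)

lemma measure_ge_eq_zero {y : ℝ} (hy : xStar ρ < y) : (ρ : Measure I) {x : I | y ≤ x} = 0 := by
  by_contra h
  have h0 := xStar_nonneg ρ
  have h1 : y ≤ 1 := by
    by_contra hcon
    refine h ?_
    convert measure_empty (μ := (ρ : Measure I))
    ext x
    simp only [Set.mem_ofPred_eq, Set.mem_empty_iff_false, iff_false]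
    intro hx
    exact hcon (hx.trans x.2.2)
  have : y ≤ xStar ρ := le_csSup (xStar_bddAbove ρ) ⟨by linarith, h1, pos_iff_ne_zero.2 h⟩
  linarith

/-- The half-lines strictly above `x⋆` are null by definition of the supremum, and absolute
continuity excludes an atom at `x⋆` itself. -/
lemma measure_xStar_le (hac : (ρ : Measure I) ≪ volume) :
    (ρ : Measure I) {x : I | xStar ρ ≤ x} = 0 := by
  have h1 : {x : I | xStar ρ ≤ x} ⊆ {x : I | (x : ℝ) = xStar ρ} ∪
      ⋃ n : ℕ, {x : I | xStar ρ + 1 / (n + 1 : ℝ) ≤ x} := by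
    intro x hx
    rcases (show xStar ρ ≤ x from hx).eq_or_lt with h | h
    · exact Or.inl h.symm
    · right
      obtain ⟨n, hn⟩ := exists_nat_one_div_lt (sub_pos.2 h)
      exact Set.mem_iUnion.2 ⟨n, show xStar ρ + 1 / (n + 1 : ℝ) ≤ x by linarith⟩
  refine measure_mono_null h1 (measure_union_null ?_ (measure_iUnion_null fun n => ?_))
  · refine hac (Set.Subsingleton.measure_zero ?_ _)
    intro x hx y hy
    exact Subtype.ext ((show (x : ℝ) = _ from hx).trans (show (y : ℝ) = _ from hy).symm)
  · exact measure_ge_eq_zero (lt_add_of_pos_right _ Nat.one_div_pos_of_nat)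

lemma ae_lt_xStar (hac : (ρ : Measure I) ≪ volume) : ∀ᵐ x : I ∂(ρ : Measure I), (x : ℝ) < xStar ρ := by
  rw [ae_iff]
  simpa using measure_xStar_le hac

lemma measurableSet_ge (a : ℝ) : MeasurableSet {x : I | a ≤ x} :=
  measurableSet_le measurable_const measurable_subtype_coe

lemma exists_small_top (hac : (ρ : Measure I) ≪ volume) {ε : ℝ} (hε : 0 < ε) :
    ∃ η > 0, η ≤ 1 ∧ (ρ : Measure I).real {x : I | xStar ρ - 2 * η ≤ x} ≤ ε := by
  have hanti : Antitone fun n : ℕ => {x : I | xStar ρ - 2 * (1 / (n + 1 : ℝ)) ≤ x} := by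
    intro m n hmn x hx
    have : 1 / (n + 1 : ℝ) ≤ 1 / (m + 1 : ℝ) := Nat.one_div_le_one_div hmn
    have hx' : xStar ρ - 2 * (1 / (n + 1 : ℝ)) ≤ x := hx
    change xStar ρ - 2 * (1 / (m + 1 : ℝ)) ≤ x
    linarith
  have h1 := tendsto_measure_iInter_atTop (μ := (ρ : Measure I))
    (fun n => (measurableSet_ge (xStar ρ - 2 * (1 / ((n : ℕ) + 1 : ℝ)))).nullMeasurableSet) hanti
    ⟨0, measure_ne_top _ _⟩
  have h2 : (⋂ n : ℕ, {x : I | xStar ρ - 2 * (1 / (n + 1 : ℝ)) ≤ x}) ⊆ {x : I | xStar ρ ≤ x} := by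
    intro x hx
    rw [Set.mem_iInter] at hx
    have h3 : Tendsto (fun n : ℕ => xStar ρ - 2 * (1 / (n + 1 : ℝ))) atTop (𝓝 (xStar ρ - 2 * 0)) :=
      (tendsto_one_div_add_atTop_nhds_zero_nat.const_mul 2).const_sub _
    have := le_of_tendsto' h3 hx
    simpa using this
  rw [measure_mono_null h2 (measure_xStar_le hac)] at h1
  have h4 := h1.eventually (gt_mem_nhds (ENNReal.ofReal_pos.2 hε))
  obtain ⟨n, hn⟩ := h4.exists
  refine ⟨1 / (n + 1 : ℝ), Nat.one_div_pos_of_nat, ?_, ?_⟩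
  · rw [div_le_one (by positivity)]; linarith [(Nat.cast_nonneg n : (0 : ℝ) ≤ n)]
  · exact ENNReal.toReal_le_of_le_ofReal hε.le hn.le

variable {K : ℝ} (hK : 1 ≤ K)

lemma mul_le_kern (ρ : ProbabilityMeasure I) {F : ℝ → ℝ} (hFm : Monotone F) (hF0 : ∀ y, 0 ≤ F y)
    {M : ℝ} (hM : ∀ y, F y ≤ M) {a v : ℝ} (hav : 1 ≤ a + v) :
    (ρ : Measure I).real {x : I | a ≤ x} * F (a + v) ≤ kern ρ F v := by
  have h1 : (ρ : Measure I).real {x : I | a ≤ x} * F (a + v)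
      = ∫ x, ({x : I | a ≤ x}.indicator fun _ => F (a + v)) x ∂(ρ : Measure I) := by
    rw [integral_indicator (measurableSet_ge a), setIntegral_const, smul_eq_mul]
  rw [h1]
  refine integral_mono ((integrable_const _).indicator (measurableSet_ge a))
    (integrable_kern ρ hFm.measurable (M := M) (fun y _ => by rw [abs_of_nonneg (hF0 y)]; exact hM y) v)
    fun x => ?_
  by_cases hx : x ∈ {x : I | a ≤ x}
  · rw [Set.indicator_of_mem hx]
    have hx' : a ≤ x := hx
    simp only
    rw [if_pos (by linarith)]
    exact hFm (by linarith)
  · rw [Set.indicator_of_notMem hx]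
    simp only
    split_ifs
    · exact hF0 _
    · exact le_rfl

variable {b : ℕ} (hac : (ρ : Measure I) ≪ volume)

lemma childOp_one_le (θ : Set.Icc 1 K) : childOp hK b hac 1 θ ≤ 1 :=
  (le_abs_self _).trans ((abs_childFunctional_le hK ρ _ _).trans_eq (by
    have : Nonempty (Set.Icc 1 K) := ⟨θ⟩
    exact norm_one))

/-- A mother of energy at least one passes on at least `1/b`, so an own energy of `1 - 1/b` suffices
for the child. This is the uniform one-step survival probability `p`. -/
lemma childOp_one_ge (θ : Set.Icc 1 K) :
    (ρ : Measure I).real {x : I | 1 - 1 / (b : ℝ) ≤ x} ≤ childOp hK b hac 1 θ := by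
  have h1 : (ρ : Measure I).real {x : I | 1 - 1 / (b : ℝ) ≤ x} * (fun _ => (1 : ℝ)) (1 - 1 / (b : ℝ) + 1 / b)
      ≤ kern ρ (fun _ => 1) (1 / b) := mul_le_kern ρ monotone_const (fun _ => zero_le_one) (M := 1)
        (fun _ => le_rfl) (by simp)
  rw [mul_one] at h1
  refine h1.trans ?_
  refine integral_mono (integrable_kern ρ measurable_const (M := 1) (fun _ _ => by simp) _)
    (integrable_kern ρ (measurable_IccExtend hK 1) (fun y _ => abs_IccExtend_le hK 1 y) _) fun x => ?_
  have : (1 : ℝ) / b ≤ θ / b := by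
    have := θ.2.1
    gcongr
  simp only
  split_ifs with h2 h3 h3
  · simp [Set.IccExtend]
  · linarith
  · simp [Set.IccExtend]
  · exact le_rfl

lemma childOp_monotone {f : C(Set.Icc 1 K, ℝ)} (hf0 : 0 ≤ f) (hf : Monotone f) :
    Monotone (childOp hK b hac f) := by
  intro θ θ' h
  refine integral_mono
    (integrable_kern ρ (measurable_IccExtend hK f) (fun y _ => abs_IccExtend_le hK f y) _)
    (integrable_kern ρ (measurable_IccExtend hK f) (fun y _ => abs_IccExtend_le hK f y) _) fun x => ?_
  have h' : (θ : ℝ) / b ≤ θ' / b := by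
    have : (θ : ℝ) ≤ θ' := h
    gcongr
  simp only
  split_ifs with h2 h3 h3
  · exact hf (Set.monotone_projIcc hK (by linarith))
  · linarith
  · exact hf0 _
  · exact le_rfl

-- Survival probabilities increase with the initial energy, so it is enough to compare `K` with `1`.
-- Energies relax towards `θs = x⋆ / (1 - 1/b)`, the fixed point of `y ↦ x⋆ + y/b`. From `1` the
-- process climbs close to `θs` in boundedly many steps with probability bounded below; from `K` it
-- falls below `θs + η` in boundedly many steps almost surely. The gap around `θs` is bridged
-- because leaving it downwards is far more likely than staying.
set_option maxHeartbeats 1000000 in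
lemma childOp_pow_comparable (hb : 1 < b) (hK3 : 3 ≤ K)
    (hp : 0 < (ρ : Measure I).real {x : I | 1 - 1 / (b : ℝ) ≤ x}) :
    ∃ C : ℝ, ∀ n θ θ', (childOp hK b hac ^ n) 1 θ ≤ C * (childOp hK b hac ^ n) 1 θ' := by
  set A := childOp hK b hac with hA
  set p := (ρ : Measure I).real {x : I | 1 - 1 / (b : ℝ) ≤ x}
  have hp1 : p ≤ 1 := measureReal_le_one
  have hApos : ∀ f, 0 ≤ f → 0 ≤ A f := childOp_nonneg hK b hac
  have hsucc : ∀ n f, (A ^ (n + 1)) f = A ((A ^ n) f) := fun n f => by rw [pow_succ']; rfl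
  have f0 : ∀ n, 0 ≤ (A ^ n) 1 := fun n => pow_pos_of_pos hApos n 1 zero_le_one
  have fmono : ∀ n, Monotone ((A ^ n) 1) := by
    intro n
    induction n with
    | zero => intro x y _; simp
    | succ n ih => rw [hsucc]; exact childOp_monotone hK hac (f0 n) ih
  have fanti : ∀ n, (A ^ (n + 1)) 1 ≤ (A ^ n) 1 := by
    intro n
    induction n with
    | zero => exact ContinuousMap.le_def.2 fun θ => by simpa using childOp_one_le hK hac θ
    | succ n ih =>
      have h := map_mono_of_pos A hApos ih
      rwa [← hsucc, ← hsucc] at h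
  have f1 : ∀ n, (A ^ n) 1 ≤ 1 := by
    intro n
    induction n with
    | zero => simp
    | succ n ih => exact (fanti n).trans ih
  set c : ℝ := 1 / b with hc
  have hb' : (2 : ℝ) ≤ b := by exact_mod_cast hb
  have hc0 : 0 < c := by positivity
  have hc2 : c ≤ 1 / 2 := by rw [hc]; gcongr
  let g : ℕ → ℝ → ℝ := fun n => Set.IccExtend hK ((A ^ n) 1)
  have gmono : ∀ n, Monotone (g n) := fun n => (fmono n).comp (Set.monotone_projIcc hK)
  have g0 : ∀ n y, 0 ≤ g n y := fun n y => f0 n _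
  have g1 : ∀ n y, g n y ≤ 1 := fun n y => f1 n _
  have ganti : ∀ n y, g (n + 1) y ≤ g n y := fun n y => fanti n _
  have ganti' : ∀ n j y, g (n + j) y ≤ g n y := fun n j y => by
    induction j with
    | zero => exact le_rfl
    | succ j ih => exact (ganti _ y).trans ih
  have gstep : ∀ n y, 1 ≤ y → y ≤ K → g (n + 1) y = kern ρ (g n) (c * y) := by
    intro n y h1 h2
    have e : g (n + 1) y = (A ^ (n + 1)) 1 ⟨y, h1, h2⟩ := Set.IccExtend_of_mem hK _ ⟨h1, h2⟩
    rw [e, hsucc, hA, childOp_apply, childFunctional_apply]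
    rw [hc, one_div_mul_eq_div]
  have gpos : ∀ n y, 0 < g n y := fun n y =>
    (pow_pos hp n).trans_le (pow_one_ge hApos hp.le (childOp_one_ge hK hac) n _)
  have low : ∀ n a y, 1 ≤ y → y ≤ K → 1 ≤ a + c * y →
      (ρ : Measure I).real {x : I | a ≤ x} * g n (a + c * y) ≤ g (n + 1) y := by
    intro n a y h1 h2 h3
    rw [gstep n y h1 h2]
    exact mul_le_kern ρ (gmono n) (g0 n) (g1 n) h3
  have base : ∀ n, p * g n 1 ≤ g (n + 1) 1 := by
    intro n
    have := low n (1 - 1 / (b : ℝ)) 1 le_rfl hK (by rw [hc]; linarith)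
    rwa [hc, mul_one, sub_add_cancel] at this
  have basej : ∀ n j, p ^ j * g n 1 ≤ g (n + j) 1 := by
    intro n j
    induction j with
    | zero => simp
    | succ j ih =>
      have := base (n + j)
      rw [pow_succ, ← Nat.add_assoc]
      nlinarith
  -- The bound `p / 2` is used twice: it forces `1 - 1/b < x⋆ - 2 η`, which keeps the climbing
  -- process alive, and it makes staying near `θs` cost more than surviving from `1`.
  obtain ⟨η, hη0, hη1, hη⟩ := exists_small_top hac (half_pos hp)
  set xs := xStar ρ
  have hxs1 : xs ≤ 1 := xStar_le_one ρ
  have hxs : 1 - c < xs - 2 * η := by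
    by_contra hcon
    push Not at hcon
    have : p ≤ (ρ : Measure I).real {x : I | xs - 2 * η ≤ x} :=
      measureReal_mono fun x hx => hcon.trans hx
    linarith
  set θs := xs / (1 - c)
  have hc1 : 0 < 1 - c := by linarith
  have hθs : xs + c * θs = θs := by simp only [θs]; field_simp; ring
  have hθs1 : 1 ≤ θs := by rw [le_div_iff₀ hc1]; linarith
  have hθs2 : θs ≤ 2 := by rw [div_le_iff₀ hc1]; linarith
  have hcj : ∀ j, c ^ j ≤ 1 := fun j => pow_le_one₀ hc0.le (by linarith)
  have hcj0 : ∀ j, 0 < c ^ j := fun j => pow_pos hc0 j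
  have hctend : Tendsto (fun j : ℕ => c ^ j) atTop (𝓝 0) :=
    tendsto_pow_atTop_nhds_zero_of_lt_one hc0.le (by linarith)
  -- climbing from `1` to just below `θs`
  obtain ⟨C₁, hC₁0, hC₁⟩ : ∃ C₁ : ℝ, 0 ≤ C₁ ∧ ∀ n y, y ≤ θs - η → g n y ≤ C₁ * g n 1 := by
    -- Lowering the driving energy by `η / 4` lowers the fixed point by at most `η / 2`, as `1 - c ≥
    -- 1/2`; the other `η / 2` is left for the finite number of steps.
    set a := xs - η / 4
    set q := (ρ : Measure I).real {x : I | a ≤ x}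
    have hq : 0 < q := measure_pos_of_lt_xStar (by simp only [a]; linarith)
    set θa := a / (1 - c)
    have hθa : a + c * θa = θa := by simp only [θa]; field_simp; ring
    have hθa1 : 1 ≤ θa := by rw [le_div_iff₀ hc1]; simp only [a]; linarith
    have hθa2 : θa ≤ 2 := by rw [div_le_iff₀ hc1]; simp only [a]; linarith
    have hθas : θs - η / 2 ≤ θa := by
      have : θs - θa = (η / 4) / (1 - c) := by simp only [θs, θa, a]; field_simp; ring
      have h2 : (η / 4) / (1 - c) ≤ η / 2 := by rw [div_le_iff₀ hc1]; nlinarith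
      linarith
    -- The argument is the `j`-th iterate of `1` under `y ↦ a + c y`, reached or exceeded with
    -- probability at least `q ^ j`.
    have climb : ∀ j n, q ^ j * g n (θa - (θa - 1) * c ^ j) ≤ g (n + j) 1 := by
      intro j
      induction j with
      | zero => intro n; simp
      | succ j ih =>
        intro n
        have h1 := ih (n + 1)
        have hy : ∀ i, 1 ≤ θa - (θa - 1) * c ^ i := fun i => by
          have := mul_le_of_le_one_right (by linarith : 0 ≤ θa - 1) (hcj i)
          linarith
        have hy1 := hy j
        have hy2 : θa - (θa - 1) * c ^ j ≤ K := by
          have := mul_nonneg (by linarith : 0 ≤ θa - 1) (hcj0 j).le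
          linarith
        have e : a + c * (θa - (θa - 1) * c ^ j) = θa - (θa - 1) * c ^ (j + 1) := by
          rw [pow_succ]; linear_combination hθa
        have hy3 := hy (j + 1)
        have h2 := low n a _ hy1 hy2 (by rw [e]; exact hy3)
        rw [e] at h2
        have h3 := mul_le_mul_of_nonneg_left h2 (pow_pos hq j).le
        rw [show n + (j + 1) = n + 1 + j by ring, pow_succ, mul_assoc]
        exact h3.trans h1
    obtain ⟨j, hj⟩ := (hctend.eventually (gt_mem_nhds (half_pos hη0))).exists
    refine ⟨(q ^ j)⁻¹, by positivity, fun n y hy => ?_⟩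
    rw [inv_mul_eq_div, le_div_iff₀ (pow_pos hq j), mul_comm]
    have h1 : y ≤ θa - (θa - 1) * c ^ j := by nlinarith [hcj0 j]
    calc q ^ j * g n y ≤ q ^ j * g n (θa - (θa - 1) * c ^ j) := by gcongr; exact gmono n h1
      _ ≤ g (n + j) 1 := climb j n
      _ ≤ g n 1 := ganti' n j 1
  -- comparison just above `θs`
  have step : ∀ n, g (n + 1) (θs + η) ≤ C₁ * g n 1 + p / 2 * g n (θs + η) := by
    intro n
    rw [gstep n _ (by linarith) (by linarith)]
    set E := {x : I | xs - 2 * η ≤ x}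
    have h1 : C₁ * g n 1 + (ρ : Measure I).real E * g n (θs + η)
        = ∫ x, (C₁ * g n 1 + (E.indicator fun _ => g n (θs + η)) x) ∂(ρ : Measure I) := by
      rw [integral_add (integrable_const _) ((integrable_const _).indicator (measurableSet_ge _)),
        integral_indicator (measurableSet_ge _), setIntegral_const, integral_const]
      simp only [smul_eq_mul, probReal_univ, one_mul]
      rfl
    have h2 : (ρ : Measure I).real E * g n (θs + η) ≤ p / 2 * g n (θs + η) :=
      mul_le_mul_of_nonneg_right hη (g0 _ _)
    refine le_trans ?_ (add_le_add_right h2 (C₁ * g n 1))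
    rw [h1]
    refine integral_mono_ae (integrable_kern ρ (gmono n).measurable (M := 1)
      (fun y _ => by rw [abs_of_nonneg (g0 n y)]; exact g1 n y) _)
      ((integrable_const _).add ((integrable_const _).indicator (measurableSet_ge _))) ?_
    filter_upwards [ae_lt_xStar hac] with x hx
    have hnn : 0 ≤ C₁ * g n 1 := mul_nonneg hC₁0 (g0 _ _)
    by_cases hxE : x ∈ E
    · rw [Set.indicator_of_mem hxE]
      split_ifs
      · have : g n (x + c * (θs + η)) ≤ g n (θs + η) := gmono n (by
          change (x : ℝ) < xs at hx
          nlinarith)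
        linarith
      · linarith [g0 n (θs + η)]
    · rw [Set.indicator_of_notMem hxE, add_zero]
      have hxE' : (x : ℝ) < xs - 2 * η := not_le.1 hxE
      split_ifs
      · exact hC₁ n _ (by nlinarith)
      · exact hnn
  -- Chosen so that `C₁ + (p / 2) C₂ ≤ p C₂`: one step from `θs + η` costs the left side, while `g n
  -- 1` loses at most the factor `p` per step.
  set C₂ := 1 + 2 * C₁ / p
  have hC₂ : 1 ≤ C₂ := by
    have : 0 ≤ 2 * C₁ / p := by positivity
    simp only [C₂]; linarith
  have above : ∀ n, g n (θs + η) ≤ C₂ * g n 1 := by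
    intro n
    induction n with
    | zero => simpa [g, Set.IccExtend] using hC₂
    | succ n ih =>
      have h1 := step n
      have h2 := base n
      have h3 : C₁ + p / 2 * C₂ ≤ C₂ * p := by
        have : C₂ * p = p + 2 * C₁ := by simp only [C₂]; field_simp
        nlinarith
      calc g (n + 1) (θs + η) ≤ C₁ * g n 1 + p / 2 * (C₂ * g n 1) := by
            refine h1.trans ?_
            gcongr
        _ = (C₁ + p / 2 * C₂) * g n 1 := by ring
        _ ≤ (C₂ * p) * g n 1 := mul_le_mul_of_nonneg_right h3 (g0 _ _)
        _ = C₂ * (p * g n 1) := by ring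
        _ ≤ _ := by gcongr
  -- descending from `K`
  have desc : ∀ n y, 1 ≤ y → y ≤ K → g (n + 1) y ≤ g n (xs + c * y) := by
    intro n y h1 h2
    rw [gstep n y h1 h2]
    have h3 : g n (xs + c * y) = ∫ _, g n (xs + c * y) ∂(ρ : Measure I) := by simp
    rw [h3]
    refine integral_mono_ae (integrable_kern ρ (gmono n).measurable (M := 1)
      (fun y _ => by rw [abs_of_nonneg (g0 n y)]; exact g1 n y) _) (integrable_const _) ?_
    filter_upwards [ae_lt_xStar hac] with x hx
    split_ifs
    · exact gmono n (by linarith)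
    · exact g0 _ _
  have descj : ∀ j n, g (n + j) K ≤ g n (θs + (K - θs) * c ^ j) := by
    intro j
    induction j with
    | zero => intro n; simp
    | succ j ih =>
      intro n
      have h1 := ih (n + 1)
      rw [show n + (j + 1) = n + 1 + j by ring]
      refine h1.trans ((desc n _ ?_ ?_).trans (le_of_eq ?_))
      · have := mul_nonneg (by linarith : 0 ≤ K - θs) (hcj0 j).le
        linarith
      · have := mul_le_of_le_one_right (by linarith : 0 ≤ K - θs) (hcj j)
        linarith
      · congr 1
        rw [pow_succ]; linear_combination hθs
  obtain ⟨j, hj⟩ := ((hctend.const_mul (K - θs)).eventually (gt_mem_nhds (by simpa using hη0))).exists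
  set C := C₂ * (p ^ j)⁻¹
  have hC : ∀ n, g n K ≤ C * g n 1 := by
    intro n
    have hpj := pow_pos hp j
    -- The first `j` times, before the descent is complete, are covered by the crude bound `g n 1 ≥
    -- p ^ n ≥ p ^ j`.
    rcases le_or_gt j n with h | h
    · obtain ⟨m, rfl⟩ := Nat.exists_eq_add_of_le' h
      calc g (m + j) K ≤ g m (θs + (K - θs) * c ^ j) := descj j m
        _ ≤ g m (θs + η) := gmono m (by linarith)
        _ ≤ C₂ * g m 1 := above m
        _ = C * (p ^ j * g m 1) := by simp only [C]; field_simp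
        _ ≤ C * g (m + j) 1 := by gcongr; exact basej m j
    · have h1 := basej 0 n
      have h2 : g 0 1 = 1 := by simp [g, Set.IccExtend]
      rw [h2, mul_one, zero_add] at h1
      have h3 : p ^ j ≤ p ^ n := pow_le_pow_of_le_one hp.le hp1 h.le
      calc g n K ≤ 1 := g1 n K
        _ ≤ C₂ := hC₂
        _ = C * p ^ j := by simp only [C]; field_simp
        _ ≤ C * g n 1 := by gcongr; exact h3.trans h1
  refine ⟨C, fun n θ θ' => ?_⟩
  have e1 : (A ^ n) 1 θ ≤ g n K := by
    have : g n θ = (A ^ n) 1 θ := Set.IccExtend_of_mem hK _ θ.2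
    rw [← this]; exact gmono n θ.2.2
  have e2 : g n 1 ≤ (A ^ n) 1 θ' := by
    have : g n θ' = (A ^ n) 1 θ' := Set.IccExtend_of_mem hK _ θ'.2
    rw [← this]; exact gmono n θ'.2.1
  exact e1.trans ((hC n).trans (by gcongr))

/-- Coupling: two processes driven by the same energies approach each other by the factor `b` per
step, and both survive a step with probability at least `p`. Once they are close, the modulus of
continuity makes their one-step kernels nearly equal. -/
lemma childOp_dobrushin (hb : 1 < b) (hK3 : 3 ≤ K)
    (hp : 0 < (ρ : Measure I).real {x : I | 1 - 1 / (b : ℝ) ≤ x}) :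
    ∃ (m : ℕ) (δ : ℝ), 0 < δ ∧ ∀ f : C(Set.Icc 1 K, ℝ), 0 ≤ f → f ≤ 1 → ∀ θ θ',
      δ ≤ (childOp hK b hac ^ m) (1 - f) θ + (childOp hK b hac ^ m) f θ' := by
  set A := childOp hK b hac with hA
  set p := (ρ : Measure I).real {x : I | 1 - 1 / (b : ℝ) ≤ x}
  have hApos : ∀ f, 0 ≤ f → 0 ≤ A f := childOp_nonneg hK b hac
  have hsucc : ∀ n f, (A ^ (n + 1)) f = A ((A ^ n) f) := fun n f => by rw [pow_succ']; rfl
  have hb' : (2 : ℝ) ≤ b := by exact_mod_cast hb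
  obtain ⟨d, hd, hmod⟩ := exists_kern_modulus hac (half_pos hp)
  -- The base case is `A (1 - f) θ + A f θ' = A 1 θ - (A f θ - A f θ') ≥ p - p / 2`; each coupled
  -- step then costs a factor `p` and multiplies the admissible distance by `b`.
  have key : ∀ j : ℕ, ∀ f : C(Set.Icc 1 K, ℝ), 0 ≤ f → f ≤ 1 → ∀ θ θ' : Set.Icc 1 K,
      |(θ : ℝ) - θ'| ≤ d / 2 * b ^ j →
      p / 2 * p ^ j ≤ (A ^ (j + 1)) (1 - f) θ + (A ^ (j + 1)) f θ' := by
    intro j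
    induction j with
    | zero =>
      intro f hf0 hf1 θ θ' h
      rw [pow_zero, mul_one, zero_add, pow_one, map_sub]
      have h1 := childOp_one_ge hK (b := b) hac θ
      have h2 := hmod (Set.IccExtend hK f) (measurable_IccExtend hK f) (fun y _ => by
        have h3 : (0 : ℝ) ≤ Set.IccExtend hK f y := hf0 _
        rw [abs_of_nonneg h3]; exact hf1 _) (θ / b) (θ' / b) (by
          rw [← sub_div, abs_div, abs_of_pos (by linarith : (0 : ℝ) < b), div_lt_iff₀ (by linarith)]
          rw [pow_zero, mul_one] at h
          nlinarith)
      have h3 : A f θ - A f θ' ≤ p / 2 := (le_abs_self _).trans h2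
      rw [ContinuousMap.sub_apply]
      linarith
    | succ j ih =>
      intro f hf0 hf1 θ θ' h
      rw [hsucc (j + 1), hsucc (j + 1)]
      set g₁ := (A ^ (j + 1)) (1 - f)
      set g₂ := (A ^ (j + 1)) f
      have hg₁ : 0 ≤ g₁ := pow_pos_of_pos hApos _ _ (sub_nonneg.2 hf1)
      have hg₂ : 0 ≤ g₂ := pow_pos_of_pos hApos _ _ hf0
      have i1 := integrable_kern ρ (measurable_IccExtend hK g₁)
        (fun y _ => abs_IccExtend_le hK g₁ y) (θ / b)
      have i2 := integrable_kern ρ (measurable_IccExtend hK g₂)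
        (fun y _ => abs_IccExtend_le hK g₂ y) (θ' / b)
      change _ ≤ kern ρ (Set.IccExtend hK g₁) (θ / b) + kern ρ (Set.IccExtend hK g₂) (θ' / b)
      unfold kern
      rw [← integral_add i1 i2]
      set B := {x : I | 1 - 1 / (b : ℝ) ≤ x}
      have h1 : p / 2 * p ^ (j + 1)
          = ∫ x, (B.indicator fun _ => p / 2 * p ^ j) x ∂(ρ : Measure I) := by
        rw [integral_indicator (measurableSet_ge _), setIntegral_const, smul_eq_mul, pow_succ]
        change _ = p * _
        ring
      rw [h1]
      refine integral_mono ((integrable_const _).indicator (measurableSet_ge _)) (i1.add i2)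
        fun x => ?_
      have n1 : ∀ (g : C(Set.Icc 1 K, ℝ)) (y : ℝ), 0 ≤ g →
          (0 : ℝ) ≤ if 1 ≤ y then Set.IccExtend hK g y else 0 := fun g y hg => by
        split_ifs
        · exact hg _
        · exact le_rfl
      by_cases hx : x ∈ B
      · rw [Set.indicator_of_mem hx]
        have hx' : 1 - 1 / (b : ℝ) ≤ x := hx
        have mem : ∀ t : Set.Icc 1 K, 1 ≤ (x : ℝ) + t / b ∧ (x : ℝ) + t / b ≤ K := by
          intro t
          have t1 : 1 / (b : ℝ) ≤ t / b := by have := t.2.1; gcongr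
          have t2 : (t : ℝ) / b ≤ K / 2 := by
            have := t.2.2
            have := t.2.1
            gcongr
          have := x.2.2
          constructor <;> linarith
        simp only
        rw [if_pos (mem θ).1, if_pos (mem θ').1, Set.IccExtend_of_mem hK _ (mem θ),
          Set.IccExtend_of_mem hK _ (mem θ')]
        refine ih f hf0 hf1 _ _ ?_
        have e : (x : ℝ) + θ / b - (x + θ' / b) = (θ - θ') / b := by ring
        simp only [e]
        rw [abs_div, abs_of_pos (by linarith : (0 : ℝ) < b), div_le_iff₀ (by linarith)]
        rw [pow_succ] at h
        linarith
      · rw [Set.indicator_of_notMem hx]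
        exact add_nonneg (n1 g₁ _ hg₁) (n1 g₂ _ hg₂)
  obtain ⟨j, hj⟩ := pow_unbounded_of_one_lt (K / (d / 2)) (by linarith : (1 : ℝ) < b)
  rw [div_lt_iff₀ (by linarith), mul_comm] at hj
  refine ⟨j + 1, p / 2 * p ^ j, by positivity, fun f hf0 hf1 θ θ' => key j f hf0 hf1 θ θ' ?_⟩
  refine le_trans ?_ hj.le
  rw [abs_le]
  constructor <;> linarith [θ.2.1, θ.2.2, θ'.2.1, θ'.2.2]

theorem exists_perronData_childOp (hb : 1 < b) (hK3 : 3 ≤ K)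
    (hp : 0 < (ρ : Measure I).real {x : I | 1 - 1 / (b : ℝ) ≤ x}) :
    Nonempty (PerronData (childOp hK b hac)) := by
  have : Nonempty (Set.Icc 1 K) := ⟨⟨1, le_rfl, hK⟩⟩
  obtain ⟨C, hC⟩ := childOp_pow_comparable hK hac hb hK3 hp
  obtain ⟨m, δ, hδ, h⟩ := childOp_dobrushin hK hac hb hK3 hp
  exact exists_perronData (childOp_nonneg hK b hac) hp (childOp_one_ge hK hac) hC hδ h

end Kernel


/-! ### The avalanche as a set of surviving branches -/

section Combinatorics

variable {b : ℕ}

/-- The energy of a site at the time its mother avalanches, if all its ancestors do. -/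
noncomputable def energy : Config b → ℝ → Site b → ℝ
  | ω, v, [] => ω [] + v
  | ω, v, i :: s => energy (fun t => ω (i :: t)) ((ω [] + v) / b) s

/-- All the sites on the branch from the root to `s` have energy at least one when their turn
comes. -/
def Alive : Config b → ℝ → Site b → Prop
  | ω, v, [] => 1 ≤ (ω [] : ℝ) + v
  | ω, v, i :: s => 1 ≤ (ω [] : ℝ) + v ∧ Alive (fun t => ω (i :: t)) ((ω [] + v) / b) s

lemma energy_concat (ω : Config b) (v : ℝ) (s : Site b) (j : Fin b) :
    energy ω v (s ++ [j]) = ω (s ++ [j]) + energy ω v s / b := by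
  induction s generalizing ω v with
  | nil => simp [energy]
  | cons i s ih => simp [energy, ih]

lemma alive_concat (ω : Config b) (v : ℝ) (s : Site b) (j : Fin b) :
    Alive ω v (s ++ [j]) ↔ Alive ω v s ∧ 1 ≤ energy ω v (s ++ [j]) := by
  induction s generalizing ω v with
  | nil => simp [energy, Alive]
  | cons i s ih => simp [energy, Alive, ih, and_assoc]

lemma Alive.mono {ω : Config b} {v w : ℝ} (hvw : v ≤ w) {s : Site b} (h : Alive ω v s) :
    Alive ω w s := by
  induction s generalizing ω v w with
  | nil => exact le_trans h (by gcongr)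
  | cons i s ih => exact ⟨h.1.trans (by gcongr), ih (by gcongr) h.2⟩

variable {ω : Config b} {v : ℝ}

lemma process_nonneg (hv : 0 ≤ v) (t : ℕ) (s : Site b) : 0 ≤ process b ω v t s := by
  induction t generalizing s with
  | zero =>
    simp only [process]
    have := (ω s).2.1
    split_ifs <;> linarith
  | succ t ih =>
    simp only [process, step]
    split_ifs
    · exact add_nonneg (ih _) (div_nonneg (ih _) b.cast_nonneg)
    · exact le_rfl
    · exact ih _

/-- The active front leaves each layer for good. One step earlier the mother is already quiet by
induction, so the site receives nothing: it either is reset or was below one. -/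
lemma process_lt_one_of_length_lt (t : ℕ) (s : Site b) (h : s.length < t) :
    process b ω v t s < 1 := by
  induction t generalizing s with
  | zero => omega
  | succ t ih =>
    have hm : ¬ (s ≠ [] ∧ 1 ≤ process b ω v t s.dropLast) := by
      rintro ⟨hs, h1⟩
      have h2 : s.dropLast.length < t := by
        rw [List.length_dropLast]
        have := List.length_pos_of_ne_nil hs
        omega
      exact absurd (ih _ h2) (not_lt.2 h1)
    simp only [process, step]
    rw [if_neg hm]
    split_ifs with h1
    · exact one_pos
    · exact not_le.1 h1

lemma process_of_lt_length (hω : ∀ s, (ω s : ℝ) < 1) (t : ℕ) (s : Site b) (h : t < s.length) :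
    process b ω v t s = ω s := by
  induction t generalizing s with
  | zero => simp [process, List.ne_nil_of_length_pos h]
  | succ t ih =>
    simp only [process, step]
    have h1 := ih s (by omega)
    have h2 := ih s.dropLast (by rw [List.length_dropLast]; omega)
    rw [h1, h2, if_neg (fun h => absurd h.2 (not_le.2 (hω _))), if_neg (not_le.2 (hω _))]

-- Before time `s.length` nothing has reached `s`; in the last step it receives its mother's share
-- precisely when the mother is alive. The root has no mother, whence the separate disjunct.
open Classical in
lemma process_length (hω : ∀ s, (ω s : ℝ) < 1) (s : Site b) :
    process b ω v s.length s
      = if s = [] ∨ Alive ω v s.dropLast then energy ω v s else (ω s : ℝ) := by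
  induction s using List.reverseRecOn with
  | nil => simp [process, energy]
  | append_singleton s j ih =>
    have h1 : process b ω v s.length (s ++ [j]) = ω (s ++ [j]) :=
      process_of_lt_length hω _ _ (by simp)
    have h2 : 1 ≤ process b ω v s.length s ↔ Alive ω v s := by
      rw [ih]
      rcases List.eq_nil_or_concat s with rfl | ⟨s', i, rfl⟩
      · simp [energy, Alive]
      · rw [List.concat_eq_append, alive_concat]
        simp only [List.dropLast_concat, List.append_eq_nil_iff, List.cons_ne_self, and_false,
          false_or]
        split_ifs with h
        · simp [h]
        · simp [h, hω]
    rw [List.length_append, List.length_singleton]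
    simp only [process, step, List.dropLast_concat, h1, h2]
    by_cases h : Alive ω v s
    · have h3 := h2.2 h
      rw [ih] at h3 ⊢
      have h4 : s = [] ∨ Alive ω v s.dropLast := by
        rcases List.eq_nil_or_concat s with rfl | ⟨s', i, rfl⟩
        · exact Or.inl rfl
        · rw [List.concat_eq_append, alive_concat] at h
          right
          simpa using h.1
      simp [h, h4, energy_concat]
    · simp [h, hω]

/-- Unless some initial energy reaches one, a site avalanches if and only if it is alive. -/
lemma avalanche_eq (hω : ∀ s, (ω s : ℝ) < 1) (hv : 0 ≤ v) :
    avalanche b ω v = {s | Alive ω v s} := by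
  have key : ∀ s, 1 ≤ process b ω v s.length s ↔ Alive ω v s := by
    intro s
    rw [process_length hω]
    rcases List.eq_nil_or_concat s with rfl | ⟨s', i, rfl⟩
    · simp [energy, Alive]
    · rw [List.concat_eq_append, alive_concat]
      by_cases h : Alive ω v s'
      · rw [if_pos (Or.inr (by simpa using h))]; simp [h]
      · rw [if_neg (by simpa using h)]; simp [h, hω]
  ext s
  simp only [avalanche, avalancheBy, Set.mem_iUnion, Set.mem_ofPred_eq]
  constructor
  · rintro ⟨t, h0, r, hrt, hr⟩
    by_contra hs
    have hlt : ∀ t, process b ω v t s < 1 := by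
      intro t
      rcases lt_trichotomy t s.length with h | h | h
      · rw [process_of_lt_length hω _ _ h]; exact hω s
      · rw [h]; exact not_le.1 fun h => hs ((key s).1 h)
      · exact process_lt_one_of_length_lt t s h
    -- A site that never reaches one is never reset, so its energy only grows and cannot return to
    -- zero from a nonzero value.
    have hmono : Monotone fun t => process b ω v t s := by
      refine monotone_nat_of_le_succ fun t => ?_
      simp only [process, step]
      split_ifs with h1 h2
      · exact le_add_of_nonneg_right (div_nonneg (by linarith [h1.2]) b.cast_nonneg)
      · exact absurd (hlt t) (not_lt.2 h2)
      · exact le_rfl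
    exact hr (le_antisymm (h0 ▸ hmono hrt.le) (process_nonneg hv r s))
  · intro hs
    refine ⟨s.length + 1, ?_, s.length, lt_add_one _, ?_⟩
    · simp only [process, step]
      rw [if_neg, if_pos ((key s).2 hs)]
      rintro ⟨hne, h1⟩
      refine absurd h1 (not_le.2 (process_lt_one_of_length_lt _ _ ?_))
      rw [List.length_dropLast]
      have := List.length_pos_of_ne_nil hne
      omega
    · have := (key s).2 hs
      intro h
      linarith

/-- The number of sites alive. -/
noncomputable def aliveCount (ω : Config b) (v : ℝ) : ℕ∞ := {s | Alive ω v s}.encard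

lemma aliveCount_mono {w : ℝ} (h : v ≤ w) : aliveCount ω v ≤ aliveCount ω w :=
  Set.encard_le_encard fun _ hs => Alive.mono h hs

lemma aliveCount_of_lt (h : (ω [] : ℝ) + v < 1) : aliveCount ω v = 0 := by
  rw [aliveCount, Set.encard_eq_zero, Set.eq_empty_iff_forall_notMem]
  rintro (_ | ⟨i, s⟩) hs
  · exact absurd h (not_lt.2 hs)
  · exact absurd h (not_lt.2 hs.1)

lemma aliveCount_of_le (h : 1 ≤ (ω [] : ℝ) + v) :
    aliveCount ω v = 1 + ∑ i, aliveCount (fun t => ω (i :: t)) ((ω [] + v) / b) := by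
  have h1 : {s | Alive ω v s} = {[]} ∪ ⋃ i : Fin b,
      (fun s => i :: s) '' {s | Alive (fun t => ω (i :: t)) ((ω [] + v) / b) s} := by
    ext s
    rcases s with _ | ⟨i, s⟩
    · simp [Alive, h]
    · simp [Alive, h]
  rw [aliveCount, h1, Set.encard_union_eq, Set.encard_singleton, Set.encard_iUnion_of_finite]
  · congr 1
    rw [finsum_eq_sum_of_fintype]
    refine Finset.sum_congr rfl fun i _ => ?_
    exact (List.cons_injective (a := i)).encard_image _
  · intro i j hij
    rw [Function.onFun, Set.disjoint_left]
    rintro _ ⟨s, _, rfl⟩ ⟨s', _, h⟩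
    exact hij (List.cons.inj h).1.symm
  · simp

/-- Links the tree to the scalar recursion: along a constant branch the energies follow `Q`. The
index is shifted because the root, with `θ / b` added, already carries the first step of `Q`. -/
lemma alive_replicate (ω : Config b) (θ : ℝ) (j : Fin b) (n : ℕ) :
    Alive ω (θ / b) (List.replicate n j)
      ↔ ∀ k ≤ n, 1 ≤ Q b θ (fun m => ω (List.replicate m j)) (k + 1) := by
  have h : ∀ k, energy ω (θ / b) (List.replicate k j)
      = Q b θ (fun m => ω (List.replicate m j)) (k + 1) := by
    intro k
    induction k with
    | zero => simp [energy, Q]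
    | succ k ih =>
      rw [Q, ← ih, List.replicate_succ', energy_concat]
  induction n with
  | zero =>
    have := h 0
    simp only [List.replicate_zero, energy] at this
    simp [Alive, this]
  | succ n ih =>
    rw [List.replicate_succ', alive_concat, ← List.replicate_succ', h]
    refine (and_congr_left' ih).trans ?_
    constructor
    · rintro ⟨h1, h2⟩ k hk
      rcases hk.lt_or_eq with h' | rfl
      · exact h1 k (by omega)
      · exact h2
    · exact fun h' => ⟨fun k hk => h' k (by omega), h' _ le_rfl⟩

end Combinatorics


/-! ### Independence of subtrees and the branching recursion -/

noncomputable section Branching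

variable {b : ℕ}

instance (ρ : ProbabilityMeasure I) : IsProbabilityMeasure (law b ρ) := by
  unfold law; infer_instance

/-- The configuration with value `x` at the root and with the subtrees `w`. -/
def graft (p : I × (Fin b → Config b)) : Config b
  | [] => p.1
  | i :: s => p.2 i s

lemma measurable_graft : Measurable (graft (b := b)) := by
  refine measurable_pi_iff.2 fun s => ?_
  cases s with
  | nil => exact measurable_fst
  | cons i s =>
    exact (measurable_pi_apply s).comp ((measurable_pi_apply i).comp measurable_snd)

/-- Given the energy of the root, the subtrees of the root are independent copies of the tree. -/
lemma map_graft (ρ : ProbabilityMeasure I) :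
    ((ρ : Measure I).prod (Measure.pi fun _ : Fin b => law b ρ)).map graft = law b ρ := by
  classical
  refine Measure.eq_infinitePi _ fun S t ht => ?_
  rw [Measure.map_apply measurable_graft (MeasurableSet.pi S.countable_toSet fun s _ => ht s)]
  set u : Site b → Set I := fun s => if s ∈ S then t s else Set.univ
  have hu : ∀ s, MeasurableSet (u s) := fun s => by
    simp only [u]
    split_ifs
    exacts [ht s, MeasurableSet.univ]
  set T : Finset (Site b) := S.image List.tail
  have h1 : graft ⁻¹' (Set.pi S t)
      = u [] ×ˢ (Set.univ.pi fun i => Set.pi T fun s => u (i :: s)) := by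
    ext ⟨x, w⟩
    simp only [Set.mem_preimage, Set.mem_pi, Set.mem_prod, Set.mem_univ, forall_true_left,
      Finset.mem_coe]
    constructor
    · intro h
      refine ⟨?_, fun i s _ => ?_⟩
      · simp only [u]
        split_ifs with h0
        exacts [h _ h0, trivial]
      · simp only [u]
        split_ifs with h0
        exacts [h _ h0, trivial]
    · rintro ⟨h0, h⟩ s hs
      cases s with
      | nil =>
        simp only [u, if_pos hs] at h0
        exact h0
      | cons i s =>
        have h2 := h i s (Finset.mem_image.2 ⟨_, hs, rfl⟩)
        simp only [u, if_pos hs] at h2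
        exact h2
  rw [h1, Measure.prod_prod, Measure.pi_pi]
  have h2 : ∀ i : Fin b, law b ρ (Set.pi T fun s => u (i :: s))
      = ∏ s ∈ T, (ρ : Measure I) (u (i :: s)) := fun i =>
    Measure.infinitePi_pi _ fun s _ => hu _
  simp only [h2]
  -- `S` is enlarged to the root together with the full product of first letters and tails, with
  -- trivial constraints outside `S`, so that the product over sites factors.
  set S' : Finset (Site b) := insert [] ((Finset.univ ×ˢ T).image fun p : Fin b × Site b => p.1 :: p.2)
  have hS' : S ⊆ S' := by
    intro s hs
    cases s with
    | nil => simp [S']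
    | cons i s =>
      refine Finset.mem_insert_of_mem (Finset.mem_image.2 ⟨(i, s), ?_, rfl⟩)
      exact Finset.mem_product.2 ⟨Finset.mem_univ _, Finset.mem_image.2 ⟨_, hs, rfl⟩⟩
  have h3 : ∏ s ∈ S, (ρ : Measure I) (t s) = ∏ s ∈ S', (ρ : Measure I) (u s) := by
    rw [← Finset.prod_subset hS']
    · exact Finset.prod_congr rfl fun s hs => by simp [u, hs]
    · intro s _ hs
      simp [u, hs]
  rw [h3, Finset.prod_insert (by simp), Finset.prod_image, Finset.prod_product]
  rintro ⟨i, s⟩ _ ⟨j, s'⟩ _ h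
  have := List.cons.inj h
  exact Prod.ext this.1 this.2

lemma integral_law (ρ : ProbabilityMeasure I) {f : Config b → ℝ} (hf : Measurable f) {M : ℝ}
    (hM : ∀ ω, |f ω| ≤ M) :
    ∫ ω, f ω ∂(law b ρ) = ∫ x : I, ∫ w, f (graft (x, w)) ∂(Measure.pi fun _ : Fin b => law b ρ)
      ∂(ρ : Measure I) := by
  conv_lhs => rw [← map_graft ρ]
  rw [integral_map measurable_graft.aemeasurable hf.aestronglyMeasurable]
  exact integral_prod _ (Integrable.of_bound
    (hf.comp measurable_graft).aestronglyMeasurable M (Eventually.of_forall fun _ => hM _))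

lemma measurableSet_alive_prod (s : Site b) :
    MeasurableSet {p : Config b × ℝ | Alive p.1 p.2 s} := by
  have h0 : Measurable fun p : Config b × ℝ => (p.1 [] : ℝ) + p.2 := by fun_prop
  induction s with
  | nil => exact measurableSet_le measurable_const h0
  | cons i s ih =>
    have h1 : Measurable fun p : Config b × ℝ =>
        (((fun t => p.1 (i :: t)), ((p.1 [] : ℝ) + p.2) / b) : Config b × ℝ) := by
      refine Measurable.prodMk ?_ (h0.div_const _)
      exact measurable_pi_iff.2 fun t => (measurable_pi_apply _).comp measurable_fst
    exact (measurableSet_le measurable_const h0).inter (h1 ih)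

lemma measurableSet_alive (v : ℝ) (s : Site b) : MeasurableSet {ω : Config b | Alive ω v s} :=
  measurable_prodMk_right (y := v) (measurableSet_alive_prod s)

lemma encard_eq_tsum {α : Type*} (S : Set α) :
    ((S.encard : ℕ∞) : ℝ≥0∞) = ∑' a, S.indicator 1 a := by
  let _ : MeasurableSpace α := ⊤
  have : MeasurableSingletonClass α := ⟨fun _ => trivial⟩
  rw [← Measure.count_apply (s := S) trivial, ← lintegral_indicator_one (s := S) trivial,
    lintegral_count]

lemma aliveCount_eq_tsum (ω : Config b) (v : ℝ) :
    (aliveCount ω v : ℝ≥0∞) = ∑' s, {ω | Alive ω v s}.indicator 1 ω := by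
  rw [aliveCount, encard_eq_tsum]
  rfl

lemma measurable_aliveCount (v : ℝ) : Measurable fun ω : Config b => aliveCount ω v := by
  have h : Measurable fun ω : Config b => (aliveCount ω v : ℝ≥0∞) := by
    simp only [aliveCount_eq_tsum]
    exact Measurable.tsum fun s => measurable_one.indicator (measurableSet_alive v s)
  refine measurable_to_countable' fun n => ?_
  have : (fun ω : Config b => aliveCount ω v) ⁻¹' {n}
      = (fun ω : Config b => (aliveCount ω v : ℝ≥0∞)) ⁻¹' {(n : ℝ≥0∞)} := by
    ext ω
    simp
  rw [this]
  exact h (measurableSet_singleton _)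

lemma ae_law_lt_one {ρ : ProbabilityMeasure I} (hac : (ρ : Measure I) ≪ volume) :
    ∀ᵐ ω ∂(law b ρ), ∀ s, (ω s : ℝ) < 1 := by
  refine ae_all_iff.2 fun s => ?_
  have h1 : ∀ᵐ x : I ∂(ρ : Measure I), (x : ℝ) < 1 := by
    filter_upwards [ae_lt_xStar hac] with x hx
    exact hx.trans_le (xStar_le_one ρ)
  exact (measurePreserving_eval_infinitePi (fun _ : Site b => (ρ : Measure I)) s).quasiMeasurePreserving.ae h1

lemma ae_encard_avalanche {ρ : ProbabilityMeasure I} (hac : (ρ : Measure I) ≪ volume) {v : ℝ}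
    (hv : 0 ≤ v) : ∀ᵐ ω ∂(law b ρ), (avalanche b ω v).encard = aliveCount ω v := by
  filter_upwards [ae_law_lt_one hac] with ω hω
  rw [avalanche_eq hω hv, aliveCount]

/-- The power `s ^ n`, with the convention that it vanishes for `n = ∞`, even if `s = 1`. -/
def killedPow (s : ℝ) (n : ℕ∞) : ℝ := if n = ⊤ then 0 else s ^ n.toNat

lemma killedPow_natCast (s : ℝ) (n : ℕ) : killedPow s n = s ^ n := by simp [killedPow]

lemma killedPow_top (s : ℝ) : killedPow s ⊤ = 0 := by simp [killedPow]

lemma killedPow_add (s : ℝ) (m n : ℕ∞) : killedPow s (m + n) = killedPow s m * killedPow s n := by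
  induction m using ENat.recTopCoe with
  | top => simp [killedPow_top]
  | coe m =>
    induction n using ENat.recTopCoe with
    | top => simp [killedPow_top]
    | coe n => rw [← Nat.cast_add]; simp only [killedPow_natCast, pow_add]

lemma killedPow_sum (s : ℝ) {ι : Type*} (S : Finset ι) (n : ι → ℕ∞) :
    killedPow s (∑ i ∈ S, n i) = ∏ i ∈ S, killedPow s (n i) := by
  classical
  induction S using Finset.induction_on with
  | empty => simpa using killedPow_natCast s 0
  | insert i S hi ih => rw [Finset.sum_insert hi, Finset.prod_insert hi, killedPow_add, ih]

lemma killedPow_nonneg {s : ℝ} (hs : 0 ≤ s) (n : ℕ∞) : 0 ≤ killedPow s n := by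
  unfold killedPow; split_ifs <;> positivity

lemma killedPow_anti {s : ℝ} (hs : 0 ≤ s) (hs1 : s ≤ 1) : Antitone (killedPow s) := by
  intro m n h
  induction n using ENat.recTopCoe with
  | top => rw [killedPow_top]; exact killedPow_nonneg hs m
  | coe n =>
    lift m to ℕ using ne_top_of_le_ne_top (ENat.natCast_ne_top n) h
    rw [killedPow_natCast, killedPow_natCast]
    exact pow_le_pow_of_le_one hs hs1 (by exact_mod_cast h)

lemma killedPow_le_one {s : ℝ} (hs : 0 ≤ s) (hs1 : s ≤ 1) (n : ℕ∞) : killedPow s n ≤ 1 := by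
  have := killedPow_anti hs hs1 (zero_le (a := n))
  simpa [killedPow] using this

lemma abs_killedPow_le {s : ℝ} (hs : 0 ≤ s) (hs1 : s ≤ 1) (n : ℕ∞) : |killedPow s n| ≤ 1 := by
  rw [abs_of_nonneg (killedPow_nonneg hs n)]
  exact killedPow_le_one hs hs1 n

lemma measurable_killedPow_aliveCount (s v : ℝ) :
    Measurable fun ω : Config b => killedPow s (aliveCount ω v) :=
  (measurable_from_top (f := killedPow s)).comp (measurable_aliveCount v)

/-- The generating function of the number of sites alive. -/
def genFun (b : ℕ) (ρ : ProbabilityMeasure I) (s v : ℝ) : ℝ :=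
  ∫ ω, killedPow s (aliveCount (b := b) ω v) ∂(law b ρ)

variable {ρ : ProbabilityMeasure I}

lemma integrable_killedPow {s : ℝ} (hs : 0 ≤ s) (hs1 : s ≤ 1) (v : ℝ) :
    Integrable (fun ω : Config b => killedPow s (aliveCount ω v)) (law b ρ) :=
  Integrable.of_bound (measurable_killedPow_aliveCount s v).aestronglyMeasurable 1
    (Eventually.of_forall fun _ => abs_killedPow_le hs hs1 _)

lemma genFun_nonneg {s : ℝ} (hs : 0 ≤ s) (v : ℝ) : 0 ≤ genFun b ρ s v :=
  integral_nonneg fun _ => killedPow_nonneg hs _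

lemma genFun_le_one {s : ℝ} (hs : 0 ≤ s) (hs1 : s ≤ 1) (v : ℝ) : genFun b ρ s v ≤ 1 := by
  have := integral_mono (integrable_killedPow (b := b) (ρ := ρ) hs hs1 v) (integrable_const 1)
    fun ω => killedPow_le_one hs hs1 _
  simpa [genFun] using this

lemma genFun_antitone {s : ℝ} (hs : 0 ≤ s) (hs1 : s ≤ 1) : Antitone (genFun b ρ s) :=
  fun _ _ h => integral_mono (integrable_killedPow hs hs1 _) (integrable_killedPow hs hs1 _)
    fun _ => killedPow_anti hs hs1 (aliveCount_mono h)

lemma genFun_eq {s : ℝ} (hs : 0 ≤ s) (hs1 : s ≤ 1) (v : ℝ) :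
    genFun b ρ s v = ∫ x : I, (if 1 ≤ (x : ℝ) + v then s * genFun b ρ s ((x + v) / b) ^ b else 1)
      ∂(ρ : Measure I) := by
  rw [genFun, integral_law ρ (measurable_killedPow_aliveCount s v)
    fun _ => abs_killedPow_le hs hs1 _]
  congr 1
  ext x
  split_ifs with h
  · have : ∀ w : Fin b → Config b, killedPow s (aliveCount (graft (x, w)) v)
        = s * ∏ i, killedPow s (aliveCount (w i) ((x + v) / b)) := by
      intro w
      rw [aliveCount_of_le h, killedPow_add, killedPow_sum]
      congr 1
      simpa using killedPow_natCast s 1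
    simp only [this]
    rw [integral_const_mul, integral_fintype_prod_eq_pow (ι := Fin b)
      (fun ω : Config b => killedPow s (aliveCount ω ((x + v) / b))), Fintype.card_fin]
    rfl
  · have : ∀ w : Fin b → Config b, killedPow s (aliveCount (graft (x, w)) v) = 1 := by
      intro w
      rw [aliveCount_of_lt (not_le.1 h)]
      simpa using killedPow_natCast s 0
    simp [this]

/-- If the root stays below one, the avalanche is empty and contributes nothing to `1 - genFun`;
only the event inside `kern` remains. -/
lemma one_sub_genFun {s : ℝ} (hs : 0 ≤ s) (hs1 : s ≤ 1) (v : ℝ) :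
    1 - genFun b ρ s v = kern ρ (fun y => 1 - s * genFun b ρ s (y / b) ^ b) v := by
  have hm : Measurable fun y : ℝ => s * genFun b ρ s (y / b) ^ b :=
    (((genFun_antitone hs hs1).measurable.comp (measurable_id.div_const _)).pow_const _).const_mul _
  have hi : Integrable (fun x : I =>
      if 1 ≤ (x : ℝ) + v then s * genFun b ρ s ((x + v) / b) ^ b else 1) (ρ : Measure I) := by
    refine Integrable.of_bound (C := 1) (Measurable.ite ?_ ?_ measurable_const).aestronglyMeasurable
      (Eventually.of_forall fun x => ?_)
    · exact measurableSet_le measurable_const (measurable_subtype_coe.add_const v)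
    · exact hm.comp (measurable_subtype_coe.add_const v)
    · rw [Real.norm_eq_abs]
      split_ifs
      · have h0 := genFun_nonneg (b := b) (ρ := ρ) hs ((x + v) / b)
        have h1 := genFun_le_one (b := b) (ρ := ρ) hs hs1 ((x + v) / b)
        rw [abs_of_nonneg (by positivity)]
        exact mul_le_one₀ hs1 (by positivity) (pow_le_one₀ h0 h1)
      · simp
  have h1 := integral_sub (integrable_const (1 : ℝ)) hi
  rw [integral_const, probReal_univ, one_smul] at h1
  rw [genFun_eq hs hs1, ← h1, kern]
  congr 1
  ext x
  split_ifs
  · rfl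
  · exact sub_self 1

/-- The probability that a site is alive. -/
def aliveProb (b : ℕ) (ρ : ProbabilityMeasure I) (s : Site b) (v : ℝ) : ℝ :=
  (law b ρ).real {ω | Alive ω v s}

lemma aliveProb_nil (v : ℝ) : aliveProb b ρ [] v = kern ρ (fun _ => 1) v := by
  have h := integral_law (b := b) ρ (measurable_one.indicator (measurableSet_alive v [])) (M := 1)
    (f := {ω : Config b | Alive ω v []}.indicator 1) fun ω => by
      by_cases h : ω ∈ {ω : Config b | Alive ω v []} <;> simp [h]
  rw [integral_indicator_one (measurableSet_alive v [])] at h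
  rw [aliveProb, h, kern]
  congr 1
  ext x
  have : ∀ w : Fin b → Config b, {ω : Config b | Alive ω v []}.indicator (1 : Config b → ℝ)
      (graft (x, w)) = if 1 ≤ (x : ℝ) + v then 1 else 0 := fun w => rfl
  simp [this]

lemma aliveProb_cons (i : Fin b) (s : Site b) (v : ℝ) :
    aliveProb b ρ (i :: s) v = kern ρ (fun y => aliveProb b ρ s (y / b)) v := by
  have h := integral_law (b := b) ρ (measurable_one.indicator (measurableSet_alive v (i :: s)))
    (M := 1) (f := {ω : Config b | Alive ω v (i :: s)}.indicator 1) fun ω => by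
      by_cases h : ω ∈ {ω : Config b | Alive ω v (i :: s)} <;> simp [h]
  rw [integral_indicator_one (measurableSet_alive v (i :: s))] at h
  rw [aliveProb, h, kern]
  congr 1
  ext x
  split_ifs with h1
  · have : ∀ w : Fin b → Config b, {ω : Config b | Alive ω v (i :: s)}.indicator (1 : Config b → ℝ)
        (graft (x, w)) = {ω : Config b | Alive ω ((x + v) / b) s}.indicator 1 (w i) := by
      intro w
      have e : graft (x, w) ∈ {ω : Config b | Alive ω v (i :: s)}
          ↔ w i ∈ {ω : Config b | Alive ω ((x + v) / b) s} := and_iff_right h1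
      by_cases hw : w i ∈ {ω : Config b | Alive ω ((x + v) / b) s}
      · rw [Set.indicator_of_mem hw, Set.indicator_of_mem (e.2 hw)]; rfl
      · rw [Set.indicator_of_notMem hw, Set.indicator_of_notMem fun h => hw (e.1 h)]
    simp only [this]
    rw [aliveProb, ← integral_indicator_one (measurableSet_alive _ s)]
    have hmp := measurePreserving_eval (fun _ : Fin b => law b ρ) i
    have e := integral_map hmp.measurable.aemeasurable
      (μ := Measure.pi fun _ : Fin b => law b ρ) (f := Set.indicator
      {ω : Config b | Alive ω ((x + v) / b) s} (1 : Config b → ℝ))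
      (measurable_one.indicator (measurableSet_alive _ s)).aestronglyMeasurable
    rw [hmp.map_eq] at e
    exact e.symm
  · have : ∀ w : Fin b → Config b, {ω : Config b | Alive ω v (i :: s)}.indicator (1 : Config b → ℝ)
        (graft (x, w)) = 0 := by
      intro w
      exact Set.indicator_of_notMem (fun h => h1 h.1) _
    simp [this]

end Branching


/-! ### Survival equation and exponential rate in terms of the kernel -/

noncomputable section Analytic

variable {b : ℕ} {ρ : ProbabilityMeasure I} {K : ℝ} (hK : 1 ≤ K)

lemma childFunctional_eq_kern {v : ℝ} (hv : v + 1 ≤ K) {f : C(Set.Icc 1 K, ℝ)} {F : ℝ → ℝ}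
    (h : ∀ θ : Set.Icc 1 K, f θ = F θ) : childFunctional hK ρ v f = kern ρ F v := by
  rw [childFunctional_apply, kern, kern]
  congr 1
  ext x
  split_ifs with h1
  · have hx : (x : ℝ) + v ∈ Set.Icc 1 K := ⟨h1, by linarith [x.2.2]⟩
    rw [Set.IccExtend_of_mem hK _ hx, h]
  · rfl

/-- Ensures that `[1, K]` is invariant: a child of a site with energy at most `K` again has energy
at most `K`, so the constant extension beyond `K` is never seen. -/
lemma div_add_one_le (hb : 1 < b) (hK3 : 3 ≤ K) {y : ℝ} (hy0 : 0 ≤ y) (hy : y ≤ K) :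
    y / b + 1 ≤ K := by
  have h2 : (2 : ℝ) ≤ b := by exact_mod_cast hb
  have : y / b ≤ y / 2 := by gcongr
  linarith

variable (hac : (ρ : Measure I) ≪ volume)

lemma aliveProb_eq (hb : 1 < b) (hK3 : 3 ≤ K) (s : Site b) {v : ℝ} (hv : v + 1 ≤ K) :
    aliveProb b ρ s v = childFunctional hK ρ v ((childOp hK b hac ^ s.length) 1) := by
  induction s generalizing v with
  | nil => rw [aliveProb_nil, childFunctional_eq_kern hK hv (F := fun _ => 1) fun θ => rfl]
  | cons i s ih =>
    rw [aliveProb_cons]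
    refine (childFunctional_eq_kern hK hv fun θ => ?_).symm
    rw [List.length_cons, pow_succ', ih (div_add_one_le hb hK3 (by linarith [θ.2.1]) θ.2.2)]
    rfl

/-- The probability that the subtree of a site of energy `θ` is infinite or contains a marked site,
if each avalanching site is marked independently with probability `1 - s`. -/
def survival (b : ℕ) (s : I) : C(Set.Icc 1 K, ℝ) :=
  ⟨fun θ => 1 - (s : ℝ) * genFun b ρ s (θ / b) ^ b, by
    have h : Continuous (genFun b ρ s) := by
      have e : genFun b ρ s = fun v => 1 - kern ρ (fun y => 1 - s * genFun b ρ s (y / b) ^ b) v := by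
        ext v
        rw [← one_sub_genFun s.2.1 s.2.2, sub_sub_cancel]
      rw [e]
      refine continuous_const.sub (continuous_kern hac (M := 1) ?_ fun y _ => ?_)
      · exact measurable_const.sub ((((genFun_antitone s.2.1 s.2.2).measurable.comp
          (measurable_id.div_const _)).pow_const _).const_mul _)
      · have h0 := genFun_nonneg (b := b) (ρ := ρ) s.2.1 (y / b)
        have h1 := genFun_le_one (b := b) (ρ := ρ) s.2.1 s.2.2 (y / b)
        have h2 := mul_le_one₀ s.2.2 (pow_nonneg h0 b) (pow_le_one₀ h0 h1 (n := b))
        have h3 := mul_nonneg s.2.1 (pow_nonneg h0 b)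
        rw [abs_of_nonneg (by linarith)]
        linarith
    exact continuous_const.sub (((h.comp (by fun_prop)).pow b).const_mul _)⟩

lemma survival_apply (s : I) (θ : Set.Icc 1 K) :
    survival hac b s θ = 1 - (s : ℝ) * genFun b ρ s (θ / b) ^ b := rfl

lemma childFunctional_survival (s : I) {v : ℝ} (hv : v + 1 ≤ K) :
    childFunctional hK ρ v (survival hac b s) = 1 - genFun b ρ s v := by
  rw [one_sub_genFun s.2.1 s.2.2]
  exact childFunctional_eq_kern hK hv fun θ => rfl

lemma childOp_survival_apply (hb : 1 < b) (hK3 : 3 ≤ K) (s : I) (θ : Set.Icc 1 K) :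
    childOp hK b hac (survival hac b s) θ = 1 - genFun b ρ s (θ / b) :=
  childFunctional_survival hK hac s (div_add_one_le hb hK3 (by linarith [θ.2.1]) θ.2.2)

lemma one_sub_le_survival (s : I) (θ : Set.Icc 1 K) : 1 - (s : ℝ) ≤ survival hac b s θ := by
  have h0 := genFun_nonneg (b := b) (ρ := ρ) s.2.1 (θ / b)
  have h1 := genFun_le_one (b := b) (ρ := ρ) s.2.1 s.2.2 (θ / b)
  have := mul_le_of_le_one_right s.2.1 (pow_le_one₀ h0 h1 (n := b))
  rw [survival_apply]
  linarith

lemma survival_nonneg (s : I) : 0 ≤ survival (K := K) hac b s :=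
  ContinuousMap.le_def.2 fun θ => (sub_nonneg.2 s.2.2).trans (one_sub_le_survival hac s θ)

lemma survival_le_one (s : I) : survival (K := K) hac b s ≤ 1 :=
  ContinuousMap.le_def.2 fun _ => sub_le_self _
    (mul_nonneg s.2.1 (pow_nonneg (genFun_nonneg s.2.1 _) b))

lemma childOp_survival_le_one (hb : 1 < b) (hK3 : 3 ≤ K) (s : I) :
    childOp hK b hac (survival hac b s) ≤ 1 :=
  ContinuousMap.le_def.2 fun θ => by
    rw [childOp_survival_apply hK hac hb hK3]
    exact sub_le_self _ (genFun_nonneg s.2.1 _)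

/-- The branching recursion `u = 1 - s (1 - A u)^b`, expanded to second order with `ε = 1 - s`, in
the form required by `tendsto_nonlinear`. -/
lemma survival_eq (hb : 1 < b) (hK3 : 3 ≤ K) (s : I) :
    survival hac b s = (1 - (s : ℝ)) • (1 : C(Set.Icc 1 K, ℝ)) + (1 - (1 - (s : ℝ))) •
      ((b : ℝ) • childOp hK b hac (survival hac b s)
        - (childOp hK b hac (survival hac b s)) ^ 2
          * remPoly b (childOp hK b hac (survival hac b s))) := by
  ext θ
  have h1 := childOp_survival_apply hK hac hb hK3 s θ
  set w := childOp hK b hac (survival hac b s)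
  have h2 : genFun b ρ s (θ / b) = 1 - w θ := by rw [h1]; ring
  have h3 := one_sub_pow_eq b (w θ)
  rw [survival_apply, h2, h3]
  simp only [ContinuousMap.add_apply, ContinuousMap.smul_apply, ContinuousMap.sub_apply,
    ContinuousMap.mul_apply, ContinuousMap.pow_apply, ContinuousMap.one_apply, remPoly_apply,
    smul_eq_mul]
  ring

/-! ### The exponential rate -/

section Rate

variable {S : Type*} [TopologicalSpace S] [CompactSpace S] [Nonempty S]
  {A : C(S, ℝ) →L[ℝ] C(S, ℝ)}

lemma PerronData.pow_h (D : PerronData A) (n : ℕ) : (A ^ n) D.h = D.r ^ n • D.h := by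
  induction n with
  | zero => simp
  | succ n ih =>
    have : (A ^ (n + 1)) D.h = A ((A ^ n) D.h) := by rw [pow_succ']; rfl
    rw [this, ih, map_smul, D.A_h, smul_smul, pow_succ]

/-- The constant `1` lies between multiples of `h`, as `c ≤ h ≤ ‖h‖`, and `Aⁿ h = rⁿ h`. -/
lemma PerronData.exists_pow_one_bounds (D : PerronData A) (hA : ∀ f, 0 ≤ f → 0 ≤ A f) :
    ∃ C > 0, ∀ n θ, C⁻¹ * D.r ^ n ≤ (A ^ n) 1 θ ∧ (A ^ n) 1 θ ≤ C * D.r ^ n := by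
  have hn : ∀ n f, 0 ≤ f → 0 ≤ (A ^ n) f := fun n f hf => pow_pos_of_pos hA n f hf
  have hh : D.c ≤ ‖D.h‖ := (D.h_ge (Classical.arbitrary S)).trans
    ((le_abs_self _).trans (D.h.norm_coe_le_norm _))
  have hc := D.c_pos
  have hh0 : 0 < ‖D.h‖ := hc.trans_le hh
  refine ⟨‖D.h‖ / D.c, by positivity, fun n θ => ⟨?_, ?_⟩⟩
  · have h1 : D.h ≤ ‖D.h‖ • (1 : C(S, ℝ)) := ContinuousMap.le_def.2 fun θ => by
      simpa using (le_abs_self _).trans (D.h.norm_coe_le_norm θ)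
    have h2 : (A ^ n) D.h θ ≤ (A ^ n) (‖D.h‖ • (1 : C(S, ℝ))) θ :=
      map_mono_of_pos (A ^ n) (hn n) h1 θ
    rw [map_smul, D.pow_h] at h2
    simp only [ContinuousMap.smul_apply, smul_eq_mul] at h2
    have h3 := mul_le_mul_of_nonneg_left (D.h_ge θ) (pow_nonneg D.r_pos.le n)
    rw [inv_div, div_mul_eq_mul_div, div_le_iff₀ hh0]
    linarith
  · have h1 : D.c • (1 : C(S, ℝ)) ≤ D.h := ContinuousMap.le_def.2 fun θ => by
      simpa using D.h_ge θ
    have h2 : (A ^ n) (D.c • (1 : C(S, ℝ))) θ ≤ (A ^ n) D.h θ :=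
      map_mono_of_pos (A ^ n) (hn n) h1 θ
    rw [map_smul, D.pow_h] at h2
    simp only [ContinuousMap.smul_apply, smul_eq_mul] at h2
    have h3 := mul_le_mul_of_nonneg_left ((le_abs_self _).trans (D.h.norm_coe_le_norm θ))
      (pow_nonneg D.r_pos.le n)
    rw [div_mul_eq_mul_div, le_div_iff₀ hc]
    linarith

/-- Above criticality, solutions of `u = ε + (1 - ε) (1 - (1 - A u) ^ n)` with `ε > 0` do not get
small. -/
lemma PerronData.exists_lt_of_supercritical (D : PerronData A) {n : ℕ} (hn : 1 < n * D.r) :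
    ∃ η > (0 : ℝ), ∃ ε₀ > (0 : ℝ), ∀ ε : ℝ, 0 < ε → ε < ε₀ → ∀ u : C(S, ℝ), 0 ≤ u → 0 ≤ A u →
      u = ε • (1 : C(S, ℝ)) + (1 - ε) • ((n : ℝ) • A u - (A u) ^ 2 * remPoly n (A u)) →
      ∃ θ, η < A u θ := by
  have hc : Continuous fun x : ℝ => x * remPoly n x :=
    continuous_id.mul (continuous_remPoly n)
  have h1 : ∀ᶠ p : ℝ × ℝ in 𝓝 (0, 0), 1 < (1 - p.2) * (n - p.1 * remPoly n p.1) * D.r := by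
    have h2 : Continuous fun p : ℝ × ℝ => (1 - p.2) * (n - p.1 * remPoly n p.1) * D.r :=
      ((continuous_const.sub continuous_snd).mul
        (continuous_const.sub (hc.comp continuous_fst))).mul continuous_const
    refine (h2.tendsto (0, 0)).eventually (lt_mem_nhds ?_)
    simpa using hn
  obtain ⟨δ, hδ, h2⟩ := Metric.eventually_nhds_iff.1 h1
  refine ⟨δ / 2, by positivity, δ, hδ, fun ε hε hε1 u hu hAu heq => ?_⟩
  by_contra! hle
  have h3 : ∀ θ, D.r⁻¹ * A u θ ≤ (1 - ε) * (n * A u θ - (A u θ) ^ 2 * remPoly n (A u θ)) := by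
    intro θ
    have h3 : 0 ≤ A u θ := hAu θ
    have h4 := h2 (y := (A u θ, ε)) (by
      rw [Prod.dist_eq, max_lt_iff, Real.dist_eq, Real.dist_eq, sub_zero, sub_zero,
        abs_of_nonneg h3, abs_of_pos hε]
      exact ⟨(hle θ).trans_lt (by linarith), hε1⟩)
    have h5 : D.r⁻¹ ≤ (1 - ε) * (n - A u θ * remPoly n (A u θ)) := by
      rw [inv_le_iff_one_le_mul₀ D.r_pos]
      exact h4.le
    calc D.r⁻¹ * A u θ ≤ (1 - ε) * (n - A u θ * remPoly n (A u θ)) * A u θ := by gcongr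
      _ = _ := by ring
  -- If `A u` were small everywhere, the supercritical slope would beat the quadratic correction.
  -- Pairing this inequality with `l` gives `ε + l u ≤ l u`, a contradiction.
  have h6 : ε • (1 : C(S, ℝ)) + D.r⁻¹ • A u ≤ u := by
    refine ContinuousMap.le_def.2 fun θ => ?_
    have h4 := DFunLike.congr_fun heq θ
    simp only [ContinuousMap.add_apply, ContinuousMap.smul_apply, ContinuousMap.sub_apply,
      ContinuousMap.mul_apply, ContinuousMap.pow_apply, ContinuousMap.one_apply, remPoly_apply,
      smul_eq_mul] at h4 ⊢
    linarith [h3 θ]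
  have h7 := D.l_mono h6
  rw [map_add, map_smul, map_smul, D.l_one, D.l_A, smul_eq_mul, smul_eq_mul,
    inv_mul_cancel_left₀ D.r_pos.ne'] at h7
  linarith

end Rate

/-- The i.i.d. sequence is realized as the energies along one constant branch. The condition at time
zero holds trivially for `θ = 1`, so `n + 1` steps correspond to the site in layer `n`. -/
lemma Z_succ_eq (hb : 1 < b) (hK3 : 3 ≤ K) (n : ℕ) :
    Z b ρ (n + 1) 1 = (childOp hK b hac ^ (n + 1)) 1 ⟨1, le_rfl, hK⟩ := by
  set j : Fin b := ⟨0, by omega⟩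
  have hinj : Function.Injective fun m : ℕ => List.replicate m j := fun m m' h => by
    simpa using congrArg List.length h
  have hmap : (law b ρ).map (fun ω m => ω (List.replicate m j))
      = Measure.infinitePi fun _ : ℕ => (ρ : Measure I) :=
    Measure.map_infinitePi_infinitePi_of_inj (P := fun _ : Site b => (ρ : Measure I)) hinj
  have hm : Measurable fun (ω : Config b) (m : ℕ) => ω (List.replicate m j) :=
    measurable_pi_iff.2 fun m => measurable_pi_apply _
  have h1 : Z b ρ (n + 1) 1 = aliveProb b ρ (List.replicate n j) (1 / b) := by
    rw [Z, aliveProb, ← hmap, map_measureReal_apply hm (measurableSet_surv b 1 (n + 1))]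
    congr 1
    ext ω
    simp only [Set.mem_preimage, Set.mem_ofPred_eq]
    rw [alive_replicate]
    constructor
    · exact fun h k hk => h (k + 1) (by omega)
    · intro h k hk
      cases k with
      | zero => simp [Q]
      | succ k => exact h k (by omega)
  rw [h1, aliveProb_eq hK hac hb hK3 _ (div_add_one_le hb hK3 zero_le_one hK), List.length_replicate,
    pow_succ']
  rfl

/-- `Zₙ` is of exact order `rⁿ`, and constants disappear under the `n`-th root. In particular `r`
does not depend on `K`. -/
lemma frakZ_eq (hb : 1 < b) (hK3 : 3 ≤ K) (D : PerronData (childOp hK b hac)) :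
    frakZ b ρ = D.r := by
  have : Nonempty (Set.Icc 1 K) := ⟨⟨1, le_rfl, hK⟩⟩
  obtain ⟨C, hC, h⟩ := D.exists_pow_one_bounds (childOp_nonneg hK b hac)
  refine tendsto_nhds_unique (tendsto_frakZ b ρ) ?_
  have hlim : ∀ C : ℝ, 0 < C → Tendsto (fun n : ℕ => (C * D.r ^ n) ^ (1 / (n : ℝ))) atTop (𝓝 D.r) := by
    intro C hC
    have h1 : Tendsto (fun n : ℕ => C ^ (1 / (n : ℝ)) * D.r) atTop (𝓝 (C ^ (0 : ℝ) * D.r)) :=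
      (((Real.continuous_const_rpow hC.ne').tendsto 0).comp
        tendsto_one_div_atTop_nhds_zero_nat).mul_const _
    rw [Real.rpow_zero, one_mul] at h1
    refine h1.congr' ?_
    filter_upwards [eventually_ne_atTop 0] with n hn
    rw [Real.mul_rpow hC.le (pow_nonneg D.r_pos.le n), one_div, Real.pow_rpow_inv_natCast D.r_pos.le hn]
  have hr := D.r_pos
  refine tendsto_of_tendsto_of_tendsto_of_le_of_le' (hlim C⁻¹ (inv_pos.2 hC)) (hlim C hC) ?_ ?_
  all_goals
    filter_upwards [eventually_ge_atTop 1] with n hn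
    obtain ⟨m, rfl⟩ := Nat.exists_eq_add_of_le' hn
    rw [Z_succ_eq hK hac hb hK3]
    have h1 := h (m + 1) ⟨1, le_rfl, hK⟩
    have h2 : 0 ≤ C⁻¹ * D.r ^ (m + 1) := by positivity
  · exact Real.rpow_le_rpow h2 h1.1 (by positivity)
  · exact Real.rpow_le_rpow (h2.trans h1.1) h1.2 (by positivity)

end Analytic


/-! ### Size, tail and infinite avalanches through operators; mixtures -/

noncomputable section Observables

variable {b : ℕ} {ρ : ProbabilityMeasure I}

lemma expectedSize_eq_tsum (hac : (ρ : Measure I) ≪ volume) {v : ℝ} (hv : 0 ≤ v) :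
    expectedSize b ρ v = ∑' s : Site b, ENNReal.ofReal (aliveProb b ρ s v) := by
  have h1 : expectedSize b ρ v
      = ∫⁻ ω, ∑' s, {ω : Config b | Alive ω v s}.indicator 1 ω ∂(law b ρ) := by
    refine lintegral_congr_ae ?_
    filter_upwards [ae_encard_avalanche hac hv] with ω hω
    rw [hω, aliveCount_eq_tsum]
  rw [h1, lintegral_tsum fun s => (measurable_one.indicator (measurableSet_alive v s)).aemeasurable]
  refine tsum_congr fun s => ?_
  rw [lintegral_indicator_one (measurableSet_alive v s), aliveProb, ofReal_measureReal]

lemma tsum_site (f : ℕ → ℝ≥0∞) : ∑' s : Site b, f s.length = ∑' n, (b : ℝ≥0∞) ^ n * f n := by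
  rw [← (Equiv.sigmaFiberEquiv (List.length (α := Fin b))).tsum_eq, ENNReal.tsum_sigma']
  refine tsum_congr fun n => ?_
  have h1 : ∀ s : {s : List (Fin b) // s.length = n},
      f ((Equiv.sigmaFiberEquiv (List.length (α := Fin b))) ⟨n, s⟩).length = f n := by
    rintro ⟨s, hs⟩
    exact congrArg f hs
  simp only [h1]
  have : Fintype {s : List (Fin b) // s.length = n} := inferInstanceAs (Fintype (List.Vector (Fin b) n))
  rw [tsum_fintype, Finset.sum_const, nsmul_eq_mul]
  congr 1
  have h2 := card_vector (α := Fin b) n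
  rw [Fintype.card_fin] at h2
  rw [Finset.card_univ]
  have h3 : Fintype.card {s : List (Fin b) // s.length = n} = b ^ n := by
    rw [← h2]
    exact Fintype.card_congr (Equiv.refl _)
  rw [h3]
  push_cast
  rfl

/-- In the subcritical phase, the expected size of the avalanche is given by the resolvent. -/
lemma exists_resolvent {K : ℝ} (hK : 1 ≤ K) (hac : (ρ : Measure I) ≪ volume) (hb : 1 < b)
    (hK3 : 3 ≤ K) (D : PerronData (childOp hK b hac)) (hr : b * D.r < 1) :
    ∃ U : C(Set.Icc 1 K, ℝ), U = 1 + (b : ℝ) • childOp hK b hac U ∧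
      ∀ v, 0 ≤ v → v + 1 ≤ K →
        expectedSize b ρ v = ENNReal.ofReal (childFunctional hK ρ v U) := by
  have : Nonempty (Set.Icc 1 K) := ⟨⟨1, le_rfl, hK⟩⟩
  obtain ⟨C, hC, h⟩ := D.exists_pow_one_bounds (childOp_nonneg hK b hac)
  have hr0 := D.r_pos
  have h0 : ∀ n θ, 0 ≤ (childOp hK b hac ^ n) 1 θ := fun n θ => le_trans (by positivity) (h n θ).1
  -- The resolvent is the Neumann series: layer `n` has `bⁿ` sites, each alive with a probability
  -- expressed by `Aⁿ 1`, and the series converges since `b r < 1`.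
  have hsum : Summable fun n : ℕ => (b : ℝ) ^ n • (childOp hK b hac ^ n) (1 : C(Set.Icc 1 K, ℝ)) := by
    refine Summable.of_norm_bounded (g := fun n => C * (b * D.r) ^ n)
      ((summable_geometric_of_lt_one (by positivity) hr).mul_left C) fun n => ?_
    rw [norm_smul, norm_pow, Real.norm_of_nonneg (Nat.cast_nonneg b)]
    have h1 : ‖(childOp hK b hac ^ n) (1 : C(Set.Icc 1 K, ℝ))‖ ≤ C * D.r ^ n := by
      refine (ContinuousMap.norm_le _ (by positivity)).2 fun θ => ?_
      rw [Real.norm_of_nonneg (h0 n θ)]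
      exact (h n θ).2
    calc (b : ℝ) ^ n * ‖(childOp hK b hac ^ n) (1 : C(Set.Icc 1 K, ℝ))‖ ≤ (b : ℝ) ^ n * (C * D.r ^ n) := by gcongr
      _ = C * (b * D.r) ^ n := by rw [mul_pow]; ring
  refine ⟨∑' n : ℕ, (b : ℝ) ^ n • (childOp hK b hac ^ n) (1 : C(Set.Icc 1 K, ℝ)), ?_, fun v hv0 hv => ?_⟩
  · conv_lhs => rw [hsum.tsum_eq_zero_add]
    rw [(childOp hK b hac).map_tsum hsum, ← hsum.mapL (childOp hK b hac) |>.tsum_const_smul (b : ℝ)]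
    congr 1
    · simp
    · refine tsum_congr fun n => ?_
      rw [map_smul, smul_smul, pow_succ' (b : ℝ), pow_succ' (childOp hK b hac)]
      rfl
  · rw [expectedSize_eq_tsum hac hv0]
    have h1 : ∀ s : Site b, ENNReal.ofReal (aliveProb b ρ s v)
        = (fun n => ENNReal.ofReal (childFunctional hK ρ v ((childOp hK b hac ^ n) 1))) s.length := fun s => by
      rw [aliveProb_eq hK hac hb hK3 s hv]
    simp only [h1]
    rw [tsum_site fun n => ENNReal.ofReal (childFunctional hK ρ v ((childOp hK b hac ^ n) 1)),
      (childFunctional hK ρ v).map_tsum hsum, ENNReal.ofReal_tsum_of_nonneg]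
    · refine tsum_congr fun n => ?_
      rw [map_smul, smul_eq_mul, ENNReal.ofReal_mul (by positivity), ENNReal.ofReal_pow (by positivity),
        ENNReal.ofReal_natCast]
    · intro n
      rw [map_smul, smul_eq_mul]
      exact mul_nonneg (by positivity) (childFunctional_nonneg hK ρ v fun θ => h0 n θ)
    · exact hsum.mapL (childFunctional hK ρ v)

lemma measurableSet_le_aliveCount (v : ℝ) (n : ℕ∞) :
    MeasurableSet {ω : Config b | n ≤ aliveCount ω v} :=
  measurable_aliveCount v (MeasurableSet.of_discrete (s := Set.Ici n))

lemma probSizeGE_eq (hac : (ρ : Measure I) ≪ volume) {v : ℝ} (hv : 0 ≤ v) (n : ℕ) :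
    probSizeGE b ρ v n = (law b ρ).real {ω | (n : ℕ∞) ≤ aliveCount ω v} := by
  refine measureReal_congr ?_
  filter_upwards [ae_encard_avalanche hac hv] with ω hω
  exact congrArg (fun N : ℕ∞ => (n : ℕ∞) ≤ N) hω

/-- With the convention at infinity, `killedPow 1` is the indicator of finiteness. -/
lemma probInfinite_eq (hac : (ρ : Measure I) ≪ volume) {v : ℝ} (hv : 0 ≤ v) :
    probInfinite b ρ v = 1 - genFun b ρ 1 v := by
  have hm : MeasurableSet {ω : Config b | ⊤ ≤ aliveCount ω v} := measurableSet_le_aliveCount v ⊤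
  have h1 : probInfinite b ρ v = (law b ρ).real {ω | ⊤ ≤ aliveCount ω v} := by
    refine measureReal_congr ?_
    filter_upwards [ae_encard_avalanche hac hv] with ω hω
    refine propext ?_
    change (avalanche b ω v).Infinite ↔ ⊤ ≤ aliveCount ω v
    rw [← hω, top_le_iff, Set.encard_eq_top_iff]
  have h2 : ∀ ω : Config b, killedPow 1 (aliveCount ω v)
      = 1 - {ω : Config b | ⊤ ≤ aliveCount ω v}.indicator 1 ω := by
    intro ω
    by_cases h : ⊤ ≤ aliveCount ω v
    · rw [Set.indicator_of_mem (show ω ∈ {ω : Config b | ⊤ ≤ aliveCount ω v} from h), top_le_iff.1 h,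
        killedPow_top]
      simp
    · rw [Set.indicator_of_notMem (show ω ∉ {ω : Config b | ⊤ ≤ aliveCount ω v} from h), killedPow,
        if_neg fun h' => h h'.ge]
      simp
  rw [h1, genFun]
  simp only [h2]
  have hi : Integrable (Set.indicator {ω : Config b | ⊤ ≤ aliveCount ω v} (1 : Config b → ℝ))
      (law b ρ) := (integrable_const (1 : ℝ)).indicator hm
  rw [integral_sub (integrable_const _) hi]
  have h3 := integral_indicator_one (μ := law b ρ) hm
  rw [h3]
  simp

lemma antitone_probSizeGE (v : ℝ) : Antitone (probSizeGE b ρ v) := fun m n h =>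
  measureReal_mono fun ω (hω : (n : ℕ∞) ≤ _) =>
    (show (m : ℕ∞) ≤ _ from le_trans (by exact_mod_cast h) hω)

lemma one_sub_killedPow {s : ℝ} (hs : 0 ≤ s) (hs1 : s < 1) (N : ℕ∞) :
    HasSum (fun n : ℕ => (1 - s) * ((if ((n + 1 : ℕ) : ℕ∞) ≤ N then 1 else 0) * s ^ n))
      (1 - killedPow s N) := by
  induction N using ENat.recTopCoe with
  | top =>
    simp only [le_top, if_true, one_mul, killedPow_top, sub_zero]
    have := (hasSum_geometric_of_lt_one hs hs1).mul_left (1 - s)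
    rwa [mul_inv_cancel₀ (by linarith)] at this
  | coe N =>
    rw [killedPow_natCast]
    have h1 : 1 - s ^ N = ∑ n ∈ Finset.range N,
        (1 - s) * ((if ((n + 1 : ℕ) : ℕ∞) ≤ (N : ℕ∞) then 1 else 0) * s ^ n) := by
      rw [← mul_neg_geom_sum, Finset.mul_sum]
      refine Finset.sum_congr rfl fun n hn => ?_
      rw [if_pos (by exact_mod_cast Finset.mem_range.1 hn), one_mul]
    rw [h1]
    refine hasSum_sum_of_ne_finset_zero fun n hn => ?_
    rw [if_neg, zero_mul, mul_zero]
    intro h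
    exact hn (Finset.mem_range.2 (by exact_mod_cast h))

/-- Summation by layers of the size, using `1 - s^N = (1 - s) ∑ sⁿ` over `n < N`. It expresses `1 -
genFun` by the generating function of the tail probabilities, the input of the Tauberian theorem. -/
lemma one_sub_genFun_eq_tsum (hac : (ρ : Measure I) ≪ volume) {v : ℝ} (hv : 0 ≤ v) {s : ℝ}
    (hs : 0 ≤ s) (hs1 : s < 1) :
    1 - genFun b ρ s v = (1 - s) * ∑' n : ℕ, probSizeGE b ρ v (n + 1) * s ^ n := by
  set G : ℕ → Config b → ℝ := fun n ω =>
    (1 - s) * ((if ((n + 1 : ℕ) : ℕ∞) ≤ aliveCount ω v then 1 else 0) * s ^ n)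
  have hs1' : 0 ≤ 1 - s := by linarith
  have hG0 : ∀ n ω, 0 ≤ G n ω := fun n ω => by
    simp only [G]
    split_ifs <;> positivity
  have hG1 : ∀ n ω, G n ω ≤ (1 - s) * s ^ n := fun n ω => by
    simp only [G]
    have := mul_nonneg hs1' (pow_nonneg hs n)
    split_ifs <;> simp [this]
  have hGm : ∀ n, Measurable (G n) := fun n =>
    ((Measurable.ite (measurableSet_le_aliveCount v _) measurable_const
      measurable_const).mul_const _).const_mul _
  have hGi : ∀ n, Integrable (G n) (law b ρ) := fun n =>
    Integrable.of_bound (hGm n).aestronglyMeasurable ((1 - s) * s ^ n)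
      (Eventually.of_forall fun ω => by rw [Real.norm_of_nonneg (hG0 n ω)]; exact hG1 n ω)
  have hint : ∀ n, ∫ ω, G n ω ∂(law b ρ) = (1 - s) * (probSizeGE b ρ v (n + 1) * s ^ n) := by
    intro n
    simp only [G]
    rw [integral_const_mul, integral_mul_const, probSizeGE_eq hac hv]
    congr 2
    rw [← integral_indicator_one (measurableSet_le_aliveCount v _)]
    refine integral_congr_ae (Eventually.of_forall fun ω => ?_)
    classical
    simp only [Set.indicator_apply, Set.mem_ofPred_eq, Pi.one_apply]
  have hsum : Summable fun n => ∫ ω, ‖G n ω‖ ∂(law b ρ) := by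
    simp only [Real.norm_of_nonneg (hG0 _ _), hint]
    refine Summable.of_nonneg_of_le (fun n => mul_nonneg hs1'
      (mul_nonneg measureReal_nonneg (pow_nonneg hs n))) (fun n => ?_)
      ((summable_geometric_of_lt_one hs hs1).mul_left (1 - s))
    refine mul_le_mul_of_nonneg_left ?_ hs1'
    exact mul_le_of_le_one_left (pow_nonneg hs n) measureReal_le_one
  have h1 := hasSum_integral_of_summable_integral_norm hGi hsum
  have h2 : ∀ ω, ∑' n, G n ω = 1 - killedPow s (aliveCount ω v) := fun ω =>
    (one_sub_killedPow hs hs1 _).tsum_eq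
  simp only [h2, hint] at h1
  rw [integral_sub (integrable_const _) (integrable_killedPow hs hs1.le v), integral_const,
    probReal_univ, one_smul] at h1
  rw [← tsum_mul_left, h1.tsum_eq]
  rfl

lemma tendsto_genFun (v : ℝ) : Tendsto (fun s => genFun b ρ s v) (𝓝[<] 1) (𝓝 (genFun b ρ 1 v)) := by
  have hs : ∀ᶠ s : ℝ in 𝓝[<] 1, 0 ≤ s ∧ s ≤ 1 := by
    filter_upwards [Ioo_mem_nhdsLT (zero_lt_one (α := ℝ))] with s hs
    exact ⟨hs.1.le, hs.2.le⟩
  refine tendsto_integral_filter_of_dominated_convergence (fun _ => 1) ?_ ?_ (integrable_const _) ?_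
  · exact Eventually.of_forall fun s => (measurable_killedPow_aliveCount s v).aestronglyMeasurable
  · filter_upwards [hs] with s hs
    exact Eventually.of_forall fun ω => abs_killedPow_le hs.1 hs.2 _
  · refine Eventually.of_forall fun ω => ?_
    by_cases h : aliveCount ω v = ⊤
    · simp [killedPow, h]
    · simp only [killedPow, if_neg h]
      exact ((continuous_pow _).tendsto _).mono_left nhdsWithin_le_nhds

/-- Without killing, zero also solves the survival equation, so the equation alone does not exclude
extinction. The solutions with killing stay bounded away from zero, and the bound persists as `s ↑
1`. -/
lemma survival_one_ne_zero {K : ℝ} (hK : 1 ≤ K) (hac : (ρ : Measure I) ≪ volume) (hb : 1 < b)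
    (hK3 : 3 ≤ K) (D : PerronData (childOp hK b hac)) (hr : 1 < b * D.r) :
    survival (K := K) hac b 1 ≠ 0 := by
  have : Nonempty (Set.Icc 1 K) := ⟨⟨1, le_rfl, hK⟩⟩
  obtain ⟨η, hη, ε₀, hε₀, h⟩ := D.exists_lt_of_supercritical hr
  have hev : ∀ᶠ s : ℝ in 𝓝[<] 1, η ≤ 1 - genFun b ρ s (K / b) := by
    filter_upwards [Ioo_mem_nhdsLT (zero_lt_one (α := ℝ)),
      Ioo_mem_nhdsLT (show 1 - ε₀ < (1 : ℝ) by linarith)] with s hs hs'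
    set t : I := ⟨s, hs.1.le, hs.2.le⟩
    obtain ⟨θ, hθ⟩ := h (1 - s) (by linarith [hs.2]) (by linarith [hs'.1]) (survival hac b t)
      (survival_nonneg hac t) (childOp_nonneg hK b hac _ (survival_nonneg hac t))
      (survival_eq hK hac hb hK3 t)
    rw [childOp_survival_apply hK hac hb hK3] at hθ
    -- The point `θ` depends on `s`; monotonicity in the energy replaces it by `K`.
    refine hθ.le.trans (sub_le_sub_left (genFun_antitone hs.1.le hs.2.le ?_) _)
    have := θ.2.2
    gcongr
  have hlim : η ≤ 1 - genFun b ρ 1 (K / b) :=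
    ge_of_tendsto ((tendsto_genFun (K / b)).const_sub 1) hev
  intro h0
  have h1 := childOp_survival_apply hK hac hb hK3 1 ⟨K, hK, le_rfl⟩
  rw [h0, map_zero] at h1
  simp only [ContinuousMap.zero_apply, Set.Icc.coe_one] at h1
  linarith

/-- For `v > 1 - x⋆` the root reaches one with positive probability, and `h` is bounded below. -/
lemma childFunctional_h_pos {K : ℝ} (hK : 1 ≤ K) (hac : (ρ : Measure I) ≪ volume)
    (D : PerronData (childOp hK b hac)) {v : ℝ} (hv : 1 - xStar ρ < v) :
    0 < childFunctional hK ρ v D.h := by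
  have h1 := mul_le_kern ρ (F := fun _ => D.c) monotone_const (fun _ => D.c_pos.le) (M := D.c)
    (fun _ => le_rfl) (a := 1 - v) (v := v) (by simp)
  refine (mul_pos (measure_pos_of_lt_xStar (by linarith)) D.c_pos).trans_le (h1.trans ?_)
  exact kern_mono ρ measurable_const (measurable_IccExtend hK D.h) (M := |D.c| + ‖D.h‖)
    (fun y _ => le_add_of_nonneg_right (norm_nonneg _))
    (fun y _ => (abs_IccExtend_le hK D.h y).trans (le_add_of_nonneg_left (abs_nonneg _)))
    (fun y _ => D.h_ge _) v

/-- At or below the threshold the root almost surely fails to reach one; accordingly `Θ` is set to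
zero there. -/
lemma probSizeGE_eq_zero (hac : (ρ : Measure I) ≪ volume) {v : ℝ} (hv0 : 0 ≤ v)
    (hv : v ≤ 1 - xStar ρ) {n : ℕ} (hn : n ≠ 0) : probSizeGE b ρ v n = 0 := by
  have h1 : ∀ᵐ ω ∂(law b ρ), (ω [] : ℝ) < xStar ρ :=
    (measurePreserving_eval_infinitePi (fun _ : Site b => (ρ : Measure I))
      []).quasiMeasurePreserving.ae (ae_lt_xStar hac)
  rw [probSizeGE_eq hac hv0, measureReal_eq_zero_iff]
  refine measure_mono_null ?_ (ae_iff.1 h1)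
  intro ω (hω : (n : ℕ∞) ≤ aliveCount ω v) (h2 : (ω [] : ℝ) < xStar ρ)
  rw [aliveCount_of_lt (by linarith)] at hω
  simp [hn] at hω

lemma kern_mix (ρ' : ProbabilityMeasure I) (α : I) {F : ℝ → ℝ} (hF : Measurable F) {M : ℝ}
    (hM : ∀ y, 1 ≤ y → |F y| ≤ M) (v : ℝ) :
    kern (mix ρ ρ' α) F v = α * kern ρ' F v + (1 - α) * kern ρ F v := by
  have h : ((mix ρ ρ' α : ProbabilityMeasure I) : Measure I)
      = ENNReal.ofReal α • (ρ' : Measure I) + ENNReal.ofReal (1 - α) • (ρ : Measure I) := rfl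
  rw [kern, h, integral_add_measure, integral_smul_measure, integral_smul_measure,
    ENNReal.toReal_ofReal α.2.1, ENNReal.toReal_ofReal (sub_nonneg.2 α.2.2)]
  · rfl
  · exact (integrable_kern ρ' hF hM v).smul_measure ENNReal.ofReal_ne_top
  · exact (integrable_kern ρ hF hM v).smul_measure ENNReal.ofReal_ne_top

lemma abs_childFunctional_mix_sub_le {K : ℝ} (hK : 1 ≤ K) (ρ' : ProbabilityMeasure I) (α : I) (v : ℝ)
    (f : C(Set.Icc 1 K, ℝ)) :
    |childFunctional hK (mix ρ ρ' α) v f - childFunctional hK ρ v f| ≤ 2 * α * ‖f‖ := by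
  simp only [childFunctional_apply]
  rw [kern_mix ρ' α (measurable_IccExtend hK f) (fun y _ => abs_IccExtend_le hK f y)]
  have h1 := abs_childFunctional_le hK ρ v f
  have h2 := abs_childFunctional_le hK ρ' v f
  simp only [childFunctional_apply] at h1 h2
  have e : ∀ x y : ℝ, (α : ℝ) * x + (1 - α) * y - y = α * (x - y) := fun x y => by ring
  rw [e, abs_mul, abs_of_nonneg α.2.1, mul_comm 2, mul_assoc]
  refine mul_le_mul_of_nonneg_left ?_ α.2.1
  exact (abs_sub _ _).trans (by linarith)

lemma tendsto_childFunctional_mix {K : ℝ} (hK : 1 ≤ K) (ρ' : ProbabilityMeasure I) (v : ℝ) :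
    Tendsto (fun α : I => childFunctional hK (mix ρ ρ' α) v) (𝓝[>] 0)
      (𝓝 (childFunctional hK ρ v)) := by
  refine (tendsto_opNorm_sub (E := C(Set.Icc 1 K, ℝ)) (G := ℝ)).2 ?_
  have h : Tendsto (fun α : I => 2 * (α : ℝ)) (𝓝[>] 0) (𝓝 0) := by
    have : Continuous fun α : I => 2 * (α : ℝ) := by fun_prop
    simpa using (this.tendsto 0).mono_left nhdsWithin_le_nhds
  refine squeeze_zero (fun _ => norm_nonneg _) (fun α => ?_) h
  exact ContinuousLinearMap.opNorm_le_bound _ (by linarith [α.2.1])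
    (abs_childFunctional_mix_sub_le hK ρ' α v)

lemma tendsto_childOp_mix {K : ℝ} (hK : 1 ≤ K) (hac : (ρ : Measure I) ≪ volume)
    (ρ' : ProbabilityMeasure I) (hac' : ∀ α, (mix ρ ρ' α : Measure I) ≪ volume) :
    Tendsto (fun α : I => childOp hK b (hac' α)) (𝓝[>] 0) (𝓝 (childOp hK b hac)) := by
  refine (tendsto_opNorm_sub (E := C(Set.Icc 1 K, ℝ)) (G := C(Set.Icc 1 K, ℝ))).2 ?_
  have h : Tendsto (fun α : I => 2 * (α : ℝ)) (𝓝[>] 0) (𝓝 0) := by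
    have : Continuous fun α : I => 2 * (α : ℝ) := by fun_prop
    simpa using (this.tendsto 0).mono_left nhdsWithin_le_nhds
  refine squeeze_zero (fun _ => norm_nonneg _) (fun α => ?_) h
  have h2 : 0 ≤ 2 * (α : ℝ) := by linarith [α.2.1]
  refine ContinuousLinearMap.opNorm_le_bound _ h2 fun f => ?_
  exact (ContinuousMap.norm_le _ (mul_nonneg h2 (norm_nonneg _))).2 fun θ =>
    abs_childFunctional_mix_sub_le hK ρ' α _ f

lemma absolutelyContinuous_mix {ρ' : ProbabilityMeasure I} (hac : (ρ : Measure I) ≪ volume)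
    (hac' : (ρ' : Measure I) ≪ volume) (α : I) : (mix ρ ρ' α : Measure I) ≪ volume := by
  refine Measure.AbsolutelyContinuous.mk fun s _ hs => ?_
  have h : ((mix ρ ρ' α : ProbabilityMeasure I) : Measure I)
      = ENNReal.ofReal α • (ρ' : Measure I) + ENNReal.ofReal (1 - α) • (ρ : Measure I) := rfl
  rw [h]
  simp [hac hs, hac' hs]

lemma IsFlat.absolutelyContinuous (h : IsFlat b ρ) : (ρ : Measure I) ≪ volume := by
  obtain ⟨⟨φ, _, _, e⟩, _⟩ := h
  rw [e]
  exact withDensity_absolutelyContinuous _ _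

lemma IsFlat.measureReal_pos (h : IsFlat b ρ) :
    0 < (ρ : Measure I).real {x : I | 1 - 1 / (b : ℝ) ≤ x} :=
  ENNReal.toReal_pos h.2.ne' (measure_ne_top _ _)

lemma mix_measureReal_pos {ρ' : ProbabilityMeasure I} {s : Set I} (h : 0 < (ρ : Measure I).real s)
    (h' : 0 < (ρ' : Measure I).real s) (α : I) : 0 < (mix ρ ρ' α : Measure I).real s := by
  have e : (mix ρ ρ' α : Measure I).real s
      = α * (ρ' : Measure I).real s + (1 - α) * (ρ : Measure I).real s := by
    have e1 : ((mix ρ ρ' α : ProbabilityMeasure I) : Measure I)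
      = ENNReal.ofReal α • (ρ' : Measure I) + ENNReal.ofReal (1 - α) • (ρ : Measure I) := rfl
    have hfin : ∀ (c : ℝ) (μ : ProbabilityMeasure I), (ENNReal.ofReal c • (μ : Measure I)) s ≠ ∞ :=
      fun c μ => ENNReal.mul_ne_top ENNReal.ofReal_ne_top (measure_ne_top _ _)
    rw [e1, measureReal_add_apply (hfin _ _) (hfin _ _), measureReal_ennreal_smul_apply, measureReal_ennreal_smul_apply,
      ENNReal.toReal_ofReal α.2.1, ENNReal.toReal_ofReal (sub_nonneg.2 α.2.2)]
  rw [e]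
  rcases α.2.1.eq_or_lt with h0 | h0
  · rw [← h0]; simpa using h
  · exact add_pos_of_pos_of_nonneg (mul_pos h0 h') (mul_nonneg (sub_nonneg.2 α.2.2) h.le)

end Observables


/-! ### Asymptotics in the three regimes -/

noncomputable section Asymptotic

variable {b : ℕ} {ρ : ProbabilityMeasure I} {K : ℝ}

/-- The coefficient of the quadratic term of the survival equation at criticality. -/
def PerronData.curvature {S : Type*} [TopologicalSpace S] [CompactSpace S]
    {A : C(S, ℝ) →L[ℝ] C(S, ℝ)} (D : PerronData A) (n : ℕ) : ℝ :=
  remPoly n 0 * D.r ^ 2 * D.l (D.h ^ 2)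

lemma PerronData.curvature_pos {S : Type*} [TopologicalSpace S] [CompactSpace S] [Nonempty S]
    {A : C(S, ℝ) →L[ℝ] C(S, ℝ)} (D : PerronData A) {n : ℕ} (hn : 1 < n) : 0 < D.curvature n := by
  have h1 : 0 < D.l (D.h ^ 2) := by
    have := D.sq_l_le D.h
    rw [D.l_h] at this
    linarith
  have h2 : 0 < remPoly n (0 : ℝ) := zero_lt_one.trans_le (one_le_remPoly hn zero_le_one)
  have := D.r_pos
  unfold PerronData.curvature
  positivity

lemma isEquivalent_of_div {ι : Type*} {F : Filter ι} {f g : ι → ℝ} (hg : ∀ᶠ k in F, g k ≠ 0)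
    (h : Tendsto (fun k => f k / g k) F (𝓝 1)) : f ~[F] g :=
  (isEquivalent_iff_tendsto_one hg).2 h

section Mixture

variable {ρ' : ProbabilityMeasure I} (hK : 1 ≤ K) (hac : (ρ : Measure I) ≪ volume)
  (hac' : ∀ α, (mix ρ ρ' α : Measure I) ≪ volume)
  (D : PerronData (childOp hK b hac)) (D' : ∀ α, PerronData (childOp hK b (hac' α)))

lemma expectedSize_asymptotics (hb : 1 < b) (hK3 : 3 ≤ K) (hcrit : b * D.r = 1) (hsub : ∀ α : I, 0 < α → b * (D' α).r < 1)
    {v : ℝ} (hv0 : 0 ≤ v) (hvK : v + 1 ≤ K) (hv : 1 - xStar ρ < v) :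
    (∀ᶠ α in 𝓝[>] (0 : I), expectedSize b (mix ρ ρ' α) v < ∞) ∧
      Tendsto (fun α : I => (1 - b * (D' α).r) * (expectedSize b (mix ρ ρ' α) v).toReal) (𝓝[>] 0)
        (𝓝 (childFunctional hK ρ v D.h)) := by
  have : Nonempty (Set.Icc 1 K) := ⟨⟨1, le_rfl, hK⟩⟩
  have : (𝓝[>] (0 : I)).NeBot := nhdsGT_neBot_of_exists_gt ⟨1, zero_lt_one⟩
  choose! U hU hE using fun (α : I) (hα : 0 < α) =>
    exists_resolvent hK (hac' α) hb hK3 (D' α) (hsub α hα)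
  have hpos : ∀ᶠ α in 𝓝[>] (0 : I), 0 < α := self_mem_nhdsWithin
  have h1 := tendsto_resolvent D D' (tendsto_childOp_mix hK hac ρ' hac') hcrit
    (hpos.mono hU) (hpos.mono hsub)
  have h2 := tendsto_functional_apply (tendsto_childFunctional_mix (ρ := ρ) hK ρ' v) h1
  simp only [map_smul, smul_eq_mul] at h2
  refine ⟨?_, h2.congr' ?_⟩
  · filter_upwards [hpos] with α hα
    rw [hE α hα v hv0 hvK]
    exact ENNReal.ofReal_lt_top
  · filter_upwards [hpos, h2.eventually (lt_mem_nhds (childFunctional_h_pos hK hac D hv))]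
      with α hα h3
    rw [hE α hα v hv0 hvK, ENNReal.toReal_ofReal]
    exact (pos_of_mul_pos_right h3 (by linarith [hsub α hα])).le

/-- With no killing the scalar relation becomes `(b r_α - 1) / κ → curvature`. Multiplying its
inverse by the limit of `childFunctional (u / κ)` cancels `κ`. -/
lemma probInfinite_asymptotics (hb : 1 < b) (hK3 : 3 ≤ K) (hcrit : b * D.r = 1) (hsup : ∀ α : I, 0 < α → 1 < b * (D' α).r)
    {v : ℝ} (hv0 : 0 ≤ v) (hvK : v + 1 ≤ K) :
    Tendsto (fun α : I => probInfinite b (mix ρ ρ' α) v / (b * (D' α).r - 1)) (𝓝[>] 0)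
      (𝓝 (childFunctional hK ρ v D.h / D.curvature b)) := by
  have : Nonempty (Set.Icc 1 K) := ⟨⟨1, le_rfl, hK⟩⟩
  have hpos : ∀ᶠ α in 𝓝[>] (0 : I), 0 < α := self_mem_nhdsWithin
  set u : I → C(Set.Icc 1 K, ℝ) := fun α => survival (hac' α) b 1 with hu
  obtain ⟨h1, -, h3, h4⟩ := tendsto_nonlinear D D' (tendsto_childOp_mix hK hac ρ' hac')
    (childOp_nonneg hK b hac) (fun α => childOp_nonneg hK b (hac' α)) hb hcrit
    (u := u) (ε := fun _ => 1 - ((1 : I) : ℝ)) (by simp) (by simpa using tendsto_const_nhds) (by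
      filter_upwards [hpos] with α hα
      exact ⟨survival_nonneg _ 1, survival_le_one _ 1, childOp_survival_le_one hK _ hb hK3 1,
        survival_one_ne_zero hK _ hb hK3 (D' α) (hsup α hα), survival_eq hK _ hb hK3 1⟩)
  have h5 := tendsto_functional_apply (tendsto_childFunctional_mix (ρ := ρ) hK ρ' v) h3
  have h6 := h5.mul (h4.inv₀ (D.curvature_pos hb).ne')
  rw [← PerronData.curvature, ← div_eq_mul_inv] at h6
  refine h6.congr' ?_
  filter_upwards [h1, hpos] with α hα hα0
  have h7 : b * (D' α).r - 1 ≠ 0 := by linarith [hsup α hα0]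
  rw [probInfinite_eq (hac' α) hv0]
  have h8 := childFunctional_survival (b := b) hK (hac' α) 1 hvK
  rw [Set.Icc.coe_one] at h8
  rw [← h8, map_smul, smul_eq_mul]
  simp only [Set.Icc.coe_one, sub_self, sub_zero, one_mul, zero_div, zero_add, inv_div]
  field_simp
  rfl

end Mixture

/-- At criticality, the survival probability with killing at rate `1 - s` is of order
`(1 - s) ^ (1/2)`. -/
lemma one_sub_genFun_asymptotics (hK : 1 ≤ K) (hac : (ρ : Measure I) ≪ volume) (hb : 1 < b)
    (hK3 : 3 ≤ K) (D : PerronData (childOp hK b hac)) (hcrit : b * D.r = 1) {v : ℝ}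
    (hvK : v + 1 ≤ K) :
    Tendsto (fun s : ℝ => (1 - genFun b ρ s v) / √(1 - s)) (𝓝[<] 1)
      (𝓝 (childFunctional hK ρ v D.h / √(D.curvature b))) := by
  have : Nonempty (Set.Icc 1 K) := ⟨⟨1, le_rfl, hK⟩⟩
  have hI : ∀ᶠ s : ℝ in 𝓝[<] 1, s ∈ Set.Ioo (0 : ℝ) 1 := Ioo_mem_nhdsLT zero_lt_one
  set t : ℝ → I := Set.projIcc 0 1 zero_le_one with ht
  have htv : ∀ s ∈ Set.Ioo (0 : ℝ) 1, ((t s : I) : ℝ) = s := fun s hs => by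
    rw [ht, Set.projIcc_of_mem zero_le_one ⟨hs.1.le, hs.2.le⟩]
  have htend : Tendsto (fun s => 1 - ((t s : I) : ℝ)) (𝓝[<] 1) (𝓝 0) := by
    have h : Tendsto (fun s : ℝ => 1 - s) (𝓝[<] 1) (𝓝 0) := by
      have : Continuous fun s : ℝ => 1 - s := by fun_prop
      simpa using (this.tendsto 1).mono_left nhdsWithin_le_nhds
    refine h.congr' ?_
    filter_upwards [hI] with s hs
    rw [htv s hs]
  obtain ⟨h1, h2, h3, h4⟩ := tendsto_nonlinear D (fun _ : ℝ => D) (F := 𝓝[<] (1 : ℝ))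
    tendsto_const_nhds
    (childOp_nonneg hK b hac) (fun _ => childOp_nonneg hK b hac) hb hcrit
    (u := fun s => survival hac b (t s)) (ε := fun s => 1 - ((t s : I) : ℝ))
    (Eventually.of_forall fun s => sub_nonneg.2 (t s).2.2) htend (by
      filter_upwards [hI] with s hs
      refine ⟨survival_nonneg _ _, survival_le_one _ _, childOp_survival_le_one hK _ hb hK3 _, ?_,
        survival_eq hK _ hb hK3 _⟩
      intro h0
      have h := one_sub_le_survival (b := b) hac (t s) (⟨1, le_rfl, hK⟩ : Set.Icc 1 K)
      rw [h0, htv s hs] at h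
      simp only [ContinuousMap.zero_apply] at h
      linarith [hs.2])
  set κ : ℝ → ℝ := fun s => D.l (survival hac b (t s)) with hκ
  have hc := D.curvature_pos hb
  -- At criticality the scalar relation is `(1 - s)(1 - κ) / κ² → curvature`, and `κ → 0` removes
  -- the factor `1 - κ`.
  have h5 : Tendsto (fun s => (1 - s) / κ s ^ 2) (𝓝[<] 1) (𝓝 (D.curvature b)) := by
    have h6 := h4.div (h2.const_sub 1) (by norm_num)
    rw [sub_zero, div_one] at h6
    refine h6.congr' ?_
    filter_upwards [h1, hI, h2.eventually (gt_mem_nhds one_pos)] with s h7 hs h8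
    have h7' : κ s ≠ 0 := h7.ne'
    have h8' : 1 - κ s ≠ 0 := by
      have : κ s < 1 := h8
      linarith
    change ((1 - (t s : ℝ)) / κ s ^ 2 + ((1 - (1 - (t s : ℝ))) * (b * D.r) - 1) / κ s) / (1 - κ s) = _
    rw [htv s hs, hcrit]
    field_simp
    ring
  have h6 := (Real.continuous_sqrt.tendsto _).comp (h5.inv₀ hc.ne')
  have h7 := ((childFunctional hK ρ v).continuous.tendsto D.h).comp h3
  have h8 := h7.mul h6
  rw [Real.sqrt_inv, ← div_eq_mul_inv] at h8
  refine h8.congr' ?_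
  filter_upwards [h1, hI] with s h9 hs
  have h9' : 0 < κ s := h9
  simp only [Function.comp_apply, map_smul, smul_eq_mul]
  rw [childFunctional_survival hK hac (t s) hvK, htv s hs, inv_div,
    Real.sqrt_div (sq_nonneg _), Real.sqrt_sq h9'.le]
  change (κ s)⁻¹ * _ * _ = _
  field_simp

/-- The generating function of the tail is its `n = 0` term plus `s (1 - genFun) / (1 - s)`. After
multiplication by `√(1 - s)` the first term vanishes in the limit and `one_sub_genFun_asymptotics`
gives the second; `√π` is `Γ(1/2)`. -/
lemma probSizeGE_asymptotics (hK : 1 ≤ K) (hac : (ρ : Measure I) ≪ volume) (hb : 1 < b)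
    (hK3 : 3 ≤ K) (D : PerronData (childOp hK b hac)) (hcrit : b * D.r = 1) {v : ℝ} (hv0 : 0 ≤ v)
    (hvK : v + 1 ≤ K) :
    Tendsto (fun n : ℕ => (n : ℝ) ^ (1 / 2 : ℝ) * probSizeGE b ρ v n) atTop
      (𝓝 (childFunctional hK ρ v D.h / √(D.curvature b) / √Real.pi)) := by
  have : Nonempty (Set.Icc 1 K) := ⟨⟨1, le_rfl, hK⟩⟩
  have h0 : ∀ n, 0 ≤ probSizeGE b ρ v n := fun n => measureReal_nonneg
  have h1 : ∀ n, probSizeGE b ρ v n ≤ 1 := fun n => measureReal_le_one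
  refine tendsto_sqrt_mul_of_antitone h0 h1 (antitone_probSizeGE v) (div_nonneg
    (childFunctional_nonneg hK ρ v fun θ => D.c_pos.le.trans (D.h_ge θ)) (Real.sqrt_nonneg _)) ?_
  have h2 : Tendsto (fun s : ℝ => √(1 - s) * probSizeGE b ρ v 0) (𝓝[<] 1) (𝓝 0) := by
    have : Continuous fun s : ℝ => √(1 - s) * probSizeGE b ρ v 0 := by fun_prop
    simpa using (this.tendsto 1).mono_left nhdsWithin_le_nhds
  have h3 : Tendsto (fun s : ℝ => s) (𝓝[<] 1) (𝓝 1) := tendsto_id.mono_left nhdsWithin_le_nhds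
  have h4 := h2.add (h3.mul (one_sub_genFun_asymptotics hK hac hb hK3 D hcrit hvK))
  rw [zero_add, one_mul] at h4
  refine h4.congr' ?_
  filter_upwards [Ioo_mem_nhdsLT (zero_lt_one (α := ℝ))] with s hs
  have hsum : Summable fun n => probSizeGE b ρ v n * s ^ n :=
    Summable.of_nonneg_of_le (fun n => mul_nonneg (h0 n) (pow_nonneg hs.1.le n))
      (fun n => mul_le_of_le_one_left (pow_nonneg hs.1.le n) (h1 n))
      (summable_geometric_of_lt_one hs.1.le hs.2)
  have h5 : 0 < √(1 - s) := Real.sqrt_pos.2 (by linarith [hs.2])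
  have h6 : √(1 - s) * √(1 - s) = 1 - s := Real.mul_self_sqrt (by linarith [hs.2])
  rw [hsum.tsum_eq_zero_add, one_sub_genFun_eq_tsum hac hv0 hs.1.le hs.2, ← Real.sqrt_eq_rpow,
    pow_zero, mul_one, mul_add]
  congr 1
  simp only [pow_succ, ← mul_assoc]
  rw [tsum_mul_right, mul_div_right_comm]
  generalize (∑' n : ℕ, probSizeGE b ρ v (n + 1) * s ^ n) = y
  have h7 : (1 - s) / √(1 - s) = √(1 - s) := by rw [← h6, Real.sqrt_mul_self h5.le]; field_simp
  rw [h7]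
  ring

end Asymptotic

end TreeAvalanche

/-! ### The main theorem -/

theorem theorem4p1 (b : ℕ) (hb : 1 < b) (ρ : ProbabilityMeasure I) (hρ : IsFlat b ρ)
    (hcrit : frakZ b ρ = 1 / (b : ℝ)) :
    ∃ τ T Θ : ℝ → ℝ,
      (∀ v, 1 - xStar ρ < v → 0 < τ v) ∧
      (∀ v, 1 - xStar ρ < v → 0 < T v) ∧
      (∀ v, 0 ≤ v → 0 ≤ Θ v) ∧
      (∀ v, 1 - xStar ρ < v → 0 < Θ v) ∧
      -- approach from the subcritical side
      (∀ ρ' : ProbabilityMeasure I, IsFlat b ρ' →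
        (∀ α : I, 0 < α → frakZ b (mix ρ ρ' α) < 1 / (b : ℝ)) →
        ∀ v, 1 - xStar ρ < v →
          (∀ᶠ α in 𝓝[>] (0 : I), expectedSize b (mix ρ ρ' α) v < ∞) ∧
          (fun α : I => (expectedSize b (mix ρ ρ' α) v).toReal) ~[𝓝[>] (0 : I)]
            fun α : I => τ v / (1 / (b : ℝ) - frakZ b (mix ρ ρ' α))) ∧
      -- at criticality
      (∀ v, 0 ≤ v →
        (fun n : ℕ => probSizeGE b ρ v n) ~[atTop]
          fun n : ℕ => Θ v / (n : ℝ) ^ (1 / 2 : ℝ)) ∧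
      -- approach from the supercritical side
      (∀ ρ' : ProbabilityMeasure I, IsFlat b ρ' →
        (∀ α : I, 0 < α → 1 / (b : ℝ) < frakZ b (mix ρ ρ' α)) →
        ∀ v, 1 - xStar ρ < v →
          (fun α : I => probInfinite b (mix ρ ρ' α) v) ~[𝓝[>] (0 : I)]
            fun α : I => (frakZ b (mix ρ ρ' α) - 1 / (b : ℝ)) * T v) := by
  have hac := hρ.absolutelyContinuous
  have hb0 : (0 : ℝ) < b := by exact_mod_cast (by omega : 0 < b)
  -- The energy range depends on `v`, so that the root energy `X + v` lies below `K`; the eigenvalue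
  -- is the same for all these spaces, being `frakZ`.
  have hK3 : ∀ v : ℝ, 3 ≤ 3 + |v| := fun v => by linarith [abs_nonneg v]
  have hK : ∀ v : ℝ, 1 ≤ 3 + |v| := fun v => by linarith [abs_nonneg v]
  have hvK : ∀ v : ℝ, v + 1 ≤ 3 + |v| := fun v => by linarith [le_abs_self v]
  have hne : ∀ v : ℝ, Nonempty (Set.Icc 1 (3 + |v|)) := fun v => ⟨⟨1, le_rfl, hK v⟩⟩
  choose D _ using fun v : ℝ => exists_true_iff_nonempty.2
    (exists_perronData_childOp (hK v) hac hb (hK3 v) hρ.measureReal_pos)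
  have hr : ∀ v, b * (D v).r = 1 := fun v => by
    rw [← frakZ_eq (hK v) hac hb (hK3 v) (D v), hcrit, mul_one_div, div_self hb0.ne']
  have hv0 : ∀ v, 1 - xStar ρ < v → 0 ≤ v := fun v hv => by linarith [xStar_le_one ρ]
  have hcurv : ∀ v, 0 < (D v).curvature b := fun v => (D v).curvature_pos hb
  have hh : ∀ v, 1 - xStar ρ < v → 0 < childFunctional (hK v) ρ v (D v).h := fun v hv =>
    childFunctional_h_pos (hK v) hac (D v) hv
  have hpi := Real.sqrt_pos.2 Real.pi_pos
  classical
  -- The factors of `b` convert between `1 - b r` and `1/b - r`. All three amplitudes are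
  -- proportional to the expectation of `h` at the root energy, on the event that the root
  -- avalanches.
  refine ⟨fun v => childFunctional (hK v) ρ v (D v).h / b,
    fun v => b * (childFunctional (hK v) ρ v (D v).h / (D v).curvature b),
    fun v => if 1 - xStar ρ < v then
      childFunctional (hK v) ρ v (D v).h / √((D v).curvature b) / √Real.pi else 0,
    fun v hv => div_pos (hh v hv) hb0,
    fun v hv => mul_pos hb0 (div_pos (hh v hv) (hcurv v)), fun v _ => ?_, fun v hv => ?_,
    fun ρ' hρ' hsub v hv => ?_, fun v hv => ?_, fun ρ' hρ' hsup v hv => ?_⟩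
  · dsimp only
    split_ifs with hv
    · exact div_nonneg (div_nonneg (hh v hv).le (Real.sqrt_nonneg _)) (Real.sqrt_nonneg _)
    · exact le_rfl
  · simp only [if_pos hv]
    exact div_pos (div_pos (hh v hv) (Real.sqrt_pos.2 (hcurv v))) hpi
  · have hac' := absolutelyContinuous_mix hac hρ'.absolutelyContinuous
    choose D' _ using fun α : I => exists_true_iff_nonempty.2
      (exists_perronData_childOp (hK v) (hac' α) hb (hK3 v)
        (mix_measureReal_pos hρ.measureReal_pos hρ'.measureReal_pos α))
    have hz : ∀ α, frakZ b (mix ρ ρ' α) = (D' α).r := fun α =>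
      frakZ_eq (hK v) (hac' α) hb (hK3 v) (D' α)
    have hz' : ∀ α : I, 0 < α → b * (D' α).r < 1 := fun α hα => by
      have := hsub α hα
      rw [hz, lt_div_iff₀ hb0] at this
      linarith
    obtain ⟨h1, h2⟩ := expectedSize_asymptotics (hK v) hac hac' (D v) D' hb (hK3 v) (hr v) hz'
      (hv0 v hv) (hvK v) hv
    have hpos : ∀ᶠ α in 𝓝[>] (0 : I), 0 < α := self_mem_nhdsWithin
    refine ⟨h1, isEquivalent_of_div ?_ ?_⟩
    · filter_upwards [hpos] with α hα
      exact div_ne_zero (div_pos (hh v hv) hb0).ne' (by linarith [hsub α hα])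
    · have h3 := h2.div_const (childFunctional (hK v) ρ v (D v).h)
      rw [div_self (hh v hv).ne'] at h3
      refine h3.congr' ?_
      filter_upwards [hpos] with α hα
      have h4 := hz' α hα
      have h5 : 1 - b * (D' α).r ≠ 0 := by linarith
      have h6 := (hh v hv).ne'
      have h7 : 1 / (b : ℝ) - frakZ b (mix ρ ρ' α) = (1 - b * (D' α).r) / b := by
        rw [hz]; field_simp
      rw [h7]
      field_simp
  · by_cases hv' : 1 - xStar ρ < v
    · have h1 := probSizeGE_asymptotics (hK v) hac hb (hK3 v) (D v) (hr v) hv (hvK v)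
      simp only [if_pos hv']
      have h0 := div_pos (div_pos (hh v hv') (Real.sqrt_pos.2 (hcurv v))) hpi
      refine isEquivalent_of_div ?_ ?_
      · filter_upwards [eventually_gt_atTop 0] with n hn
        exact (div_pos h0 (Real.rpow_pos_of_pos (by exact_mod_cast hn) _)).ne'
      · have h3 := h1.div_const (childFunctional (hK v) ρ v (D v).h / √((D v).curvature b) / √Real.pi)
        rw [div_self h0.ne'] at h3
        refine h3.congr fun n => ?_
        generalize childFunctional (hK v) ρ v (D v).h / √((D v).curvature b) / √Real.pi = y
        rw [div_div_eq_mul_div, mul_comm]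
    · simp only [if_neg hv', zero_div]
      refine (EventuallyEq.isEquivalent ?_)
      filter_upwards [eventually_ne_atTop 0] with n hn
      exact probSizeGE_eq_zero hac hv (not_lt.1 hv') hn
  · have hac' := absolutelyContinuous_mix hac hρ'.absolutelyContinuous
    choose D' _ using fun α : I => exists_true_iff_nonempty.2
      (exists_perronData_childOp (hK v) (hac' α) hb (hK3 v)
        (mix_measureReal_pos hρ.measureReal_pos hρ'.measureReal_pos α))
    have hz : ∀ α, frakZ b (mix ρ ρ' α) = (D' α).r := fun α =>
      frakZ_eq (hK v) (hac' α) hb (hK3 v) (D' α)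
    have hz' : ∀ α : I, 0 < α → 1 < b * (D' α).r := fun α hα => by
      have := hsup α hα
      rw [hz, div_lt_iff₀ hb0] at this
      linarith
    have h2 := probInfinite_asymptotics (hK v) hac hac' (D v) D' hb (hK3 v) (hr v) hz'
      (hv0 v hv) (hvK v)
    have hpos : ∀ᶠ α in 𝓝[>] (0 : I), 0 < α := self_mem_nhdsWithin
    have h0 := div_pos (hh v hv) (hcurv v)
    refine isEquivalent_of_div ?_ ?_
    · filter_upwards [hpos] with α hα
      exact mul_ne_zero (by linarith [hsup α hα]) (mul_pos hb0 h0).ne'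
    · have h3 := h2.div_const (childFunctional (hK v) ρ v (D v).h / (D v).curvature b)
      rw [div_self h0.ne'] at h3
      refine h3.congr' ?_
      filter_upwards [hpos] with α hα
      have h7 : frakZ b (mix ρ ρ' α) - 1 / (b : ℝ) = (b * (D' α).r - 1) / b := by
        rw [hz]; field_simp
      rw [h7, div_div, ← mul_assoc, div_mul_cancel₀ _ hb0.ne']
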